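/- Let $n,m>1$ be integers. For $\mathbf q\in\mathbb Z^n$ put $|\mathbf q|=\max_i|q_i|$, and let $\|y\|$ be the distance from $y\in\mathbb R$ to the nearest integer. Let $\psi:\mathbb Z^n\to(0,\infty)$ satisfy $\psi(\mathbf q)<1$ for all but finitely many $\mathbf q$, and be non-increasing in the sense that $\psi(\mathbf q)\ge\psi(\mathbf q')$ whenever every coordinate $q_\ell$ lies between $0$ and $q'_\ell$ (both included). Let $$\mathcal M^\times(n,m;\psi)=\Big\{\mathbf x=(\mathbf x_1,\dots,\mathbf x_m)\in[0,1]^{nm}:\ \prod_{j=1}^m\|\mathbf q\mathbf x_j\|<\psi(\mathbf q)\ \text{for infinitely many }\mathbf q\in\mathbb Z^n\Big\},$$ where $\mathbf x$ is an $n\times m$ matrix with columns $\mathbf x_j$ and $\mathbf q\mathbf x_j=\sum_i q_ix_{i,j}$. Call a function $f:[0,\infty)\to\mathbb R$ admissible if it satisfies the following conditions. 1. $f$ is continuous and non-decreasing, and $f(0)=0$. 2. For all $0<x<y$, $\ f(x)x^{-(nm-1)}\le f(y)y^{-(nm-1)}$ and $f(y)y^{-nm}\le f(x)x^{-nm}$;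 moreover $f(r)r^{-nm}\to\infty$ as $r\to0^+$. 3. For every $0<t<1$ there are $r_0>0$ and $C>0$ such that $$C^{-1}\alpha^{nm}\le\frac{f(\alpha r)}{f(r)}\le C\alpha^{nm}\qquad\text{for all } r>0 \text{ and } 1<\alpha<r^{-t}\text{ with }\alpha r<r_0 .$$ For $E\subset\mathbb R^{nm}$ let $\mathcal H^f(E)=\lim_{\eta\to0^+}\inf\sum_i f(|B_i|)$, where the infimum is over countable covers of $E$ by Euclidean balls $B_i$ of diameter $|B_i|\le\eta$. Then, for every admissible $f$, $$\mathcal H^f\big(\mathcal M^\times(n,m;\psi)\big)=\begin{cases}0&\text{if }S<\infty,\\ \mathcal H^f([0,1]^{nm})&\text{if }S=\infty,\end{cases}$$ where $$S=\sum_{\mathbf q\in\mathbb Z^n\setminus\{0\}}f\Big(\frac{\psi(\mathbf q)}{|\mathbf q|}\Big)\Big(\frac{\psi(\mathbf q)}{|\mathbf q|}\Big)^{1-nm}|\mathbf q|\,\log^{m-1}\big(\psi(\mathbf q)^{-1}\big).$$ An example is $f(r)=r^{nm}\log(1/r)$: there is an admissible function that equals $r^{nm}\log(1/r)$ for all sufficiently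 small $r>0$. -/

import Mathlib

open scoped ENNReal

/-- A dimension function: a continuous non-decreasing function on `[0, ∞)` vanishing at `0`
(the values at negative reals are never used). -/
structure IsDimensionFunction (f : ℝ → ℝ) : Prop where
  continuousOn : ContinuousOn f (Set.Ici 0)
  monotoneOn : MonotoneOn f (Set.Ici 0)
  map_zero : f 0 = 0

/-- `f ⪯ s`. -/
def PrecEq (f : ℝ → ℝ) (s : ℝ) : Prop :=
  ∀ x y : ℝ, 0 < x → x < y → f y / y ^ s ≤ f x / x ^ s

/-- `f ≺ s`: `f ⪯ s` and `f r / r ^ s → ∞` as `r → 0⁺`. -/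
def Prec (f : ℝ → ℝ) (s : ℝ) : Prop :=
  PrecEq f s ∧ Filter.Tendsto (fun r : ℝ => f r / r ^ s) (nhdsWithin 0 (Set.Ioi 0)) Filter.atTop

/-- `s ⪯ f`. -/
def EqPrec (s : ℝ) (f : ℝ → ℝ) : Prop :=
  ∀ x y : ℝ, 0 < x → x < y → f x / x ^ s ≤ f y / y ^ s

/-- For every `0 < t < 1` there is `r₀ > 0` such that `f (α r) / f r ≍ α ^ d` for all
`1 < α < r ^ (-t)` with `α r < r₀`; the implied constant may depend on `t` (and on `f`, `d`). -/
def GrowthCondition (d : ℕ) (f : ℝ → ℝ) : Prop :=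
  ∀ t : ℝ, 0 < t → t < 1 → ∃ r₀ : ℝ, 0 < r₀ ∧ ∃ C : ℝ, 0 < C ∧
    ∀ r α : ℝ, 0 < r → 1 < α → α < r ^ (-t) → α * r < r₀ →
      C⁻¹ * α ^ d ≤ f (α * r) / f r ∧ f (α * r) / f r ≤ C * α ^ d

/-- The dimension functions admitted in dimension `d`: `(d - 1) ⪯ f ≺ d` and the growth
condition with exponent `d`. -/
structure IsAdmissible (d : ℕ) (f : ℝ → ℝ) : Prop where
  dimensionFunction : IsDimensionFunction f
  eqPrec : EqPrec ((d : ℝ) - 1) f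
  prec : Prec f (d : ℝ)
  growth : GrowthCondition d f

/-- `ψ : ℤⁿ → ℝ` is non-increasing in every coordinate away from the origin:
`ψ q ≥ ψ q'` whenever each coordinate `q ℓ` lies between `0` and `q' ℓ`. -/
def NonIncreasing {n : ℕ} (ψ : (Fin n → ℤ) → ℝ) : Prop :=
  ∀ q q' : Fin n → ℤ, (∀ l, q l ∈ Set.uIcc 0 (q' l)) → ψ q' ≤ ψ q

/-- The infimum of `∑ f (|Bᵢ|)` over countable covers of `E` by (closed, possibly degenerate)
balls `Bᵢ` of diameter at most `η`. -/
noncomputable def hausdorffPremeasure {X : Type*} [PseudoMetricSpace X]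
    (f : ℝ → ℝ) (η : ℝ) (E : Set X) : ℝ≥0∞ :=
  ⨅ (c : ℕ → X) (r : ℕ → ℝ) (_ : E ⊆ ⋃ i, Metric.closedBall (c i) (r i))
    (_ : ∀ i, Metric.diam (Metric.closedBall (c i) (r i)) ≤ η),
    ∑' i, ENNReal.ofReal (f (Metric.diam (Metric.closedBall (c i) (r i))))

/-- The Hausdorff `f`-measure: the limit of the premeasures as `η → 0⁺`, which is their supremum
because they increase as `η` decreases. -/
noncomputable def hausdorffFMeasure {X : Type*} [PseudoMetricSpace X]
    (f : ℝ → ℝ) (E : Set X) : ℝ≥0∞ :=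
  ⨆ (η : ℝ) (_ : 0 < η), hausdorffPremeasure f η E

/-- The distance of a real number to the nearest integer. -/
noncomputable def distInt (y : ℝ) : ℝ := |y - (round y : ℝ)|

/-- The unit cube `[0,1]^{nm}` in the Euclidean space of real `n × m` matrices. -/
def unitCube (n m : ℕ) : Set (EuclideanSpace ℝ (Fin n × Fin m)) :=
  {x | ∀ p, 0 ≤ x p ∧ x p ≤ 1}

/-- `M^×(n,m;ψ)`: the matrices `x` in the unit cube, with columns `x₁, …, x_m`, such that
`∏ⱼ ‖q xⱼ‖ < ψ q` for infinitely many `q ∈ ℤⁿ`. -/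
def multSet (n m : ℕ) (ψ : (Fin n → ℤ) → ℝ) : Set (EuclideanSpace ℝ (Fin n × Fin m)) :=
  {x | x ∈ unitCube n m ∧
    {q : Fin n → ℤ | ∏ j : Fin m, distInt (∑ i : Fin n, (q i : ℝ) * x (i, j)) < ψ q}.Infinite}

/-- The general term of the series; `‖q‖` is the maximum of the `|q i|`. -/
noncomputable def seriesTerm (n m : ℕ) (f : ℝ → ℝ) (ψ : (Fin n → ℤ) → ℝ) (q : Fin n → ℤ) : ℝ :=
  f (ψ q / ‖q‖) * (ψ q / ‖q‖) ^ (1 - (n : ℤ) * (m : ℤ)) * ‖q‖ * Real.log ((ψ q)⁻¹) ^ (m - 1)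

/-!
Write `d = n m` and `g r = f r / r ^ d`. Since `f ≺ d`, `g` tends to infinity at `0`, so the cube
itself has infinite `f`-measure, and the claim is that the measure of the limsup set is `0` or
infinite according to the behaviour of the series
`∑ g (ψ q / ‖q‖) * ψ q * log ^ (m - 1) (1 / ψ q)`.

*Convergence.* The region `∏ ‖q xⱼ‖ < ψ q` splits into boxes `‖q xⱼ‖ ≲ 2 ^ (-bⱼ)` with
`∑ bⱼ ≈ log₂ (1 / ψ q)`. There are about `log ^ (m - 1) (1 / ψ q)` of them, each of volume about
`ψ q`. A volume count bounds the number of dyadic cubes of side about `ψ q / ‖q‖` that meet the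
region (`exists_cells_of_prod_lt`). The resulting balls have total `f`-mass at most a multiple of
the term of the series (`IsAdmissible.exists_cover_multSlice`), and a Borel-Cantelli argument
concludes.

*Divergence.* Choosing a coordinate `i₀` at which `|q i|` is maximal, and a sign, one may sum over
vectors whose coordinate `q i₀` is positive and dominates. As `g` is comparable at polynomially
related scales, `ψ q / ‖q‖` may be replaced by `1 / ‖q‖`, and as `ψ` is monotone, `q i₀` may be
replaced by a slightly smaller integer with few small prime factors, since such integers have
positive lower density (`summable_dominantCone`). For these vectors, neighbourhoods of the
hyperplanes `q y = p` with `p` coprime to `q i₀` have the expected volume up to constants in every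
fixed dyadic cube, and for different vectors they are quasi-independent: if the vectors are not
parallel because the two linear forms are independent on the torus, and if they are parallel
because reduced fractions with different denominators repel each other
(`volume_colCube_near_coprime_inter_le`). Products of such neighbourhoods over the columns form a
`QuasiIndepFamily`, with height the dyadic size of `q i₀` and weight the volume.

For such a family Lebesgue measure can be moved onto the sets of large height without concentrating
too much mass on any small cube (`QuasiIndepFamily.exists_redistribution`): a sum of multiples
`w q ≤ g (2 ^ (-k q)) / A` of the indicators has mean about `1`, and the dyadic cubes on which its
mean is too large are discarded. They carry little mass, because a large mean of a sum with small
weights forces a large off-diagonal second moment, while quasi-independence bounds the latter.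
Iteration gives probability densities with decreasing compact supports all of which satisfy a
Frostman condition with the same small constant, and compactness turns this into a lower bound for
the `f`-mass of every cover of the limsup set. The constant being arbitrary, the measure is
infinite. The growth condition on `f` enters only through the comparison of polynomially related
scales.
-/

open scoped NNReal
open MeasureTheory

/-! ### Dyadic cubes -/

/-- The real `n × m` matrices, stored as the family of their `m` columns. -/
abbrev Cols (n m : ℕ) := Fin m → Fin n → ℝ

/-- The index of the dyadic cube of side `2⁻ˡ` that contains `x`. -/
noncomputable def dyIdx {n m : ℕ} (l : ℕ) (x : Cols n m) : Fin m → Fin n → ℤ :=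
  fun j i => ⌊(2 : ℝ) ^ l * x j i⌋

/-- The half-open dyadic cube of side `2⁻ˡ` that contains `x`. -/
def cell {n m : ℕ} (l : ℕ) (x : Cols n m) : Set (Cols n m) := {y | dyIdx l y = dyIdx l x}

/-- `h` is constant on every dyadic cube of side `2⁻ˡ`. For a set `S` this is used with
`h = (· ∈ S)`, and then says that `S` is a union of such cubes. -/
def IsStep {n m : ℕ} {α : Type*} (l : ℕ) (h : Cols n m → α) : Prop :=
  ∀ x y, dyIdx l x = dyIdx l y → h x = h y

section Cells

variable {n m : ℕ}

theorem mem_cell_self (l : ℕ) (x : Cols n m) : x ∈ cell l x := rfl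

theorem dyIdx_eq_of_succ {l : ℕ} {x y : Cols n m} (h : dyIdx (l + 1) x = dyIdx (l + 1) y) :
    dyIdx l x = dyIdx l y := by
  have key : ∀ a : ℝ, ⌊(2 : ℝ) ^ l * a⌋ = ⌊(2 : ℝ) ^ (l + 1) * a⌋ / 2 := by
    intro a
    have := Int.floor_div_natCast ((2 : ℝ) ^ (l + 1) * a) 2
    rw [show ((2 : ℕ) : ℤ) = 2 by rfl] at this
    rw [← this]
    congr 1
    push_cast
    ring
  funext j i
  have := congrFun (congrFun h j) i
  simp only [dyIdx] at this ⊢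
  rw [key, key, this]

theorem dyIdx_eq_of_le {l l' : ℕ} (hl : l ≤ l') {x y : Cols n m}
    (h : dyIdx l' x = dyIdx l' y) : dyIdx l x = dyIdx l y := by
  induction l', hl using Nat.le_induction with
  | base => exact h
  | succ k _ ih => exact ih (dyIdx_eq_of_succ h)

theorem IsStep.mono {α : Type*} {l l' : ℕ} {h : Cols n m → α} (hs : IsStep l h) (hl : l ≤ l') :
    IsStep l' h := fun x y hxy => hs x y (dyIdx_eq_of_le hl hxy)

theorem isStep_cell {l l' : ℕ} (hl : l ≤ l') (x : Cols n m) : IsStep l' (· ∈ cell l x) := by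
  intro y z hyz
  simp only [cell, Set.mem_ofPred_eq, dyIdx_eq_of_le hl hyz]

theorem cell_subset_cell {l l' : ℕ} (hl : l ≤ l') {x y : Cols n m} (h : y ∈ cell l x) :
    cell l' y ⊆ cell l x := fun _ hz => (dyIdx_eq_of_le hl hz).trans h

theorem cell_eq_of_mem {l : ℕ} {x y : Cols n m} (h : y ∈ cell l x) : cell l y = cell l x := by
  ext z
  simp only [cell, Set.mem_ofPred_eq] at h ⊢
  rw [h]

theorem measurable_dyIdx (l : ℕ) : Measurable (dyIdx (n := n) (m := m) l) := by
  unfold dyIdx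
  fun_prop

theorem IsStep.measurable {α : Type*} [MeasurableSpace α] [Nonempty α] {l : ℕ}
    {h : Cols n m → α} (hs : IsStep l h) : Measurable h := by
  classical
  have : h = (fun z => if hz : ∃ x, dyIdx l x = z then h hz.choose
      else Classical.arbitrary α) ∘ dyIdx l := by
    funext x
    have hx : ∃ y, dyIdx l y = dyIdx l x := ⟨x, rfl⟩
    simp only [Function.comp, dif_pos hx]
    exact (hs _ _ hx.choose_spec).symm
  rw [this]
  exact (measurable_of_countable _).comp (measurable_dyIdx l)

theorem IsStep.measurableSet {l : ℕ} {S : Set (Cols n m)} (hs : IsStep l (· ∈ S)) :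
    MeasurableSet S := measurable_mem.1 hs.measurable

theorem measurableSet_cell (l : ℕ) (x : Cols n m) : MeasurableSet (cell l x) :=
  (isStep_cell le_rfl x).measurableSet

theorem cell_eq_pi (l : ℕ) (x : Cols n m) :
    cell l x = Set.pi Set.univ fun j => Set.pi Set.univ fun i =>
      Set.Ico ((dyIdx l x j i : ℝ) / 2 ^ l) ((dyIdx l x j i + 1 : ℝ) / 2 ^ l) := by
  ext y
  simp only [cell, Set.mem_ofPred_eq, Set.mem_pi, Set.mem_univ, true_implies, Set.mem_Ico,
    funext_iff]
  refine forall_congr' fun j => forall_congr' fun i => ?_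
  have h2 : (0 : ℝ) < 2 ^ l := by positivity
  rw [div_le_iff₀ h2, lt_div_iff₀ h2, mul_comm (y j i)]
  exact Int.floor_eq_iff

theorem volume_cell (l : ℕ) (x : Cols n m) :
    volume (cell l x) = ((2 : ℝ≥0∞)⁻¹ ^ l) ^ (n * m) := by
  rw [cell_eq_pi, volume_pi_pi]
  have : ∀ j, volume (Set.pi Set.univ fun i => Set.Ico ((dyIdx l x j i : ℝ) / 2 ^ l)
      ((dyIdx l x j i + 1 : ℝ) / 2 ^ l)) = ((2 : ℝ≥0∞)⁻¹ ^ l) ^ n := by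
    intro j
    rw [volume_pi_pi]
    have : ∀ i, volume (Set.Ico ((dyIdx l x j i : ℝ) / 2 ^ l)
        ((dyIdx l x j i + 1 : ℝ) / 2 ^ l)) = (2 : ℝ≥0∞)⁻¹ ^ l := by
      intro i
      rw [Real.volume_Ico, ← sub_div, add_sub_cancel_left, one_div, ← inv_pow,
        ENNReal.ofReal_pow (by positivity), ENNReal.ofReal_inv_of_pos (by norm_num)]
      norm_num
    simp [this]
  simp [this, pow_mul]

theorem volume_cell_ne_zero (l : ℕ) (x : Cols n m) : volume (cell l x) ≠ 0 := by
  rw [volume_cell]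
  exact pow_ne_zero _ (pow_ne_zero _ (by simp))

theorem volume_cell_ne_top (l : ℕ) (x : Cols n m) : volume (cell l x) ≠ ⊤ := by
  rw [volume_cell]
  exact ENNReal.pow_ne_top (ENNReal.pow_ne_top (by simp))

theorem volume_cell_succ (l : ℕ) (x y : Cols n m) :
    volume (cell l x) = 2 ^ (n * m) * volume (cell (l + 1) y) := by
  rw [volume_cell, volume_cell, ← mul_pow, pow_succ', ← mul_assoc,
    ENNReal.mul_inv_cancel (by simp) (by simp), one_mul]

/-- A comparison of two measures on the dyadic cubes of side `2⁻ˡ` passes to unions of such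
cubes. -/
theorem measure_le_of_cells {l : ℕ} {S : Set (Cols n m)} (hS : IsStep l (· ∈ S))
    {μ ν : Measure (Cols n m)} (h : ∀ x ∈ S, μ (cell l x) ≤ ν (cell l x)) : μ S ≤ ν S := by
  have hU : S = ⋃ z ∈ dyIdx l '' S, dyIdx l ⁻¹' {z} := by
    ext x
    simp only [Set.mem_iUnion, Set.mem_preimage, Set.mem_singleton_iff, exists_prop]
    constructor
    · intro hx
      exact ⟨_, ⟨x, hx, rfl⟩, rfl⟩
    · rintro ⟨_, ⟨y, hy, rfl⟩, hxy⟩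
      exact (hS _ _ hxy).mpr hy
  have hm : ∀ z ∈ dyIdx l '' S, MeasurableSet (dyIdx l ⁻¹' {z}) := fun z _ =>
    measurable_dyIdx l (measurableSet_singleton z)
  have hd : (dyIdx l '' S).PairwiseDisjoint (fun z => dyIdx (n := n) (m := m) l ⁻¹' {z}) := by
    intro z _ z' _ hzz
    refine Set.disjoint_left.2 fun x hx hx' => hzz ?_
    exact hx.symm.trans hx'
  rw [hU, measure_biUnion (Set.to_countable _) hd hm, measure_biUnion (Set.to_countable _) hd hm]
  refine ENNReal.tsum_le_tsum ?_
  rintro ⟨_, x, hx, rfl⟩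
  exact h x hx

theorem measure_eq_of_cells {l : ℕ} {S : Set (Cols n m)} (hS : IsStep l (· ∈ S))
    {μ ν : Measure (Cols n m)} (h : ∀ x ∈ S, μ (cell l x) = ν (cell l x)) : μ S = ν S :=
  le_antisymm (measure_le_of_cells hS fun x hx => (h x hx).le)
    (measure_le_of_cells hS fun x hx => (h x hx).ge)

theorem setLIntegral_cell_of_isStep {l : ℕ} {h : Cols n m → ℝ≥0∞} (hs : IsStep l h)
    {l' : ℕ} (hl : l ≤ l') (x : Cols n m) {k : Cols n m → ℝ≥0∞} (hk : Measurable k) :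
    ∫⁻ y in cell l' x, h y * k y = h x * ∫⁻ y in cell l' x, k y := by
  rw [← lintegral_const_mul _ hk]
  exact setLIntegral_congr_fun (measurableSet_cell l' x)
    (fun y hy => by rw [hs y x (dyIdx_eq_of_le hl hy)])

end Cells

/-! ### Weighted sums of indicators and their second moments -/

section Layer

variable {n m : ℕ} {ι : Type*}

/-- The weighted sum of indicators `∑ q ∈ Q, w q • 1_{U q}`. -/
noncomputable def layer (U : ι → Set (Cols n m)) (w : ι → ℝ≥0) (Q : Finset ι) (x : Cols n m) :
    ℝ≥0 := ∑ q ∈ Q, w q * (U q).indicator 1 x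

/-- The off-diagonal part of the square of `layer U w Q`. -/
noncomputable def crossLayer [DecidableEq ι] (U : ι → Set (Cols n m)) (w : ι → ℝ≥0) (Q : Finset ι)
    (x : Cols n m) : ℝ≥0 :=
  ∑ p ∈ Q.offDiag, w p.1 * w p.2 * (U p.1 ∩ U p.2).indicator 1 x

theorem layer_le_sum (U : ι → Set (Cols n m)) (w : ι → ℝ≥0) (Q : Finset ι) (x : Cols n m) :
    layer U w Q x ≤ ∑ q ∈ Q, w q := by
  refine Finset.sum_le_sum fun q _ => ?_
  by_cases hx : x ∈ U q <;> simp [hx]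

theorem layer_mono (U : ι → Set (Cols n m)) (w : ι → ℝ≥0) {Q Q' : Finset ι} (h : Q ⊆ Q')
    (x : Cols n m) : layer U w Q x ≤ layer U w Q' x :=
  Finset.sum_le_sum_of_subset h

theorem crossLayer_mono [DecidableEq ι] (U : ι → Set (Cols n m)) (w : ι → ℝ≥0) {Q Q' : Finset ι}
    (h : Q ⊆ Q') (x : Cols n m) : crossLayer U w Q x ≤ crossLayer U w Q' x :=
  Finset.sum_le_sum_of_subset (Finset.offDiag_mono h)

theorem measurable_layer {U : ι → Set (Cols n m)} (hU : ∀ q, MeasurableSet (U q)) (w : ι → ℝ≥0)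
    (Q : Finset ι) : Measurable (layer U w Q) :=
  Finset.measurable_fun_sum _ fun q _ =>
    (measurable_const.indicator (hU q)).const_mul _

theorem measurable_crossLayer [DecidableEq ι] {U : ι → Set (Cols n m)}
    (hU : ∀ q, MeasurableSet (U q)) (w : ι → ℝ≥0) (Q : Finset ι) :
    Measurable (crossLayer U w Q) :=
  Finset.measurable_fun_sum _ fun p _ =>
    (measurable_const.indicator ((hU p.1).inter (hU p.2))).const_mul _

theorem lintegral_indicator_coe (S U : Set (Cols n m)) (hU : MeasurableSet U) :
    ∫⁻ x in S, ((U.indicator (1 : Cols n m → ℝ≥0) x : ℝ≥0) : ℝ≥0∞) = volume (U ∩ S) := by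
  have : (fun x => ((U.indicator (1 : Cols n m → ℝ≥0) x : ℝ≥0) : ℝ≥0∞)) = U.indicator 1 := by
    funext x
    by_cases hx : x ∈ U <;> simp [hx]
  rw [this, lintegral_indicator_one hU, Measure.restrict_apply hU]

theorem setLIntegral_layer {U : ι → Set (Cols n m)} (hU : ∀ q, MeasurableSet (U q)) (w : ι → ℝ≥0)
    (Q : Finset ι) (S : Set (Cols n m)) :
    ∫⁻ x in S, layer U w Q x = ∑ q ∈ Q, w q * volume (U q ∩ S) := by
  simp only [layer, ENNReal.ofNNReal_finsetSum, ENNReal.coe_mul]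
  rw [lintegral_finsetSum]
  · refine Finset.sum_congr rfl fun q _ => ?_
    rw [lintegral_const_mul, lintegral_indicator_coe _ _ (hU q)]
    exact (measurable_const.indicator (hU q)).coe_nnreal_ennreal
  · exact fun q _ => ((measurable_const.indicator (hU q)).coe_nnreal_ennreal).const_mul _

theorem setLIntegral_crossLayer [DecidableEq ι] {U : ι → Set (Cols n m)}
    (hU : ∀ q, MeasurableSet (U q)) (w : ι → ℝ≥0) (Q : Finset ι) (S : Set (Cols n m)) :
    ∫⁻ x in S, crossLayer U w Q x =
      ∑ p ∈ Q.offDiag, w p.1 * w p.2 * volume (U p.1 ∩ U p.2 ∩ S) := by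
  simp only [crossLayer, ENNReal.ofNNReal_finsetSum, ENNReal.coe_mul]
  rw [lintegral_finsetSum]
  · refine Finset.sum_congr rfl fun p _ => ?_
    rw [lintegral_const_mul, lintegral_indicator_coe _ _ ((hU p.1).inter (hU p.2))]
    exact (measurable_const.indicator ((hU p.1).inter (hU p.2))).coe_nnreal_ennreal
  · exact fun p _ => ((measurable_const.indicator
      ((hU p.1).inter (hU p.2))).coe_nnreal_ennreal).const_mul _

theorem layer_sq_le [DecidableEq ι] (U : ι → Set (Cols n m)) (w : ι → ℝ≥0) (Q : Finset ι) {t : ℝ≥0}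
    (hw : ∀ q ∈ Q, w q ≤ t) (x : Cols n m) :
    layer U w Q x ^ 2 ≤ t * layer U w Q x + crossLayer U w Q x := by
  have h1 : ∀ q q', (w q * (U q).indicator 1 x) * (w q' * (U q').indicator 1 x) =
      w q * w q' * (U q ∩ U q').indicator (1 : Cols n m → ℝ≥0) x := by
    intro q q'
    by_cases h : x ∈ U q <;> by_cases h' : x ∈ U q' <;> simp [h, h']
  rw [sq, layer, Finset.sum_mul_sum, ← Finset.sum_product', ← Finset.diag_union_offDiag,
    Finset.sum_union (Finset.disjoint_diag_offDiag Q), Finset.sum_diag]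
  refine add_le_add ?_ (le_of_eq ?_)
  · rw [Finset.mul_sum]
    refine Finset.sum_le_sum fun q hq => ?_
    rw [h1, Set.inter_self, mul_assoc]
    exact mul_le_mul_left (hw q hq) _
  · exact Finset.sum_congr rfl fun p _ => h1 _ _

/-- If a layer all of whose weights are at most `t` has a mean larger than `c t` on `S`, then
the second moment, whose diagonal part is controlled by the first moment, bounds `t |S|`. -/
theorem mul_volume_le_of_le_layer [DecidableEq ι] {U : ι → Set (Cols n m)}
    (hU : ∀ q, MeasurableSet (U q)) (w : ι → ℝ≥0) (Q : Finset ι) {t c : ℝ≥0} (ht : 0 < t)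
    (hw : ∀ q ∈ Q, w q ≤ t) {S : Set (Cols n m)} (hS : volume S ≠ ⊤)
    (h : (c * t : ℝ≥0) * volume S ≤ ∫⁻ x in S, layer U w Q x) :
    (c ^ 2 * t : ℝ≥0) * volume S ≤
      ∫⁻ x in S, ((layer U w Q x + t⁻¹ * crossLayer U w Q x : ℝ≥0) : ℝ≥0∞) := by
  have hF := measurable_layer hU w Q
  have hX := measurable_crossLayer hU w Q
  set F := layer U w Q
  set X := crossLayer U w Q
  have hpt : ∀ x, 2 * (c * t) * F x ≤ t * (F x + t⁻¹ * X x) + (c * t) ^ 2 := by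
    intro x
    have h1 := layer_sq_le U w Q hw x
    have h2 := two_mul_le_add_sq (c * t) (F x)
    have h3 : t * (F x + t⁻¹ * X x) = t * F x + X x := by
      rw [mul_add, ← mul_assoc t, mul_inv_cancel₀ ht.ne', one_mul]
    rw [h3]
    calc 2 * (c * t) * F x ≤ (c * t) ^ 2 + F x ^ 2 := h2
      _ ≤ _ := by rw [add_comm]; exact add_le_add_left h1 _
  have hint : (2 * (c * t) : ℝ≥0) * ∫⁻ x in S, (F x : ℝ≥0∞) ≤
      t * (∫⁻ x in S, ((F x + t⁻¹ * X x : ℝ≥0) : ℝ≥0∞)) + ((c * t) ^ 2 : ℝ≥0) * volume S := by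
    rw [← lintegral_const_mul _ hF.coe_nnreal_ennreal,
      ← lintegral_const_mul _ (by fun_prop), ← setLIntegral_const, ← lintegral_add_right _ (by fun_prop)]
    refine lintegral_mono fun x => ?_
    have := ENNReal.coe_le_coe.2 (hpt x)
    simpa only [ENNReal.coe_add, ENNReal.coe_mul, ENNReal.coe_pow] using this
  set I := ∫⁻ x in S, ((F x + t⁻¹ * X x : ℝ≥0) : ℝ≥0∞)
  have h4 : ((c * t) ^ 2 : ℝ≥0) * volume S + ((c * t) ^ 2 : ℝ≥0) * volume S ≤
      t * I + ((c * t) ^ 2 : ℝ≥0) * volume S := by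
    refine le_trans ?_ hint
    calc _ = ((2 * (c * t) : ℝ≥0) : ℝ≥0∞) * (((c * t : ℝ≥0) : ℝ≥0∞) * volume S) := by
            push_cast; ring
      _ ≤ _ := by gcongr
  have h5 := (ENNReal.add_le_add_iff_right (ENNReal.mul_ne_top ENNReal.coe_ne_top hS)).1 h4
  have h6 : (t : ℝ≥0∞) * ((c ^ 2 * t : ℝ≥0) * volume S) ≤ t * I := by
    refine le_trans (le_of_eq ?_) h5
    push_cast; ring
  exact (ENNReal.mul_le_mul_iff_right (by exact_mod_cast ht.ne') ENNReal.coe_ne_top).1 h6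

end Layer

/-! ### Overloaded cubes -/

section Layer

variable {n m : ℕ} {ι : Type*}

theorem isStep_layer {U : ι → Set (Cols n m)} (w : ι → ℝ≥0) (Q : Finset ι) {l : ℕ}
    (hU : ∀ q ∈ Q, IsStep l (· ∈ U q)) : IsStep l (layer U w Q) := by
  intro x y hxy
  refine Finset.sum_congr rfl fun q hq => ?_
  have := hU q hq x y hxy
  by_cases hx : x ∈ U q
  · have hy : y ∈ U q := by simpa [hx] using this
    simp [hx, hy]
  · have hy : y ∉ U q := by simpa [hx] using this
    simp [hx, hy]

/-- A dyadic cube is overloaded by `F` when the mean of `F` exceeds `B (1 + t l)`. -/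
def Overloaded (F : Cols n m → ℝ≥0) (B : ℝ≥0) (t : ℕ → ℝ≥0) (l : ℕ) (x : Cols n m) : Prop :=
  (B * (1 + t l) : ℝ≥0) * volume (cell l x) < ∫⁻ y in cell l x, F y

theorem isStep_overloaded (F : Cols n m → ℝ≥0) (B : ℝ≥0) (t : ℕ → ℝ≥0) {l l' : ℕ} (hl : l ≤ l') :
    IsStep l' (Overloaded F B t l) := by
  intro x y hxy
  have : cell l x = cell l y := cell_eq_of_mem (dyIdx_eq_of_le hl hxy)
  simp only [Overloaded, this]

/-- The union of the overloaded cubes of side `2⁻ˡ`, `N < l ≤ L'`. -/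
def overloadedSet (F : Cols n m → ℝ≥0) (B : ℝ≥0) (t : ℕ → ℝ≥0) (N L' : ℕ) : Set (Cols n m) :=
  {x | ∃ l, N < l ∧ l ≤ L' ∧ Overloaded F B t l x}

theorem isStep_overloadedSet (F : Cols n m → ℝ≥0) (B : ℝ≥0) (t : ℕ → ℝ≥0) (N L' : ℕ) :
    IsStep L' (· ∈ overloadedSet F B t N L') := by
  intro x y hxy
  simp only [overloadedSet, Set.mem_ofPred_eq]
  refine propext (exists_congr fun l => and_congr_right fun _ => and_congr_right fun h => ?_)
  rw [isStep_overloaded F B t h x y hxy]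

/-- The stopping-time decomposition: if every overloaded cube whose predecessors are not
overloaded satisfies `∫ F ≤ ∫ K`, then so does the part of the overloaded set in any cube. -/
theorem setLIntegral_overloadedSet_le {F : Cols n m → ℝ≥0} {K : Cols n m → ℝ≥0∞}
    {B : ℝ≥0} {t : ℕ → ℝ≥0} {N L' L : ℕ} (hL : L ≤ N) (x₀ : Cols n m)
    (h : ∀ l x, N < l → l ≤ L' → x ∈ cell L x₀ → Overloaded F B t l x →
      (∀ l', N < l' → l' < l → ¬ Overloaded F B t l' x) →
        ∫⁻ y in cell l x, F y ≤ ∫⁻ y in cell l x, K y) :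
    ∫⁻ y in overloadedSet F B t N L' ∩ cell L x₀, F y ≤ ∫⁻ y in cell L x₀, K y := by
  set W : ℕ → Set (Cols n m) := fun l => {x | (N < l ∧ l ≤ L' ∧ Overloaded F B t l x ∧
      ∀ l', N < l' → l' < l → ¬ Overloaded F B t l' x) ∧ x ∈ cell L x₀} with hW
  have hstep : ∀ l, IsStep l (· ∈ W l) := by
    intro l x y hxy
    by_cases hl : N < l
    · have h1 : Overloaded F B t l x = Overloaded F B t l y :=
        isStep_overloaded F B t le_rfl x y hxy
      have h2 : (x ∈ cell L x₀) = (y ∈ cell L x₀) := isStep_cell (by omega) x₀ x y hxy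
      have h3 : ∀ l', l' < l → (Overloaded F B t l' x = Overloaded F B t l' y) := fun l' hl' =>
        isStep_overloaded F B t hl'.le x y hxy
      simp only [hW, Set.mem_ofPred_eq, h1, h2]
      refine propext (and_congr_left fun _ => and_congr_right fun _ => and_congr_right fun _ =>
        and_congr_right fun _ => forall_congr' fun l' => imp_congr_right fun _ =>
        forall_congr' fun hl' => ?_)
      rw [h3 l' hl']
    · simp [hW, hl]
  have hmeas : ∀ l, MeasurableSet (W l) := fun l => (hstep l).measurableSet
  have hdisj : Pairwise (Function.onFun Disjoint W) := by
    intro l l' hll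
    refine Set.disjoint_left.2 fun x hx hx' => ?_
    obtain ⟨⟨h1, -, h3, h4⟩, -⟩ := hx
    obtain ⟨⟨h1', -, h3', h4'⟩, -⟩ := hx'
    rcases lt_or_gt_of_ne hll with hlt | hlt
    · exact h4' l h1 hlt h3
    · exact h4 l' h1' hlt h3'
  have hcov : overloadedSet F B t N L' ∩ cell L x₀ ⊆ ⋃ l, W l := by
    classical
    rintro x ⟨hx, hx0⟩
    have hx' : ∃ l, N < l ∧ l ≤ L' ∧ Overloaded F B t l x := hx
    refine Set.mem_iUnion.2 ⟨Nat.find hx', ⟨⟨(Nat.find_spec hx').1, (Nat.find_spec hx').2.1,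
      (Nat.find_spec hx').2.2, fun l' h1 h2 h3 => ?_⟩, hx0⟩⟩
    exact Nat.find_min hx' h2 ⟨h1, h2.le.trans (Nat.find_spec hx').2.1, h3⟩
  calc ∫⁻ y in overloadedSet F B t N L' ∩ cell L x₀, F y
      ≤ ∫⁻ y in ⋃ l, W l, F y := lintegral_mono_set hcov
    _ = ∑' l, ∫⁻ y in W l, F y := lintegral_iUnion hmeas hdisj _
    _ ≤ ∑' l, ∫⁻ y in W l, K y := by
        refine ENNReal.tsum_le_tsum fun l => ?_
        have := measure_le_of_cells (hstep l)
          (μ := volume.withDensity fun y => (F y : ℝ≥0∞)) (ν := volume.withDensity K) ?_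
        · rwa [withDensity_apply _ (hmeas l), withDensity_apply _ (hmeas l)] at this
        · rintro x ⟨⟨h1, h2, h3, h4⟩, h5⟩
          rw [withDensity_apply _ (measurableSet_cell _ _),
            withDensity_apply _ (measurableSet_cell _ _)]
          exact h l x h1 h2 h5 h3 h4
    _ = ∫⁻ y in ⋃ l, W l, K y := (lintegral_iUnion hmeas hdisj _).symm
    _ ≤ ∫⁻ y in cell L x₀, K y := by
        refine lintegral_mono_set (Set.iUnion_subset fun l x hx => hx.2)

end Layer

/-! ### Quasi-independent families of sets -/

/-- The standing assumptions on a family of subsets `U q` of the unit cube with heights `k q` and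
weights `v q`: each `U q` has density comparable to `v q` in every fixed dyadic cube
once `k q` is large, density at most a multiple of `v q` in every dyadic cube of side at least
`2 ^ (-k q)`, and the sets are pairwise quasi-independent. -/
structure QuasiIndepFamily {n m : ℕ} {ι : Type*} (U : ι → Set (Cols n m)) (k : ι → ℕ)
    (v : ι → ℝ≥0) (c₁ C₂ C₃ : ℝ≥0) : Prop where
  pos : 0 < c₁
  isStep : ∀ q, ∃ l, IsStep l (· ∈ U q)
  subset : ∀ q, U q ⊆ cell 0 0
  lower : ∀ L, ∃ N, ∀ q, N ≤ k q → ∀ x ∈ cell (n := n) (m := m) 0 0,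
    (c₁ * v q : ℝ≥0) * volume (cell L x) ≤ volume (U q ∩ cell L x)
  upper : ∀ q l x, l ≤ k q →
    volume (U q ∩ cell l x) ≤ (C₂ * v q : ℝ≥0) * volume (cell l x)
  inter : ∀ q q', q ≠ q' → volume (U q ∩ U q') ≤ (C₃ * (v q * v q') : ℝ≥0)

section Step

variable {n m : ℕ} {ι : Type*} {U : ι → Set (Cols n m)} {k : ι → ℕ} {v : ι → ℝ≥0} {c₁ C₂ C₃ : ℝ≥0}

theorem QuasiIndepFamily.measurableSet (H : QuasiIndepFamily U k v c₁ C₂ C₃) (q : ι) :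
    MeasurableSet (U q) := (H.isStep q).choose_spec.measurableSet

theorem QuasiIndepFamily.setLIntegral_layer_le (H : QuasiIndepFamily U k v c₁ C₂ C₃)
    {w : ι → ℝ≥0} {Q : Finset ι} (hw : ∑ q ∈ Q, w q * v q ≤ 1) {l : ℕ} (hl : ∀ q ∈ Q, l ≤ k q)
    (x : Cols n m) : ∫⁻ y in cell l x, layer U w Q y ≤ C₂ * volume (cell l x) := by
  rw [setLIntegral_layer H.measurableSet]
  calc ∑ q ∈ Q, w q * volume (U q ∩ cell l x)
      ≤ ∑ q ∈ Q, w q * ((C₂ * v q : ℝ≥0) * volume (cell l x)) :=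
        Finset.sum_le_sum fun q hq => by gcongr; exact H.upper q l x (hl q hq)
    _ = ((∑ q ∈ Q, w q * v q : ℝ≥0) : ℝ≥0∞) * (C₂ * volume (cell l x)) := by
        rw [ENNReal.ofNNReal_finsetSum, Finset.sum_mul]
        refine Finset.sum_congr rfl fun q _ => ?_
        push_cast; ring
    _ ≤ 1 * (C₂ * volume (cell l x)) := by gcongr; exact_mod_cast hw
    _ = _ := one_mul _

theorem QuasiIndepFamily.le_setLIntegral_layer (H : QuasiIndepFamily U k v c₁ C₂ C₃)
    {w : ι → ℝ≥0} {Q : Finset ι} (hw : ∑ q ∈ Q, w q * v q = 1) {l : ℕ} {x : Cols n m}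
    (hl : ∀ q ∈ Q, (c₁ * v q : ℝ≥0) * volume (cell l x) ≤ volume (U q ∩ cell l x)) :
    c₁ * volume (cell l x) ≤ ∫⁻ y in cell l x, layer U w Q y := by
  rw [setLIntegral_layer H.measurableSet]
  calc c₁ * volume (cell l x)
      = ((∑ q ∈ Q, w q * v q : ℝ≥0) : ℝ≥0∞) * (c₁ * volume (cell l x)) := by simp [hw]
    _ = ∑ q ∈ Q, w q * ((c₁ * v q : ℝ≥0) * volume (cell l x)) := by
        rw [ENNReal.ofNNReal_finsetSum, Finset.sum_mul]
        refine Finset.sum_congr rfl fun q _ => ?_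
        push_cast; ring
    _ ≤ _ := Finset.sum_le_sum fun q hq => by gcongr; exact hl q hq

theorem QuasiIndepFamily.setLIntegral_crossLayer_le [DecidableEq ι]
    (H : QuasiIndepFamily U k v c₁ C₂ C₃)
    {w : ι → ℝ≥0} {Q : Finset ι} (hw : ∑ q ∈ Q, w q * v q ≤ 1) (S : Set (Cols n m)) :
    ∫⁻ y in S, crossLayer U w Q y ≤ C₃ := by
  rw [setLIntegral_crossLayer H.measurableSet]
  calc ∑ p ∈ Q.offDiag, w p.1 * w p.2 * volume (U p.1 ∩ U p.2 ∩ S)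
      ≤ ∑ p ∈ Q.offDiag, ((C₃ * ((w p.1 * v p.1) * (w p.2 * v p.2)) : ℝ≥0) : ℝ≥0∞) := by
        refine Finset.sum_le_sum fun p hp => ?_
        calc w p.1 * w p.2 * volume (U p.1 ∩ U p.2 ∩ S)
            ≤ w p.1 * w p.2 * ((C₃ * (v p.1 * v p.2) : ℝ≥0) : ℝ≥0∞) := by
              gcongr
              exact (measure_mono Set.inter_subset_left).trans
                (H.inter _ _ (Finset.mem_offDiag.1 hp).2.2)
          _ = _ := by push_cast; ring
    _ ≤ ∑ p ∈ Q ×ˢ Q, ((C₃ * ((w p.1 * v p.1) * (w p.2 * v p.2)) : ℝ≥0) : ℝ≥0∞) := by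
        refine Finset.sum_le_sum_of_subset fun p hp => ?_
        have := Finset.mem_offDiag.1 hp
        exact Finset.mem_product.2 ⟨this.1, this.2.1⟩
    _ = ((C₃ * ((∑ q ∈ Q, w q * v q) * ∑ q ∈ Q, w q * v q) : ℝ≥0) : ℝ≥0∞) := by
        rw [← ENNReal.ofNNReal_finsetSum, ← Finset.mul_sum, Finset.sum_mul_sum, Finset.sum_product]
    _ ≤ C₃ := by
        refine ENNReal.coe_le_coe.2 ?_
        calc _ ≤ C₃ * (1 * 1) := by gcongr
          _ = C₃ := by ring

/-- The overloaded cubes carry only a small part of a layer in a dyadic cube of side `2⁻ᴸ`. -/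
theorem QuasiIndepFamily.setLIntegral_overloadedSet_le
    (H : QuasiIndepFamily U k v c₁ C₂ C₃) {w : ι → ℝ≥0} {Q : Finset ι}
    (hw : ∑ q ∈ Q, w q * v q ≤ 1) {t : ℕ → ℝ≥0} (ht : Monotone t) {B : ℝ≥0} (hB : C₂ ≤ B)
    (hB0 : 0 < B) {L N L' : ℕ} (hLN : L ≤ N) (hQ : ∀ q ∈ Q, N ≤ k q) (hwt : ∀ q ∈ Q, w q ≤ t (k q))
    (htN : 1 ≤ t N) (x₀ : Cols n m) (htL : 1 ≤ (t N : ℝ≥0∞) * volume (cell L x₀)) :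
    ∫⁻ y in overloadedSet (layer U w Q) B t N L' ∩ cell L x₀, layer U w Q y ≤
      (2 ^ (n * m + 1) / B * (C₂ + C₃) : ℝ≥0) * volume (cell L x₀) := by
  classical
  -- A maximal overloaded cube of side `2 ^ (-(l + 1))` satisfies two inequalities: its mean is at
  -- most a multiple of `B t (l + 1)`, because its parent is not overloaded, and the mean of the
  -- density in `K` is at least `B ^ 2 t (l + 1)` by the second moment, which gains a factor `B`.
  set F := layer U w Q with hF
  have hFm : Measurable F := measurable_layer H.measurableSet w Q
  have hXm : Measurable (crossLayer U w Q) := measurable_crossLayer H.measurableSet w Q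
  set K : Cols n m → ℝ≥0∞ := fun x =>
    ((2 ^ (n * m + 1) / B * (F x + (t N)⁻¹ * crossLayer U w Q x) : ℝ≥0) : ℝ≥0∞) with hK
  have htN0 : 0 < t N := lt_of_lt_of_le one_pos htN
  refine (_root_.setLIntegral_overloadedSet_le (K := K) hLN x₀ ?_).trans ?_
  · intro l x hl _ _ hover hnot
    obtain ⟨l, rfl⟩ : ∃ l', l = l' + 1 := ⟨l - 1, by omega⟩
    have hNl : N ≤ l := by omega
    have htl : 1 ≤ t (l + 1) := htN.trans (ht hl.le)
    have htl' : t l ≤ t (l + 1) := ht (Nat.le_succ l)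
    have htl0 : 0 < t (l + 1) := lt_of_lt_of_le one_pos htl
    -- the parent cube is not overloaded
    have hpar : ∫⁻ y in cell l x, F y ≤ (B * (1 + t l) : ℝ≥0) * volume (cell l x) := by
      rcases hNl.eq_or_lt with rfl | hlt
      · refine (H.setLIntegral_layer_le hw hQ x).trans ?_
        gcongr
        calc C₂ ≤ B := hB
          _ ≤ B * (1 + t N) := le_mul_of_one_le_right' (by simp)
      · exact not_lt.1 (hnot l hlt (Nat.lt_succ_self l))
    have h1 : ∫⁻ y in cell (l + 1) x, F y ≤
        (2 ^ (n * m + 1) * B * t (l + 1) : ℝ≥0) * volume (cell (l + 1) x) := by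
      calc ∫⁻ y in cell (l + 1) x, F y ≤ ∫⁻ y in cell l x, F y :=
            lintegral_mono_set (cell_subset_cell (Nat.le_succ l) (mem_cell_self l x))
        _ ≤ _ := hpar
        _ = (2 ^ (n * m) * B * (1 + t l) : ℝ≥0) * volume (cell (l + 1) x) := by
            rw [volume_cell_succ l x x]; push_cast; ring
        _ ≤ _ := by
            gcongr ?_ * _
            refine ENNReal.coe_le_coe.2 ?_
            calc 2 ^ (n * m) * B * (1 + t l) ≤ 2 ^ (n * m) * B * (t (l + 1) + t (l + 1)) := by gcongr
              _ = _ := by ring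
    -- split off the sets of large height, whose contribution is harmless
    set Q₁ := Q.filter (fun q => k q < l + 1) with hQ₁
    set Q₂ := Q.filter (fun q => ¬ k q < l + 1) with hQ₂
    have hsplit : ∫⁻ y in cell (l + 1) x, F y = (∫⁻ y in cell (l + 1) x, layer U w Q₁ y) +
        ∫⁻ y in cell (l + 1) x, layer U w Q₂ y := by
      simp only [hF, setLIntegral_layer H.measurableSet]
      exact (Finset.sum_filter_add_sum_filter_not Q _ _).symm
    have h2 : ∫⁻ y in cell (l + 1) x, layer U w Q₂ y ≤ C₂ * volume (cell (l + 1) x) :=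
      H.setLIntegral_layer_le
        ((Finset.sum_le_sum_of_subset (Finset.filter_subset _ _)).trans hw)
        (fun q hq => not_lt.1 (Finset.mem_filter.1 hq).2) x
    have hvt := volume_cell_ne_top (l + 1) x
    have h3 : (B * t (l + 1) : ℝ≥0) * volume (cell (l + 1) x) ≤
        ∫⁻ y in cell (l + 1) x, layer U w Q₁ y := by
      have h4 : (B * (1 + t (l + 1)) : ℝ≥0) * volume (cell (l + 1) x) ≤
          (∫⁻ y in cell (l + 1) x, layer U w Q₁ y) + B * volume (cell (l + 1) x) := by
        refine le_trans (le_of_lt hover) ?_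
        rw [hsplit]
        gcongr
        exact h2.trans (by gcongr)
      have h5 : ((B * (1 + t (l + 1)) : ℝ≥0) : ℝ≥0∞) * volume (cell (l + 1) x) =
          (B * t (l + 1) : ℝ≥0) * volume (cell (l + 1) x) + B * volume (cell (l + 1) x) := by
        push_cast; ring
      rw [h5] at h4
      exact (ENNReal.add_le_add_iff_right (ENNReal.mul_ne_top ENNReal.coe_ne_top hvt)).1 h4
    have h6 := mul_volume_le_of_le_layer H.measurableSet w Q₁ htl0
      (fun q hq => (hwt q (Finset.mem_filter.1 hq).1).trans
        (ht (Finset.mem_filter.1 hq).2.le)) hvt h3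
    have h7 : ((B ^ 2 * t (l + 1) : ℝ≥0) : ℝ≥0∞) * volume (cell (l + 1) x) ≤
        ∫⁻ y in cell (l + 1) x, ((F y + (t N)⁻¹ * crossLayer U w Q y : ℝ≥0) : ℝ≥0∞) := by
      refine h6.trans (lintegral_mono fun y => ENNReal.coe_le_coe.2 ?_)
      have hi : (t (l + 1))⁻¹ ≤ (t N)⁻¹ := inv_anti₀ htN0 (ht hl.le)
      exact add_le_add (layer_mono U w (Finset.filter_subset _ _) y)
        (mul_le_mul' hi (crossLayer_mono U w (Finset.filter_subset _ _) y))
    have hKint : ∫⁻ y in cell (l + 1) x, K y = (2 ^ (n * m + 1) / B : ℝ≥0) *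
        ∫⁻ y in cell (l + 1) x, ((F y + (t N)⁻¹ * crossLayer U w Q y : ℝ≥0) : ℝ≥0∞) := by
      rw [← lintegral_const_mul _ (by fun_prop)]
      simp only [hK, ENNReal.coe_mul]
    rw [hKint]
    calc _ ≤ _ := h1
      _ = (2 ^ (n * m + 1) / B : ℝ≥0) *
          (((B ^ 2 * t (l + 1) : ℝ≥0) : ℝ≥0∞) * volume (cell (l + 1) x)) := by
          rw [← mul_assoc, ← ENNReal.coe_mul]
          congr 2
          field_simp
      _ ≤ _ := by gcongr
  · have hKint : ∫⁻ y in cell L x₀, K y = (2 ^ (n * m + 1) / B : ℝ≥0) *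
        ((∫⁻ y in cell L x₀, F y) + ((t N)⁻¹ : ℝ≥0) * ∫⁻ y in cell L x₀, crossLayer U w Q y) := by
      rw [← lintegral_const_mul _ (by fun_prop), ← lintegral_add_left (by fun_prop),
        ← lintegral_const_mul _ (by fun_prop)]
      simp only [hK, ENNReal.coe_mul, ENNReal.coe_add]
    rw [hKint, ENNReal.coe_mul, mul_assoc]
    gcongr
    have h1 := H.setLIntegral_layer_le hw (fun q hq => hLN.trans (hQ q hq)) x₀
    have h2 := H.setLIntegral_crossLayer_le hw (cell L x₀)
    have h3 : (((t N)⁻¹ : ℝ≥0) : ℝ≥0∞) ≤ volume (cell L x₀) := by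
      rw [ENNReal.coe_inv htN0.ne']
      exact (ENNReal.inv_le_iff_le_mul (fun _ => by simp [htN0.ne']) (by simp)).2 htL
    calc _ ≤ C₂ * volume (cell L x₀) + volume (cell L x₀) * C₃ := by gcongr
      _ = _ := by push_cast; ring

end Step

/-! ### Redistribution of Lebesgue measure -/

section Step

variable {n m : ℕ} {ι : Type*} {U : ι → Set (Cols n m)} {k : ι → ℕ} {v : ι → ℝ≥0} {c₁ C₂ C₃ : ℝ≥0}

/-- Once the overloaded set is discarded, no cube is overloaded any more. -/
theorem setLIntegral_cell_inter_compl_overloadedSet {F : Cols n m → ℝ≥0} {B : ℝ≥0} {t : ℕ → ℝ≥0}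
    (ht : Monotone t) {N L' : ℕ} (hF : IsStep L' F) (hNL : N < L')
    (hlow : ∀ l x, l ≤ N → ∫⁻ y in cell l x, F y ≤ B * volume (cell l x)) (l : ℕ) (x : Cols n m) :
    ∫⁻ y in cell l x, (overloadedSet F B t N L')ᶜ.indicator (fun y => (F y : ℝ≥0∞)) y ≤
      (B * (1 + t l) : ℝ≥0) * volume (cell l x) := by
  set W := overloadedSet F B t N L' with hW
  have hWm : MeasurableSet W := (isStep_overloadedSet F B t N L').measurableSet
  have hle : ∀ y, Wᶜ.indicator (fun y => (F y : ℝ≥0∞)) y ≤ F y := fun y =>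
    Set.indicator_le_self' (fun _ _ => zero_le) y
  have hBt : ∀ l, B ≤ B * (1 + t l) := fun l => le_mul_of_one_le_right' (by simp)
  have hmid : ∀ l, N < l → l ≤ L' →
      ∫⁻ y in cell l x, Wᶜ.indicator (fun y => (F y : ℝ≥0∞)) y ≤
      (B * (1 + t l) : ℝ≥0) * volume (cell l x) := by
    intro l h1 h2
    by_cases ho : Overloaded F B t l x
    · have : ∫⁻ y in cell l x, Wᶜ.indicator (fun y => (F y : ℝ≥0∞)) y = ∫⁻ y in cell l x, 0 := by
        refine setLIntegral_congr_fun (measurableSet_cell l x) fun y hy => ?_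
        have hyW : y ∈ W := ⟨l, h1, h2, (isStep_overloaded F B t le_rfl y x hy).mpr ho⟩
        simp [hyW]
      rw [this]; simp
    · exact (lintegral_mono hle).trans (not_lt.1 ho)
  rcases le_or_gt l N with hl | hl
  · refine (lintegral_mono hle).trans ((hlow l x hl).trans ?_)
    gcongr
    exact hBt l
  rcases le_or_gt l L' with hl' | hl'
  · exact hmid l hl hl'
  -- below the resolution of `F` the mean over a cube is the mean over its predecessor
  have hst : IsStep L' (Wᶜ.indicator fun y => (F y : ℝ≥0∞)) := by
    intro y z hyz
    have h1 : (y ∈ W) = (z ∈ W) := isStep_overloadedSet F B t N L' y z hyz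
    have h2 := hF y z hyz
    by_cases hy : y ∈ W
    · have hz : z ∈ W := h1.mp hy
      simp [hy, hz]
    · have hz : z ∉ W := fun h => hy (h1.mpr h)
      simp [hy, hz, h2]
  have hval : ∀ l, L' ≤ l → ∫⁻ y in cell l x, Wᶜ.indicator (fun y => (F y : ℝ≥0∞)) y =
      Wᶜ.indicator (fun y => (F y : ℝ≥0∞)) x * volume (cell l x) := by
    intro l hl
    have := setLIntegral_cell_of_isStep hst hl x (k := fun _ => 1) measurable_const
    simpa using this
  have h1 := hmid L' hNL le_rfl
  rw [hval L' le_rfl] at h1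
  rw [hval l hl'.le]
  have h2 := (ENNReal.mul_le_mul_iff_left (volume_cell_ne_zero L' x) (volume_cell_ne_top L' x)).1 h1
  gcongr
  refine h2.trans (ENNReal.coe_le_coe.2 ?_)
  gcongr
  exact ht hl'.le

/-- Weights proportional to `t (k q)` and normalized so that the expected mean is `1`. -/
theorem exists_weights {t : ℕ → ℝ≥0} (hdiv : ∀ (N : ℕ) (T : ℝ≥0), ∃ Q : Finset ι,
      (∀ q ∈ Q, N ≤ k q) ∧ T ≤ ∑ q ∈ Q, t (k q) * v q) (N : ℕ) :
    ∃ (Q : Finset ι) (w : ι → ℝ≥0), (∀ q ∈ Q, N ≤ k q) ∧ (∀ q, w q ≤ t (k q)) ∧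
      ∑ q ∈ Q, w q * v q = 1 := by
  obtain ⟨Q, hQ, hT⟩ := hdiv N 1
  set T := ∑ q ∈ Q, t (k q) * v q with hTdef
  have hT0 : 0 < T := lt_of_lt_of_le one_pos hT
  refine ⟨Q, fun q => t (k q) / T, hQ, fun q => div_le_self zero_le hT, ?_⟩
  simp only [div_mul_eq_mul_div, ← Finset.sum_div]
  exact div_self hT0.ne'

/-- Redistribution of Lebesgue measure. On every dyadic cube of side `2⁻ᴸ` Lebesgue measure is
replaced by a measure of the same mass which is carried by finitely many sets `U q` of
large height, in such a way that the density of every smaller cube of side `2⁻ˡ` is at most a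
multiple of `1 + G l / A`, with a constant that does not depend on `L` and `A`. -/
theorem QuasiIndepFamily.exists_redistribution (H : QuasiIndepFamily U k v c₁ C₂ C₃) {G : ℕ → ℝ≥0}
    (hG : Monotone G) (hGtop : ∀ K, ∃ l, K ≤ G l)
    (hdiv : ∀ (N : ℕ) (T : ℝ≥0), ∃ Q : Finset ι, (∀ q ∈ Q, N ≤ k q) ∧ T ≤ ∑ q ∈ Q, G (k q) * v q) :
    ∃ B : ℝ≥0, ∀ (L : ℕ) (A : ℝ≥0) (N₀ : ℕ), 0 < A →
      ∃ (g : Cols n m → ℝ≥0∞) (L' : ℕ) (Q : Finset ι), L ≤ L' ∧ (∀ q ∈ Q, N₀ ≤ k q) ∧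
        IsStep L' g ∧ (∃ M : ℝ≥0, ∀ x, g x ≤ M) ∧ (∀ x, g x ≠ 0 → ∃ q ∈ Q, x ∈ U q) ∧
        (∀ x ∈ cell (n := n) (m := m) 0 0, ∫⁻ y in cell L x, g y = volume (cell L x)) ∧
        ∀ l x, L < l → ∫⁻ y in cell l x, g y ≤ (B * (1 + G l / A) : ℝ≥0) * volume (cell l x) := by
  have hc := H.pos
  -- `B` is so large that the overloaded cubes carry at most half of the guaranteed mean `c₁`
  set B : ℝ≥0 := C₂ + 2 ^ (n * m + 2) * (C₂ + C₃) / c₁ + 1 with hBdef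
  have hB0 : 0 < B := by positivity
  have hB2 : C₂ ≤ B := by rw [hBdef, add_assoc]; exact le_self_add
  have hB3 : 2 ^ (n * m + 1) / B * (C₂ + C₃) ≤ c₁ / 2 := by
    have h1 : 2 ^ (n * m + 2) * (C₂ + C₃) ≤ c₁ * B := by
      calc 2 ^ (n * m + 2) * (C₂ + C₃) = c₁ * (2 ^ (n * m + 2) * (C₂ + C₃) / c₁) := by
            field_simp
        _ ≤ c₁ * B := by
            gcongr
            rw [hBdef, add_assoc, add_left_comm]; exact le_self_add
    rw [div_mul_eq_mul_div, div_le_div_iff₀ hB0 two_pos]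
    calc _ = 2 ^ (n * m + 2) * (C₂ + C₃) := by ring
      _ ≤ _ := h1
  refine ⟨2 / c₁ * B, fun L A N₀ hA => ?_⟩
  set t : ℕ → ℝ≥0 := fun l => G l / A with htdef
  have ht : Monotone t := fun a b hab => by simp only [htdef]; gcongr; exact hG hab
  obtain ⟨N₁, hN₁⟩ := H.lower L
  -- from the level `N₂` on, the threshold `t` exceeds the inverse volume of the cubes of level `L`
  obtain ⟨N₂, hN₂⟩ := hGtop (A * 2 ^ (L * (n * m)))
  set N := max (max N₀ L) (max N₁ N₂) with hN
  have hN0 : N₀ ≤ N := (le_max_left _ _).trans (le_max_left _ _)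
  have hNL : L ≤ N := (le_max_right _ _).trans (le_max_left _ _)
  have hNN₁ : N₁ ≤ N := (le_max_left _ _).trans (le_max_right _ _)
  have hNN₂ : N₂ ≤ N := (le_max_right _ _).trans (le_max_right _ _)
  have htN : 2 ^ (L * (n * m)) ≤ t N := by
    simp only [htdef]
    rw [le_div_iff₀ hA, mul_comm]
    exact hN₂.trans (hG hNN₂)
  have htN1 : 1 ≤ t N := le_trans (one_le_pow₀ one_le_two) htN
  have htL : ∀ x : Cols n m, 1 ≤ (t N : ℝ≥0∞) * volume (cell L x) := by
    intro x
    rw [volume_cell, ← pow_mul]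
    calc (1 : ℝ≥0∞) = 2 ^ (L * (n * m)) * 2⁻¹ ^ (L * (n * m)) := by
          rw [← mul_pow, ENNReal.mul_inv_cancel (by simp) (by simp), one_pow]
      _ ≤ _ := by
          gcongr
          calc (2 : ℝ≥0∞) ^ (L * (n * m)) = ((2 ^ (L * (n * m)) : ℝ≥0) : ℝ≥0∞) := by push_cast; rfl
            _ ≤ _ := ENNReal.coe_le_coe.2 htN
  have hdiv' : ∀ (N : ℕ) (T : ℝ≥0), ∃ Q : Finset ι, (∀ q ∈ Q, N ≤ k q) ∧
      T ≤ ∑ q ∈ Q, t (k q) * v q := by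
    intro N T
    obtain ⟨Q, hQ, hT⟩ := hdiv N (A * T)
    refine ⟨Q, hQ, ?_⟩
    simp only [htdef, div_mul_eq_mul_div, ← Finset.sum_div]
    rwa [le_div_iff₀ hA, mul_comm]
  obtain ⟨Q, w, hQ, hwt, hw⟩ := exists_weights hdiv' N
  choose ℓ hℓ using H.isStep
  set L' := max (N + 1) (Q.sup ℓ) with hL'
  have hNL' : N < L' := lt_of_lt_of_le (Nat.lt_succ_self N) (le_max_left _ _)
  set F := layer U w Q with hF
  have hFst : IsStep L' F := isStep_layer w Q fun q hq =>
    (hℓ q).mono ((Finset.le_sup hq).trans (le_max_right _ _))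
  set W := overloadedSet F B t N L' with hWdef
  have hWst : IsStep L' (· ∈ W) := isStep_overloadedSet F B t N L'
  have hWm : MeasurableSet W := hWst.measurableSet
  set F' : Cols n m → ℝ≥0∞ := Wᶜ.indicator (fun y => (F y : ℝ≥0∞)) with hF'
  have hF'st : IsStep L' F' := by
    intro y z hyz
    have h1 : (y ∈ W) = (z ∈ W) := hWst y z hyz
    by_cases hy : y ∈ W
    · have hz : z ∈ W := h1.mp hy
      simp [hF', hy, hz]
    · have hz : z ∉ W := fun h => hy (h1.mpr h)
      simp [hF', hy, hz, hFst y z hyz]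
  have hF'm : Measurable F' := hF'st.measurable
  have hF'le : ∀ y, F' y ≤ F y := fun y => Set.indicator_le_self' (fun _ _ => zero_le) y
  have hFm : Measurable F := measurable_layer H.measurableSet w Q
  -- the part of `F` outside of the overloaded set still has mean at least `c₁ / 2`
  have hmain : ∀ x ∈ cell (n := n) (m := m) 0 0,
      ((c₁ / 2 : ℝ≥0) : ℝ≥0∞) * volume (cell L x) ≤ ∫⁻ y in cell L x, F' y := by
    intro x hx
    have h1 : c₁ * volume (cell L x) ≤ ∫⁻ y in cell L x, F y :=
      H.le_setLIntegral_layer hw fun q hq => hN₁ q (hNN₁.trans (hQ q hq)) x hx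
    have h2 : ∫⁻ y in W ∩ cell L x, F y ≤ ((c₁ / 2 : ℝ≥0) : ℝ≥0∞) * volume (cell L x) := by
      refine (H.setLIntegral_overloadedSet_le hw.le ht hB2 hB0 hNL hQ (fun q _ => hwt q) htN1 x
        (htL x)).trans ?_
      gcongr
    have h3 : ∫⁻ y in cell L x, F y = (∫⁻ y in W ∩ cell L x, F y) + ∫⁻ y in cell L x, F' y := by
      rw [hF', lintegral_indicator hWm.compl, Measure.restrict_restrict hWm.compl,
        ← Measure.restrict_restrict hWm, ← Measure.restrict_restrict hWm.compl]
      exact (lintegral_add_compl _ hWm).symm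
    have h4 : ((c₁ / 2 : ℝ≥0) : ℝ≥0∞) * volume (cell L x) +
        ((c₁ / 2 : ℝ≥0) : ℝ≥0∞) * volume (cell L x) ≤
        ((c₁ / 2 : ℝ≥0) : ℝ≥0∞) * volume (cell L x) + ∫⁻ y in cell L x, F' y := by
      calc _ = c₁ * volume (cell L x) := by
            rw [← add_mul, ← ENNReal.coe_add, add_halves]
        _ ≤ _ := h1
        _ ≤ _ := by rw [h3]; gcongr
    exact (ENNReal.add_le_add_iff_left
      (ENNReal.mul_ne_top ENNReal.coe_ne_top (volume_cell_ne_top L x))).1 h4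
  -- normalizing the remaining mass on each cube of level `L` costs a factor at most `2 / c₁`
  set ρ : Cols n m → ℝ≥0∞ := fun x => volume (cell L x) / ∫⁻ y in cell L x, F' y with hρ
  have hρst : IsStep L ρ := by
    intro x y hxy
    have : cell L x = cell L y := cell_eq_of_mem hxy
    simp only [hρ, this]
  have hρle : ∀ x ∈ cell (n := n) (m := m) 0 0, ρ x ≤ ((2 / c₁ : ℝ≥0) : ℝ≥0∞) := by
    intro x hx
    refine ENNReal.div_le_of_le_mul ?_
    calc volume (cell L x) = ((2 / c₁ : ℝ≥0) : ℝ≥0∞) * (((c₁ / 2 : ℝ≥0) : ℝ≥0∞) *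
          volume (cell L x)) := by
          rw [← mul_assoc, ← ENNReal.coe_mul, div_mul_div_comm, mul_comm c₁,
            div_self (by positivity), ENNReal.coe_one, one_mul]
      _ ≤ _ := by gcongr; exact hmain x hx
  have hF'supp : ∀ x, F' x ≠ 0 → ∃ q ∈ Q, x ∈ U q := by
    intro x hx
    by_contra! hcon
    refine hx (le_antisymm ((hF'le x).trans ?_) zero_le)
    have : F x = 0 := Finset.sum_eq_zero fun q hq => by simp [hcon q hq]
    simp [this]
  have hF'unit : ∀ x, x ∉ cell (n := n) (m := m) 0 0 → F' x = 0 := by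
    intro x hx
    by_contra hne
    obtain ⟨q, -, hq⟩ := hF'supp x hne
    exact hx (H.subset q hq)
  refine ⟨fun x => ρ x * F' x, L', Q, (hNL.trans hNL'.le), fun q hq => hN0.trans (hQ q hq),
    ?_, ⟨2 / c₁ * ∑ q ∈ Q, w q, ?_⟩, fun x hx => hF'supp x (right_ne_zero_of_mul hx), ?_, ?_⟩
  · intro x y hxy
    simp only [hF'st x y hxy, hρst.mono (hNL.trans hNL'.le) x y hxy]
  · intro x
    by_cases hx : x ∈ cell (n := n) (m := m) 0 0
    · rw [ENNReal.coe_mul]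
      exact mul_le_mul' (hρle x hx) ((hF'le x).trans
        (ENNReal.coe_le_coe.2 (layer_le_sum U w Q x)))
    · simp [hF'unit x hx]
  · intro x hx
    rw [setLIntegral_cell_of_isStep hρst le_rfl x hF'm]
    have h0 : ∫⁻ y in cell L x, F' y ≠ 0 := by
      intro h0
      have := hmain x hx
      rw [h0, nonpos_iff_eq_zero, mul_eq_zero] at this
      rcases this with h | h
      · have : (0 : ℝ≥0) < c₁ / 2 := by positivity
        exact this.ne' (by exact_mod_cast h)
      · exact volume_cell_ne_zero L x h
    have htop : ∫⁻ y in cell L x, F' y ≠ ⊤ := by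
      refine ne_top_of_le_ne_top ?_ ((lintegral_mono hF'le).trans
        (H.setLIntegral_layer_le hw.le (fun q hq => hNL.trans (hQ q hq)) x))
      exact ENNReal.mul_ne_top ENNReal.coe_ne_top (volume_cell_ne_top L x)
    exact ENNReal.div_mul_cancel h0 htop
  · intro l x hl
    rw [setLIntegral_cell_of_isStep hρst hl.le x hF'm]
    by_cases hx : x ∈ cell (n := n) (m := m) 0 0
    · have := setLIntegral_cell_inter_compl_overloadedSet (B := B) ht hFst hNL' (fun l x hl =>
        (H.setLIntegral_layer_le hw.le (fun q hq => hl.trans (hQ q hq)) x).trans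
          (by gcongr)) l x
      calc ρ x * ∫⁻ y in cell l x, F' y
          ≤ ((2 / c₁ : ℝ≥0) : ℝ≥0∞) * ((B * (1 + t l) : ℝ≥0) * volume (cell l x)) := by
            gcongr
            exact hρle x hx
        _ = _ := by
            rw [← mul_assoc, ← ENNReal.coe_mul, ← mul_assoc]
    · have : ∫⁻ y in cell l x, F' y = ∫⁻ y in cell l x, 0 := by
        refine setLIntegral_congr_fun (measurableSet_cell l x) fun y hy => hF'unit y fun hy' => hx ?_
        have h1 : dyIdx 0 y = dyIdx 0 x := dyIdx_eq_of_le (Nat.zero_le l) hy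
        exact h1.symm.trans hy'
      rw [this]; simp

end Step

/-! ### A Cantor construction -/

section Cantor

variable {n m : ℕ} {ι : Type*} {U : ι → Set (Cols n m)} {k : ι → ℕ} {v : ι → ℝ≥0} {c₁ C₂ C₃ : ℝ≥0}

/-- A probability density on the unit cube which is constant on dyadic cubes of side `2⁻ᴸ` and
gives mass at most `ε G(l) 2⁻ˡᵈ` to each dyadic cube of side `2⁻ˡ`, `l ≥ l₀`. -/
structure IsFrostmanDensity (G : ℕ → ℝ≥0) (ε : ℝ≥0) (l₀ L : ℕ) (h : Cols n m → ℝ≥0∞) : Prop where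
  isStep : IsStep L h
  bounded : ∃ M : ℝ≥0, ∀ x, h x ≤ M
  support : ∀ x, h x ≠ 0 → x ∈ cell 0 0
  mass : ∫⁻ x in cell (0 : ℕ) (0 : Cols n m), h x = 1
  frostman : ∀ l x, l₀ ≤ l → ∫⁻ y in cell l x, h y ≤ (ε * G l : ℝ≥0) * volume (cell l x)

/-- The unit cube itself is the initial stage: `ε * G l ≥ 1` as soon as `l` is large. -/
theorem isFrostmanDensity_indicator {G : ℕ → ℝ≥0} {ε : ℝ≥0} {l₀ : ℕ} (h : ∀ l, l₀ ≤ l → 1 ≤ ε * G l) :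
    IsFrostmanDensity G ε l₀ 0 ((cell (0 : ℕ) (0 : Cols n m)).indicator 1) where
  isStep := by
    intro x y hxy
    have h1 := isStep_cell (Nat.zero_le 0) (0 : Cols n m) x y hxy
    by_cases hx : x ∈ cell 0 0
    · have hy : y ∈ cell 0 0 := h1.mp hx
      simp [hx, hy]
    · have hy : y ∉ cell 0 0 := fun hy => hx (h1.mpr hy)
      simp [hx, hy]
  bounded := ⟨1, fun x => by
    by_cases hx : x ∈ cell 0 0 <;> simp [hx]⟩
  support x hx := by
    by_contra hx'
    simp [hx'] at hx
  mass := by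
    rw [lintegral_indicator_one (measurableSet_cell _ _),
      Measure.restrict_apply (measurableSet_cell _ _), Set.inter_self, volume_cell]
    simp
  frostman l x hl := by
    rw [lintegral_indicator_one (measurableSet_cell _ _),
      Measure.restrict_apply (measurableSet_cell _ _)]
    calc _ ≤ volume (cell l x) := measure_mono Set.inter_subset_right
      _ = ((1 : ℝ≥0) : ℝ≥0∞) * volume (cell l x) := by simp
      _ ≤ _ := by gcongr; exact h l hl

/-- One step of the construction: the mass is moved onto finitely many sets `U q` of large height,
without loss in the Frostman constant `ε`. -/
theorem IsFrostmanDensity.exists_refinement (H : QuasiIndepFamily U k v c₁ C₂ C₃) {G : ℕ → ℝ≥0}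
    (hG : Monotone G) (hGtop : ∀ K, ∃ l, K ≤ G l)
    (hdiv : ∀ (N : ℕ) (T : ℝ≥0), ∃ Q : Finset ι, (∀ q ∈ Q, N ≤ k q) ∧ T ≤ ∑ q ∈ Q, G (k q) * v q)
    {ε : ℝ≥0} (hε : 0 < ε) {l₀ L : ℕ} {h : Cols n m → ℝ≥0∞} (hh : IsFrostmanDensity G ε l₀ L h)
    (N : ℕ) :
    ∃ (h' : Cols n m → ℝ≥0∞) (L' : ℕ) (Q : Finset ι), IsFrostmanDensity G ε l₀ L' h' ∧
      (∀ q ∈ Q, N ≤ k q) ∧ (∀ x, h' x ≠ 0 → h x ≠ 0) ∧ ∀ x, h' x ≠ 0 → ∃ q ∈ Q, x ∈ U q := by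
  obtain ⟨B, hB⟩ := H.exists_redistribution hG hGtop hdiv
  obtain ⟨M, hM⟩ := hh.bounded
  -- Beyond the level `L₁` the loss `M * B * (1 + G l / A)` is at most `ε * G l`: the two summands
  -- are at most half of it by the choice of `L₁` and of `A`.
  obtain ⟨L₁, hL₁⟩ := hGtop (2 * M * B / ε)
  set A : ℝ≥0 := 2 * M * B / ε + 1 with hA
  have hA0 : 0 < A := by positivity
  set L₂ := max L L₁ with hL₂
  obtain ⟨g, L', Q, hLL', hQ, hgst, ⟨M', hM'⟩, hsupp, hmass, hsmall⟩ := hB L₂ A N hA0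
  have hLL₂ : L ≤ L₂ := le_max_left _ _
  have hgm : Measurable g := hgst.measurable
  have hhm : Measurable h := hh.isStep.measurable
  have hlarge : ∀ l x, l ≤ L₂ → ∫⁻ y in cell l x, h y * g y = ∫⁻ y in cell l x, h y := by
    intro l x hl
    have := measure_eq_of_cells (isStep_cell hl x)
      (μ := volume.withDensity fun y => h y * g y) (ν := volume.withDensity h) ?_
    · rwa [withDensity_apply _ (measurableSet_cell _ _),
        withDensity_apply _ (measurableSet_cell _ _)] at this
    · intro y _
      rw [withDensity_apply _ (measurableSet_cell _ _),
        withDensity_apply _ (measurableSet_cell _ _),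
        setLIntegral_cell_of_isStep hh.isStep hLL₂ y hgm]
      have h1 := setLIntegral_cell_of_isStep hh.isStep hLL₂ y (k := fun _ => 1) measurable_const
      simp only [mul_one, setLIntegral_one] at h1
      rw [h1]
      by_cases hy : h y = 0
      · simp [hy]
      · rw [hmass y (hh.support y hy)]
  refine ⟨fun x => h x * g x, L', Q, ⟨?_, ⟨M * M', fun x => ?_⟩, fun x hx => ?_, ?_, ?_⟩, hQ,
    fun x hx => left_ne_zero_of_mul hx, fun x hx => hsupp x (right_ne_zero_of_mul hx)⟩
  · intro x y hxy
    simp only [hgst x y hxy, hh.isStep.mono (hLL₂.trans hLL') x y hxy]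
  · rw [ENNReal.coe_mul]
    exact mul_le_mul' (hM x) (hM' x)
  · exact hh.support x (left_ne_zero_of_mul hx)
  · rw [hlarge 0 0 (Nat.zero_le _), hh.mass]
  · intro l x hl
    rcases le_or_gt l L₂ with hl' | hl'
    · rw [hlarge l x hl']
      exact hh.frostman l x hl
    · rw [setLIntegral_cell_of_isStep hh.isStep (hLL₂.trans hl'.le) x hgm]
      calc h x * ∫⁻ y in cell l x, g y
          ≤ M * ((B * (1 + G l / A) : ℝ≥0) * volume (cell l x)) :=
            mul_le_mul' (hM x) (hsmall l x hl')
        _ = (M * (B * (1 + G l / A)) : ℝ≥0) * volume (cell l x) := by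
            rw [← mul_assoc, ← ENNReal.coe_mul]
        _ ≤ _ := by
            gcongr ?_ * _
            refine ENNReal.coe_le_coe.2 ?_
            have h1 : 2 * M * B ≤ ε * G l := by
              have : 2 * M * B / ε ≤ G l := hL₁.trans (hG ((le_max_right _ _).trans hl'.le))
              rw [div_le_iff₀ hε] at this
              rwa [mul_comm (G l)] at this
            have h2 : 2 * M * B ≤ ε * A := by
              rw [hA, mul_add, mul_div_cancel₀ _ hε.ne']
              exact le_self_add
            have h3 : 2 * M * B * (G l / A) ≤ ε * G l := by
              calc _ ≤ ε * A * (G l / A) := by gcongr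
                _ = ε * G l := by field_simp
            have h4 : 2 * (M * (B * (1 + G l / A))) ≤ 2 * (ε * G l) := by
              calc _ = 2 * M * B + 2 * M * B * (G l / A) := by ring
                _ ≤ ε * G l + ε * G l := add_le_add h1 h3
                _ = _ := by ring
            exact le_of_mul_le_mul_left h4 two_pos

/-- A lower bound for the content of the set of points that lie in `V q` for `q` of arbitrarily
large height, where `V q` is a closed set containing `U q`. -/
theorem QuasiIndepFamily.one_le_tsum_of_cover (H : QuasiIndepFamily U k v c₁ C₂ C₃) {G : ℕ → ℝ≥0}
    (hG : Monotone G) (hGtop : ∀ K, ∃ l, K ≤ G l)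
    (hdiv : ∀ (N : ℕ) (T : ℝ≥0), ∃ Q : Finset ι, (∀ q ∈ Q, N ≤ k q) ∧ T ≤ ∑ q ∈ Q, G (k q) * v q)
    {V : ι → Set (Cols n m)} (hV : ∀ q, IsClosed (V q)) (hUV : ∀ q, U q ⊆ V q)
    {ε : ℝ≥0} (hε : 0 < ε) :
    ∃ l₀ : ℕ, ∀ (P : ℕ) (O : ℕ → Set (Cols n m)) (lev : ℕ → ℕ), (∀ i, IsOpen (O i)) →
      (∀ i, l₀ ≤ lev i) →
      (∀ i, ∃ s : Finset (Cols n m), s.card ≤ P ∧ O i ⊆ ⋃ x ∈ s, cell (lev i) x) →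
      ({x | x ∈ closure (cell 0 0) ∧ ∀ N, ∃ q, N ≤ k q ∧ x ∈ V q} ⊆ ⋃ i, O i) →
      1 ≤ ∑' i, (P * ((ε * G (lev i) : ℝ≥0) * volume (cell (lev i) (0 : Cols n m))) : ℝ≥0∞) := by
  obtain ⟨l₀, hl₀⟩ := hGtop ε⁻¹
  refine ⟨l₀, fun P O lev hO hlev hs hcov => ?_⟩
  have h₀ : IsFrostmanDensity G ε l₀ 0 ((cell (0 : ℕ) (0 : Cols n m)).indicator 1) := by
    refine isFrostmanDensity_indicator fun l hl => ?_
    calc 1 = ε * ε⁻¹ := (mul_inv_cancel₀ hε.ne').symm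
      _ ≤ _ := by gcongr; exact hl₀.trans (hG hl)
  choose! next lev' Q' hnext hQ' hsub hU' using
    fun (h : Cols n m → ℝ≥0∞) (p : ℕ × ℕ) (hh : IsFrostmanDensity G ε l₀ p.1 h) =>
      hh.exists_refinement H hG hGtop hdiv hε p.2
  -- the sequence of densities, together with the levels on which they are constant
  let s : ℕ → (Cols n m → ℝ≥0∞) × ℕ := fun j => Nat.rec ((cell (0 : ℕ) (0 : Cols n m)).indicator 1, 0)
    (fun j p => (next p.1 (p.2, j), lev' p.1 (p.2, j))) j
  have hs0 : ∀ j, IsFrostmanDensity G ε l₀ (s j).2 (s j).1 := by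
    intro j
    induction j with
    | zero => exact h₀
    | succ j ih => exact hnext (s j).1 ((s j).2, j) ih
  have hsub' : ∀ j x, (s (j + 1)).1 x ≠ 0 → (s j).1 x ≠ 0 := fun j =>
    hsub (s j).1 ((s j).2, j) (hs0 j)
  set K : ℕ → Set (Cols n m) := fun j => tsupport (s j).1 with hK
  have hKanti : ∀ j, K (j + 1) ⊆ K j := fun j => closure_mono fun x hx => hsub' j x hx
  have hK0 : ∀ j, K j ⊆ closure (cell 0 0) := fun j =>
    closure_mono fun x hx => (hs0 j).support x hx
  have hbdd : Bornology.IsBounded (cell (0 : ℕ) (0 : Cols n m)) := by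
    rw [cell_eq_pi]
    exact Bornology.IsBounded.pi fun j => Bornology.IsBounded.pi fun i => Metric.isBounded_Ico _ _
  have hKc : IsCompact (closure (cell (0 : ℕ) (0 : Cols n m))) := hbdd.isCompact_closure
  have hKV : ∀ j, K (j + 1) ⊆ ⋃ q ∈ Q' (s j).1 ((s j).2, j), V q := by
    intro j
    refine closure_minimal ?_ (Set.Finite.isClosed_biUnion (Finset.finite_toSet _) fun q _ => hV q)
    intro x hx
    obtain ⟨q, hq, hxq⟩ := hU' (s j).1 ((s j).2, j) (hs0 j) x hx
    exact Set.mem_biUnion hq (hUV q hxq)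
  -- some stage of the construction is contained in the open cover
  obtain ⟨j, hj⟩ : ∃ j, K j ⊆ ⋃ i, O i := by
    by_contra! hcon
    have hne := IsCompact.nonempty_iInter_of_sequence_nonempty_isCompact_isClosed
      (fun j => K j \ ⋃ i, O i) (fun j => Set.sdiff_subset_sdiff_left (hKanti j))
      (fun j => Set.sdiff_nonempty.2 (hcon j))
      (((hKc.of_isClosed_subset (isClosed_tsupport _) (hK0 0)).diff (isOpen_iUnion hO)))
      (fun j => (isClosed_tsupport _).sdiff (isOpen_iUnion hO))
    obtain ⟨x, hx⟩ := hne
    rw [Set.mem_iInter] at hx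
    refine (hx 0).2 (hcov ⟨hK0 0 (hx 0).1, fun N => ?_⟩)
    obtain ⟨q, hq, hxq⟩ := Set.mem_iUnion₂.1 (hKV N (hx (N + 1)).1)
    exact ⟨q, hQ' (s N).1 ((s N).2, N) (hs0 N) q hq, hxq⟩
  set h := (s j).1
  have hh : IsFrostmanDensity G ε l₀ (s j).2 h := hs0 j
  calc (1 : ℝ≥0∞) = ∫⁻ x in cell (0 : ℕ) (0 : Cols n m), h x := hh.mass.symm
    _ ≤ ∫⁻ x in ⋃ i, O i, h x := by
        rw [← lintegral_indicator (measurableSet_cell _ _),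
          ← lintegral_indicator (isOpen_iUnion hO).measurableSet]
        refine lintegral_mono fun x => ?_
        by_cases hx : h x = 0
        · exact (Set.indicator_le_self' (fun _ _ => zero_le) x).trans (by rw [hx]; exact zero_le)
        · have : x ∈ ⋃ i, O i := hj (subset_closure hx)
          rw [Set.indicator_of_mem this]
          exact Set.indicator_le_self' (fun _ _ => zero_le) x
    _ ≤ ∑' i, ∫⁻ x in O i, h x := lintegral_iUnion_le _ _
    _ ≤ _ := by
        refine ENNReal.tsum_le_tsum fun i => ?_
        obtain ⟨t, ht, hOt⟩ := hs i
        calc ∫⁻ x in O i, h x ≤ ∫⁻ x in ⋃ y ∈ t, cell (lev i) y, h x := lintegral_mono_set hOt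
          _ ≤ ∑ y ∈ t, ∫⁻ x in cell (lev i) y, h x := by
              have := measure_biUnion_finset_le (μ := volume.withDensity h) t
                (fun y => cell (lev i) y)
              rw [withDensity_apply _ (Finset.measurableSet_biUnion _
                fun y _ => measurableSet_cell _ _)] at this
              refine this.trans (Finset.sum_le_sum fun y _ => ?_)
              rw [withDensity_apply _ (measurableSet_cell _ _)]
          _ ≤ ∑ y ∈ t, ((ε * G (lev i) : ℝ≥0) * volume (cell (lev i) (0 : Cols n m)) : ℝ≥0∞) := by
              refine Finset.sum_le_sum fun y _ => ?_
              rw [volume_cell (lev i) 0, ← volume_cell (lev i) y]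
              exact hh.frostman (lev i) y (hlev i)
          _ ≤ _ := by
              rw [Finset.sum_const, nsmul_eq_mul]
              gcongr

end Cantor

/-! ### Gauge functions -/

section Gauge

variable {f : ℝ → ℝ} {d : ℕ}

/-- The density `f r / rᵈ` of the gauge function. -/
noncomputable def gaugeDensity (d : ℕ) (f : ℝ → ℝ) (r : ℝ) : ℝ := f r / r ^ d

theorem gaugeDensity_mul_pow (d : ℕ) (f : ℝ → ℝ) {r : ℝ} (hr : 0 < r) :
    gaugeDensity d f r * r ^ d = f r := by
  unfold gaugeDensity
  field_simp

theorem IsAdmissible.nonneg (hf : IsAdmissible d f) {r : ℝ} (hr : 0 ≤ r) : 0 ≤ f r := by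
  have := hf.dimensionFunction.monotoneOn (Set.mem_Ici.2 le_rfl) (Set.mem_Ici.2 hr) hr
  rwa [hf.dimensionFunction.map_zero] at this

theorem IsAdmissible.gaugeDensity_anti (hf : IsAdmissible d f) {x y : ℝ} (hx : 0 < x) (hxy : x ≤ y) :
    gaugeDensity d f y ≤ gaugeDensity d f x := by
  rcases hxy.eq_or_lt with rfl | h
  · rfl
  · have := hf.prec.1 x y hx h
    simpa only [Real.rpow_natCast, gaugeDensity] using this

theorem IsAdmissible.gaugeDensity_nonneg (hf : IsAdmissible d f) {x : ℝ} (hx : 0 < x) :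
    0 ≤ gaugeDensity d f x := div_nonneg (hf.nonneg hx.le) (by positivity)

theorem IsAdmissible.gaugeDensity_mul_mono (hf : IsAdmissible d f) {x y : ℝ}
    (hx : 0 < x) (hxy : x ≤ y) : gaugeDensity d f x * x ≤ gaugeDensity d f y * y := by
  rcases hxy.eq_or_lt with rfl | h
  · rfl
  · have := hf.eqPrec x y hx h
    have key : ∀ z : ℝ, 0 < z → f z / z ^ ((d : ℝ) - 1) = gaugeDensity d f z * z := by
      intro z hz
      rw [Real.rpow_sub_one hz.ne', Real.rpow_natCast, gaugeDensity, div_div_eq_mul_div,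
        div_mul_eq_mul_div]
    rwa [key x hx, key y (hx.trans h)] at this

theorem IsAdmissible.exists_le_gaugeDensity (hf : IsAdmissible d f) (K : ℝ) :
    ∃ r₀, 0 < r₀ ∧ ∀ r, 0 < r → r ≤ r₀ → K ≤ gaugeDensity d f r := by
  have h1 := hf.prec.2.eventually (Filter.eventually_ge_atTop K)
  rw [eventually_nhdsWithin_iff, Metric.eventually_nhds_iff] at h1
  obtain ⟨δ, hδ, h⟩ := h1
  refine ⟨δ / 2, by positivity, fun r hr hr' => ?_⟩
  have := h (y := r) (by rw [Real.dist_eq, sub_zero, abs_of_pos hr]; linarith) hr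
  simpa only [Real.rpow_natCast, gaugeDensity] using this

theorem IsAdmissible.gaugeDensity_pos (hf : IsAdmissible d f) {x : ℝ} (hx : 0 < x) :
    0 < gaugeDensity d f x := by
  obtain ⟨r₀, hr₀, h⟩ := hf.exists_le_gaugeDensity 1
  have h1 := h (min x r₀) (lt_min hx hr₀) (min_le_right _ _)
  have h2 := hf.gaugeDensity_mul_mono (lt_min hx hr₀) (min_le_left x r₀)
  have h3 : 0 < gaugeDensity d f (min x r₀) * min x r₀ :=
    mul_pos (by linarith) (lt_min hx hr₀)
  exact pos_of_mul_pos_left (h3.trans_le h2) hx.le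

theorem IsAdmissible.map_mul_le (hf : IsAdmissible d f) {x c : ℝ} (hx : 0 < x) (hc : 1 ≤ c) :
    f (c * x) ≤ c ^ d * f x := by
  have hcx : 0 < c * x := by positivity
  have h1 := hf.gaugeDensity_anti hx (le_mul_of_one_le_left hx.le hc)
  rw [← gaugeDensity_mul_pow d f hcx, ← gaugeDensity_mul_pow d f hx, mul_pow]
  calc gaugeDensity d f (c * x) * (c ^ d * x ^ d) ≤ gaugeDensity d f x * (c ^ d * x ^ d) := by gcongr
    _ = _ := by ring

/-- The gauge density at the dyadic scale `2⁻ˡ`. -/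
noncomputable def dyadicDensity (d : ℕ) (f : ℝ → ℝ) (l : ℕ) : ℝ≥0 :=
  (gaugeDensity d f ((2 : ℝ)⁻¹ ^ l)).toNNReal

theorem IsAdmissible.coe_dyadicDensity (hf : IsAdmissible d f) (l : ℕ) :
    (dyadicDensity d f l : ℝ) = gaugeDensity d f ((2 : ℝ)⁻¹ ^ l) :=
  Real.coe_toNNReal _ (hf.gaugeDensity_nonneg (by positivity))

theorem IsAdmissible.monotone_dyadicDensity (hf : IsAdmissible d f) :
    Monotone (dyadicDensity d f) := fun l l' h =>
  Real.toNNReal_le_toNNReal (hf.gaugeDensity_anti (by positivity)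
    (pow_le_pow_of_le_one (by norm_num) (by norm_num) h))

theorem IsAdmissible.exists_le_dyadicDensity (hf : IsAdmissible d f) (K : ℝ≥0) :
    ∃ l, K ≤ dyadicDensity d f l := by
  obtain ⟨r₀, hr₀, h⟩ := hf.exists_le_gaugeDensity K
  obtain ⟨l, hl⟩ := exists_pow_lt_of_lt_one hr₀ (show (2 : ℝ)⁻¹ < 1 by norm_num)
  refine ⟨l, ?_⟩
  rw [← NNReal.coe_le_coe, hf.coe_dyadicDensity]
  exact h _ (by positivity) hl.le

theorem IsAdmissible.dyadicDensity_mul_volume {n m : ℕ} (hf : IsAdmissible (n * m) f) (l : ℕ)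
    (x : Cols n m) : dyadicDensity (n * m) f l * volume (cell l x) =
      ENNReal.ofReal (f ((2 : ℝ)⁻¹ ^ l)) := by
  rw [volume_cell, ← gaugeDensity_mul_pow (n * m) f (r := (2 : ℝ)⁻¹ ^ l) (by positivity),
    ENNReal.ofReal_mul (hf.gaugeDensity_nonneg (by positivity)), ENNReal.ofReal_pow (by positivity),
    ENNReal.ofReal_pow (by positivity), ENNReal.ofReal_inv_of_pos (by norm_num),
    ENNReal.ofReal_ofNat]
  rfl

end Gauge

/-! ### From dyadic cubes to Hausdorff measures -/

section Hausdorff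

variable {n m : ℕ}

/-- The columns of a point of the Euclidean space of matrices. -/
def toCols (x : EuclideanSpace ℝ (Fin n × Fin m)) : Cols n m := fun j i => x (i, j)

theorem toCols_surjective (y : Cols n m) : ∃ x, toCols (n := n) (m := m) x = y :=
  ⟨WithLp.toLp 2 fun p => y p.2 p.1, rfl⟩

/-- The open cube of side `2 δ` centred at `c`. -/
def openBox (c : Cols n m) (δ : ℝ) : Set (Cols n m) := {y | ∀ j i, |y j i - c j i| < δ}

theorem isOpen_openBox (c : Cols n m) (δ : ℝ) : IsOpen (openBox c δ) := by
  have : openBox c δ = ⋂ j, ⋂ i, {y | |y j i - c j i| < δ} := by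
    ext y; simp [openBox]
  rw [this]
  exact isOpen_iInter_of_finite fun j => isOpen_iInter_of_finite fun i =>
    isOpen_lt (by fun_prop) continuous_const

theorem exists_cells_of_openBox (c : Cols n m) {δ : ℝ} {l : ℕ} (hδ : 2 * δ ≤ (2 : ℝ)⁻¹ ^ l) :
    ∃ s : Finset (Cols n m), s.card ≤ 2 ^ (n * m) ∧ openBox c δ ⊆ ⋃ x ∈ s, cell l x := by
  classical
  have h2 : (0 : ℝ) < 2 ^ l := by positivity
  set a : Cols n m := fun j i => c j i - δ with ha
  set pt : (Fin m → Fin n → Fin 2) → Cols n m := fun e j i =>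
    a j i + ((e j i : ℕ) : ℝ) / 2 ^ l with hpt
  refine ⟨Finset.univ.image pt, Finset.card_image_le.trans (by simp [pow_mul]), fun y hy => ?_⟩
  have key : ∀ j i, ∃ e : Fin 2, ⌊(2 : ℝ) ^ l * y j i⌋ = ⌊(2 : ℝ) ^ l * a j i⌋ + ((e : ℕ) : ℤ) := by
    intro j i
    have h := abs_lt.1 (hy j i)
    have h3 : (2 : ℝ) ^ l * (2 * δ) ≤ 1 := by
      calc (2 : ℝ) ^ l * (2 * δ) ≤ 2 ^ l * 2⁻¹ ^ l := by gcongr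
        _ = 1 := by rw [← mul_pow]; norm_num
    have h4 : (2 : ℝ) ^ l * a j i < 2 ^ l * y j i := by
      refine mul_lt_mul_of_pos_left ?_ h2
      simp only [ha]; linarith
    have h5 : (2 : ℝ) ^ l * y j i < 2 ^ l * a j i + 1 := by
      have : (2 : ℝ) ^ l * y j i < 2 ^ l * (a j i + 2 * δ) := by
        refine mul_lt_mul_of_pos_left ?_ h2
        simp only [ha]; linarith
      linarith [mul_add ((2 : ℝ) ^ l) (a j i) (2 * δ)]
    have h6 : ⌊(2 : ℝ) ^ l * a j i⌋ ≤ ⌊(2 : ℝ) ^ l * y j i⌋ := Int.floor_le_floor h4.le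
    have h7 : ⌊(2 : ℝ) ^ l * y j i⌋ ≤ ⌊(2 : ℝ) ^ l * a j i⌋ + 1 := by
      have := Int.floor_le_floor h5.le
      rwa [Int.floor_add_one] at this
    rcases (by omega : ⌊(2 : ℝ) ^ l * y j i⌋ = ⌊(2 : ℝ) ^ l * a j i⌋ ∨
      ⌊(2 : ℝ) ^ l * y j i⌋ = ⌊(2 : ℝ) ^ l * a j i⌋ + 1) with h8 | h8
    · exact ⟨0, by simp [h8]⟩
    · exact ⟨1, by simp [h8]⟩
  choose e he using key
  refine Set.mem_biUnion (Finset.mem_coe.2 (Finset.mem_image_of_mem pt (Finset.mem_univ e))) ?_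
  funext j i
  simp only [dyIdx, hpt, he j i]
  rw [mul_add, mul_div_cancel₀ _ h2.ne', Int.floor_add_natCast]

theorem closure_cell_zero_subset {y : Cols n m} (hy : y ∈ closure (cell 0 0)) (j : Fin m) (i : Fin n) :
    0 ≤ y j i ∧ y j i ≤ 1 := by
  have hcl : IsClosed {y : Cols n m | 0 ≤ y j i ∧ y j i ≤ 1} :=
    (isClosed_le (f := fun _ => (0 : ℝ)) (g := fun y : Cols n m => y j i) (by fun_prop)
      (by fun_prop)).inter (isClosed_le (f := fun y : Cols n m => y j i) (by fun_prop) (by fun_prop))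
  refine closure_minimal ?_ hcl hy
  intro z hz
  have := congrFun (congrFun hz j) i
  simp only [dyIdx, pow_zero, one_mul, Pi.zero_apply, Int.floor_zero] at this
  rw [Int.floor_eq_zero_iff] at this
  exact ⟨this.1, this.2.le⟩

variable {ι : Type*} {U : ι → Set (Cols n m)} {k : ι → ℕ} {v : ι → ℝ≥0} {c₁ C₂ C₃ : ℝ≥0}

/-- If the expected `f`-mass `∑ g (2 ^ (-k q)) * v q` diverges, the limsup set of the closed sets
`V q ⊇ U q` has infinite `f`-measure. -/
theorem QuasiIndepFamily.hausdorffFMeasure_eq_top (H : QuasiIndepFamily U k v c₁ C₂ C₃) {f : ℝ → ℝ}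
    (hf : IsAdmissible (n * m) f)
    (hdiv : ∀ (N : ℕ) (T : ℝ≥0), ∃ Q : Finset ι, (∀ q ∈ Q, N ≤ k q) ∧
      T ≤ ∑ q ∈ Q, dyadicDensity (n * m) f (k q) * v q)
    {V : ι → Set (Cols n m)} (hV : ∀ q, IsClosed (V q)) (hUV : ∀ q, U q ⊆ V q)
    {E : Set (EuclideanSpace ℝ (Fin n × Fin m))}
    (hE : ∀ x, x ∈ unitCube n m → (∀ N, ∃ q, N ≤ k q ∧ toCols x ∈ V q) → x ∈ E) :
    hausdorffFMeasure f E = ⊤ := by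
  refine ENNReal.eq_top_of_forall_nnreal_le fun T => ?_
  set d := n * m with hd
  -- a ball lies in `2 ^ d` dyadic cubes of comparable side, which loses at most `4 ^ d` in `f`
  set ε : ℝ≥0 := (2 ^ d * 4 ^ d * (T + 1))⁻¹ with hε
  have hε0 : 0 < ε := by positivity
  obtain ⟨l₀, hl₀⟩ := H.one_le_tsum_of_cover hf.monotone_dyadicDensity hf.exists_le_dyadicDensity
    hdiv hV hUV hε0
  set η : ℝ := (2 : ℝ)⁻¹ ^ (l₀ + 2) with hη
  have hη0 : 0 < η := by positivity
  refine le_trans ?_ (le_iSup₂ (f := fun (η : ℝ) (_ : 0 < η) => hausdorffPremeasure f η E) η hη0)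
  refine le_iInf₂ fun c r => le_iInf₂ fun hcov hdiam => ?_
  set δ : ℕ → ℝ := fun i => Metric.diam (Metric.closedBall (c i) (r i)) with hδ
  have hδ0 : ∀ i, 0 ≤ δ i := fun i => Metric.diam_nonneg
  obtain ⟨τ, hτ0, hτ⟩ := ENNReal.exists_pos_sum_of_countable' (ε := 1) one_ne_zero ℕ
  -- slightly larger open balls
  have hδ' : ∀ i, ∃ δ', δ i < δ' ∧ δ' ≤ 2 * η ∧
      ENNReal.ofReal (f δ') ≤ ENNReal.ofReal (f (δ i)) + τ i := by
    intro i
    have hcont : ContinuousWithinAt (fun x => ENNReal.ofReal (f x)) (Set.Ici 0) (δ i) :=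
      ENNReal.continuous_ofReal.continuousAt.comp_continuousWithinAt
        (hf.dimensionFunction.continuousOn (δ i) (hδ0 i))
    have h1 : ContinuousWithinAt (fun x => ENNReal.ofReal (f x)) (Set.Ioi (δ i)) (δ i) :=
      hcont.mono fun x hx => (hδ0 i).trans (le_of_lt hx)
    have h2 : ∀ᶠ x in nhdsWithin (δ i) (Set.Ioi (δ i)),
        ENNReal.ofReal (f x) < ENNReal.ofReal (f (δ i)) + τ i :=
      h1.eventually_lt_const (ENNReal.lt_add_right ENNReal.ofReal_ne_top (hτ0 i).ne')
    have h3 : ∀ᶠ x in nhdsWithin (δ i) (Set.Ioi (δ i)), x < 2 * η :=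
      eventually_nhdsWithin_of_eventually_nhds
        (eventually_lt_nhds (lt_of_le_of_lt (hdiam i) (by linarith)))
    obtain ⟨x, h4, h5, h6⟩ := (h2.and (h3.and self_mem_nhdsWithin)).exists
    exact ⟨x, h6, h5.le, h4.le⟩
  choose δ' hδ1 hδ2 hδ3 using hδ'
  have hδ'0 : ∀ i, 0 < δ' i := fun i => (hδ0 i).trans_lt (hδ1 i)
  have hlev : ∀ i, ∃ l : ℕ, (2 : ℝ)⁻¹ ^ (l + 1) < 2 * δ' i ∧ 2 * δ' i ≤ (2 : ℝ)⁻¹ ^ l := by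
    intro i
    refine exists_nat_pow_near_of_lt_one (by linarith [hδ'0 i]) ?_ (by norm_num) (by norm_num)
    have : η ≤ 2⁻¹ ^ 2 := by
      rw [hη]
      exact pow_le_pow_of_le_one (by norm_num) (by norm_num) (by omega)
    linarith [hδ2 i]
  choose lev hlev1 hlev2 using hlev
  have hlev0 : ∀ i, l₀ ≤ lev i := by
    intro i
    by_contra! hlt
    have h1 : (2 : ℝ)⁻¹ ^ l₀ ≤ 2⁻¹ ^ (lev i + 1) :=
      pow_le_pow_of_le_one (by norm_num) (by norm_num) hlt
    have h2 : 4 * η = 2⁻¹ ^ l₀ := by rw [hη, pow_add]; ring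
    linarith [hlev1 i, hδ2 i]
  have hmain := hl₀ (2 ^ d) (fun i => openBox (toCols (c i)) (δ' i)) lev
    (fun i => isOpen_openBox _ _) hlev0 (fun i => exists_cells_of_openBox _ (hlev2 i)) ?_
  · have hterm : ∀ i, (((2 ^ d : ℕ) : ℝ≥0∞) * ((ε * dyadicDensity d f (lev i) : ℝ≥0) *
        volume (cell (lev i) (0 : Cols n m))) : ℝ≥0∞) ≤
        ((T + 1)⁻¹ : ℝ≥0) * (ENNReal.ofReal (f (δ i)) + τ i) := by
      intro i
      rw [ENNReal.coe_mul, mul_assoc, hf.dyadicDensity_mul_volume]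
      have h1 : f ((2 : ℝ)⁻¹ ^ lev i) ≤ 4 ^ d * f (δ' i) := by
        have h2 : (2 : ℝ)⁻¹ ^ lev i ≤ 4 * δ' i := by
          have := hlev1 i
          rw [pow_succ] at this
          linarith
        calc f ((2 : ℝ)⁻¹ ^ lev i) ≤ f (4 * δ' i) :=
              hf.dimensionFunction.monotoneOn (Set.mem_Ici.2 (by positivity))
                (Set.mem_Ici.2 (by linarith [hδ'0 i])) h2
          _ ≤ _ := hf.map_mul_le (hδ'0 i) (by norm_num)
      calc ((2 ^ d : ℕ) : ℝ≥0∞) * (ε * ENNReal.ofReal (f ((2 : ℝ)⁻¹ ^ lev i)))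
          ≤ ((2 ^ d : ℕ) : ℝ≥0∞) * (ε * ENNReal.ofReal (4 ^ d * f (δ' i))) := by gcongr
        _ = ((2 ^ d * ε * 4 ^ d : ℝ≥0) : ℝ≥0∞) * ENNReal.ofReal (f (δ' i)) := by
            rw [ENNReal.ofReal_mul (by positivity), ENNReal.ofReal_pow (by norm_num)]
            push_cast
            norm_num
            ring
        _ = ((T + 1)⁻¹ : ℝ≥0) * ENNReal.ofReal (f (δ' i)) := by
            congr 2
            rw [hε]
            field_simp
        _ ≤ _ := by gcongr; exact hδ3 i
    have h1 := hmain.trans (ENNReal.tsum_le_tsum hterm)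
    rw [ENNReal.tsum_mul_left, ENNReal.tsum_add] at h1
    have h2 : ((T + 1 : ℝ≥0) : ℝ≥0∞) ≤ (∑' i, ENNReal.ofReal (f (δ i))) + 1 := by
      calc ((T + 1 : ℝ≥0) : ℝ≥0∞) = (T + 1 : ℝ≥0) * 1 := by rw [mul_one]
        _ ≤ (T + 1 : ℝ≥0) * (((T + 1)⁻¹ : ℝ≥0) *
            ((∑' i, ENNReal.ofReal (f (δ i))) + ∑' i, τ i)) := by gcongr
        _ = (∑' i, ENNReal.ofReal (f (δ i))) + ∑' i, τ i := by
            rw [← mul_assoc, ← ENNReal.coe_mul, mul_inv_cancel₀ (by positivity), ENNReal.coe_one,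
              one_mul]
        _ ≤ _ := by gcongr
    rw [ENNReal.coe_add, ENNReal.coe_one] at h2
    exact (ENNReal.add_le_add_iff_right ENNReal.one_ne_top).1 h2
  · rintro y ⟨hy1, hy2⟩
    obtain ⟨x, rfl⟩ := toCols_surjective y
    have hx : x ∈ unitCube n m := fun p => closure_cell_zero_subset hy1 p.2 p.1
    obtain ⟨i, hi⟩ := Set.mem_iUnion.1 (hcov (hE x hx hy2))
    refine Set.mem_iUnion.2 ⟨i, fun j i' => ?_⟩
    have hc : c i ∈ Metric.closedBall (c i) (r i) :=
      Metric.mem_closedBall_self (dist_nonneg.trans (Metric.mem_closedBall.1 hi))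
    calc |toCols x j i' - toCols (c i) j i'| = ‖(x - c i) (i', j)‖ := by
          simp [toCols, Real.norm_eq_abs]
      _ ≤ ‖x - c i‖ := PiLp.norm_apply_le _ _
      _ = dist x (c i) := (dist_eq_norm _ _).symm
      _ ≤ δ i := Metric.dist_le_diam_of_mem Metric.isBounded_closedBall hi hc
      _ < δ' i := hδ1 i

end Hausdorff

/-! ### Neighbourhoods of rational points on the line -/

section Line

theorem volume_abs_mul_add_sub_lt {a : ℝ} (ha : 0 < a) (β p : ℝ) {δ : ℝ} :
    volume {t : ℝ | |a * t + β - p| < δ} = ENNReal.ofReal (2 * δ / a) := by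
  have : {t : ℝ | |a * t + β - p| < δ} = Set.Ioo ((p - β - δ) / a) ((p - β + δ) / a) := by
    ext t
    simp only [Set.mem_ofPred_eq, Set.mem_Ioo, abs_lt, div_lt_iff₀ ha, lt_div_iff₀ ha]
    constructor <;> rintro ⟨h1, h2⟩ <;> constructor <;> linarith
  rw [this, Real.volume_Ioo]
  congr 1
  ring

/-- The points `t` of an interval of length `h ≥ 1 / a` for which `a t + β` is close to an
integer. -/
theorem volume_near_int_le {a : ℝ} (ha : 0 < a) (β u : ℝ) {h δ : ℝ} (hah : 1 ≤ a * h) (hδ0 : 0 ≤ δ)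
    (hδ : δ ≤ 1) :
    volume {t : ℝ | t ∈ Set.Ico u (u + h) ∧ ∃ p : ℤ, |a * t + β - p| < δ} ≤
      ENNReal.ofReal (8 * δ * h) := by
  set s := a * u + β with hs
  set P : Finset ℤ := Finset.Icc ⌊s⌋ ⌊s + a * h + 1⌋ with hP
  have hsub : {t : ℝ | t ∈ Set.Ico u (u + h) ∧ ∃ p : ℤ, |a * t + β - p| < δ} ⊆
      ⋃ p ∈ P, {t : ℝ | |a * t + β - (p : ℤ)| < δ} := by
    rintro t ⟨⟨h1, h2⟩, p, hp⟩
    refine Set.mem_biUnion (Finset.mem_coe.2 (Finset.mem_Icc.2 ⟨?_, ?_⟩)) hp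
    · have h3 := (abs_lt.1 hp).2
      have h4 : a * u ≤ a * t := by gcongr
      have : (⌊s⌋ : ℝ) < p + 1 := by linarith [Int.floor_le s]
      exact_mod_cast Int.lt_add_one_iff.1 (by exact_mod_cast this)
    · have h3 := (abs_lt.1 hp).1
      have h5 : a * t ≤ a * (u + h) := by gcongr
      rw [Int.le_floor]
      linarith [mul_add a u h]
  have hcard : (P.card : ℝ) ≤ 4 * (a * h) := by
    rw [hP, Int.card_Icc]
    have h1 : ⌊s⌋ ≤ ⌊s + a * h + 1⌋ := Int.floor_le_floor (by linarith)
    have h2 : (((⌊s + a * h + 1⌋ + 1 - ⌊s⌋).toNat : ℤ) : ℝ) = ⌊s + a * h + 1⌋ + 1 - ⌊s⌋ := by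
      rw [Int.toNat_of_nonneg (by omega)]; push_cast; ring
    have h3 : (((⌊s + a * h + 1⌋ + 1 - ⌊s⌋).toNat : ℕ) : ℝ) = ⌊s + a * h + 1⌋ + 1 - ⌊s⌋ := by
      rw [← h2]; exact (Int.cast_natCast _).symm
    rw [h3]
    linarith [Int.floor_le (s + a * h + 1), Int.lt_floor_add_one s]
  calc _ ≤ volume (⋃ p ∈ P, {t : ℝ | |a * t + β - (p : ℤ)| < δ}) := measure_mono hsub
    _ ≤ ∑ p ∈ P, volume {t : ℝ | |a * t + β - (p : ℤ)| < δ} := measure_biUnion_finset_le _ _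
    _ = P.card * ENNReal.ofReal (2 * δ / a) := by
        simp only [volume_abs_mul_add_sub_lt ha, Finset.sum_const, nsmul_eq_mul]
    _ = ENNReal.ofReal (P.card * (2 * δ / a)) := by
        rw [ENNReal.ofReal_mul (by positivity), ENNReal.ofReal_natCast]
    _ ≤ _ := by
        refine ENNReal.ofReal_le_ofReal ?_
        calc (P.card : ℝ) * (2 * δ / a) ≤ 4 * (a * h) * (2 * δ / a) := by gcongr
          _ = 8 * δ * h := by field_simp; ring

/-- The positive integers with few small prime factors, in the sense that the sum of the
reciprocals of the prime factors is at most `7 / 8`. A bound below `1` leaves a positive proportion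
of residues coprime to `a`, and a bound above `∑ 1 / p ^ 2` makes such integers frequent. -/
def sparsePrimeFactors : Set ℕ := {a | 0 < a ∧ ∑ ℓ ∈ a.primeFactors, (1 / ℓ : ℝ) ≤ 7 / 8}

theorem card_primeFactors_le_log (a : ℕ) (ha : a ≠ 0) : a.primeFactors.card ≤ Nat.log 2 a := by
  refine Nat.le_log_of_pow_le one_lt_two ?_
  calc 2 ^ a.primeFactors.card ≤ ∏ p ∈ a.primeFactors, p :=
        Finset.pow_card_le_prod _ _ _ fun p hp => (Nat.prime_of_mem_primeFactors hp).two_le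
    _ ≤ a := Nat.le_of_dvd (Nat.pos_of_ne_zero ha) (Nat.prod_primeFactors_dvd a)

theorem card_filter_modEq_le (P : ℤ) (M : ℕ) {ℓ : ℕ} (hℓ : 0 < ℓ) (v : ℤ) :
    (((Finset.Ico P (P + M)).filter fun p => p ≡ v [ZMOD ℓ]).card : ℝ) ≤ M / ℓ + 1 := by
  have hℓ' : (0 : ℝ) < ℓ := by exact_mod_cast hℓ
  have h0 := Int.Ico_filter_modEq_card P (P + M) (r := (ℓ : ℤ)) (by exact_mod_cast hℓ) v
  have h1 : (((Finset.Ico P (P + M)).filter fun p => p ≡ v [ZMOD ℓ]).card : ℝ) =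
      ((max (⌈(((P + M : ℤ) : ℚ) - v) / ((ℓ : ℤ) : ℚ)⌉ - ⌈((P : ℚ) - v) / ((ℓ : ℤ) : ℚ)⌉) 0 : ℤ)
        : ℝ) := by
    rw [← h0]; simp
  rw [h1]
  have h2 := Int.ceil_lt_add_one ((((P + M : ℤ) : ℚ) - v) / ((ℓ : ℤ) : ℚ))
  have h3 := Int.le_ceil (((P : ℚ) - v) / ((ℓ : ℤ) : ℚ))
  generalize ⌈(((P + M : ℤ) : ℚ) - v) / ((ℓ : ℤ) : ℚ)⌉ = x at h2 ⊢
  generalize ⌈((P : ℚ) - v) / ((ℓ : ℤ) : ℚ)⌉ = y at h3 ⊢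
  push_cast at h2 h3 ⊢
  refine max_le ?_ (by positivity)
  have h4 : (x : ℚ) - y ≤ M / ℓ + 1 := by
    have : ((P : ℚ) + M - v) / ℓ = (P - v) / ℓ + M / ℓ := by ring
    linarith
  have h5 := (Rat.cast_le (K := ℝ)).2 h4
  push_cast at h5
  exact h5

theorem card_filter_dvd_le (P : ℤ) (M : ℕ) {ℓ : ℕ} (hℓ : 0 < ℓ) :
    (((Finset.Ico P (P + M)).filter fun p => (ℓ : ℤ) ∣ p).card : ℝ) ≤ M / ℓ + 1 := by
  simpa only [Int.modEq_zero_iff_dvd] using card_filter_modEq_le P M hℓ 0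

/-- In an interval of length much larger than `log a`, a positive proportion of the integers is
coprime to `a`. -/
theorem le_card_filter_coprime {a : ℕ} (ha : a ∈ sparsePrimeFactors) (P : ℤ) (M : ℕ) :
    (M : ℝ) / 8 - Nat.log 2 a ≤
      ((Finset.Ico P (P + M)).filter fun p => Int.gcd p a = 1).card := by
  classical
  obtain ⟨ha0, hsum⟩ := ha
  have hsplit := Finset.card_filter_add_card_filter_not (s := Finset.Ico P (P + M))
    (fun p => Int.gcd p a = 1)
  have hbad : ((Finset.Ico P (P + M)).filter fun p => ¬ Int.gcd p a = 1) ⊆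
      a.primeFactors.biUnion fun ℓ => (Finset.Ico P (P + M)).filter fun p => (ℓ : ℤ) ∣ p := by
    intro p hp
    rw [Finset.mem_filter] at hp
    obtain ⟨ℓ, hℓ, hdvd⟩ := Nat.exists_prime_and_dvd hp.2
    refine Finset.mem_biUnion.2 ⟨ℓ, Nat.mem_primeFactors.2 ⟨hℓ, ?_, ha0.ne'⟩,
      Finset.mem_filter.2 ⟨hp.1, ?_⟩⟩
    · have := (Int.natCast_dvd_natCast.2 hdvd).trans (Int.gcd_dvd_right p a)
      exact_mod_cast this
    · exact (Int.natCast_dvd_natCast.2 hdvd).trans (Int.gcd_dvd_left p a)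
  have h1 : (((Finset.Ico P (P + M)).filter fun p => ¬ Int.gcd p a = 1).card : ℝ) ≤
      7 / 8 * M + Nat.log 2 a := by
    calc _ ≤ ((a.primeFactors.biUnion fun ℓ =>
          (Finset.Ico P (P + M)).filter fun p => (ℓ : ℤ) ∣ p).card : ℝ) := by
          exact_mod_cast Finset.card_le_card hbad
      _ ≤ ∑ ℓ ∈ a.primeFactors, (((Finset.Ico P (P + M)).filter fun p => (ℓ : ℤ) ∣ p).card : ℝ) := by
          exact_mod_cast Finset.card_biUnion_le
      _ ≤ ∑ ℓ ∈ a.primeFactors, ((M : ℝ) / ℓ + 1) := Finset.sum_le_sum fun ℓ hℓ =>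
          card_filter_dvd_le P M (Nat.prime_of_mem_primeFactors hℓ).pos
      _ = M * ∑ ℓ ∈ a.primeFactors, (1 / ℓ : ℝ) + a.primeFactors.card := by
          rw [Finset.sum_add_distrib, Finset.mul_sum]
          simp [div_eq_mul_inv]
      _ ≤ M * (7 / 8) + Nat.log 2 a := by
          gcongr
          exact card_primeFactors_le_log a ha0.ne'
      _ = _ := by ring
  have h2 : (M : ℝ) = ((Finset.Ico P (P + M)).filter fun p => Int.gcd p a = 1).card +
      ((Finset.Ico P (P + M)).filter fun p => ¬ Int.gcd p a = 1).card := by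
    have h3 : (Finset.Ico P (P + M)).card = M := by simp
    rw [h3] at hsplit
    exact_mod_cast hsplit.symm
  linarith

/-- A lower bound for the points `t` of an interval of length `h` for which `a t + β` lies at
distance about `δ` to the right of an integer coprime to `a`. -/
theorem le_volume_near_coprime {a : ℕ} (ha : a ∈ sparsePrimeFactors) (β u : ℝ) {h δ : ℝ}
    (hah : 16 * (Nat.log 2 a + 1) ≤ a * h) (hδ0 : 0 < δ) (hδ : δ ≤ 1) :
    ENNReal.ofReal (δ * h / 32) ≤ volume {t : ℝ | t ∈ Set.Ico u (u + h) ∧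
      ∃ p : ℤ, Int.gcd p a = 1 ∧ δ / 2 ≤ a * t + β - p ∧ a * t + β - p < δ} := by
  have ha0 : (0 : ℝ) < a := by exact_mod_cast ha.1
  set s := a * u + β with hs
  set M := ⌊a * h - 1⌋₊ with hM
  have hM1 : (M : ℝ) ≤ a * h - 1 := Nat.floor_le (by
    have : (0 : ℝ) ≤ Nat.log 2 a := by positivity
    linarith)
  have hM2 : a * h - 2 < M := by
    have := Nat.lt_floor_add_one (a * h - 1)
    linarith
  set P : Finset ℤ := (Finset.Ico ⌈s⌉ (⌈s⌉ + M)).filter fun p => Int.gcd p a = 1 with hP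
  have hcard : a * h / 16 ≤ (P.card : ℝ) := by
    have := le_card_filter_coprime ha ⌈s⌉ M
    refine le_trans ?_ this
    linarith
  set J : ℤ → Set ℝ := fun p => Set.Ico ((p - β + δ / 2) / a) ((p - β + δ) / a) with hJ
  have hmemJ : ∀ p t, t ∈ J p ↔ δ / 2 ≤ a * t + β - p ∧ a * t + β - p < δ := by
    intro p t
    simp only [hJ, Set.mem_Ico, div_le_iff₀ ha0, lt_div_iff₀ ha0]
    constructor <;> rintro ⟨h1, h2⟩ <;> constructor <;> linarith
  have hsub : (⋃ p ∈ P, J p) ⊆ {t : ℝ | t ∈ Set.Ico u (u + h) ∧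
      ∃ p : ℤ, Int.gcd p a = 1 ∧ δ / 2 ≤ a * t + β - p ∧ a * t + β - p < δ} := by
    intro t ht
    obtain ⟨p, hp, htp⟩ := Set.mem_iUnion₂.1 ht
    have h1 := (hmemJ p t).1 htp
    have h2 := Finset.mem_filter.1 hp
    have h3 := Finset.mem_Ico.1 h2.1
    refine ⟨⟨?_, ?_⟩, p, h2.2, h1⟩
    · have h4 : s ≤ p := (Int.le_ceil s).trans (by exact_mod_cast h3.1)
      have : (a : ℝ) * u ≤ a * t := by linarith
      exact le_of_mul_le_mul_left this ha0
    · have h4 : (p : ℝ) ≤ ⌈s⌉ + M - 1 := by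
        have : p ≤ ⌈s⌉ + M - 1 := by omega
        exact_mod_cast this
      have h5 := Int.ceil_lt_add_one s
      have : (a : ℝ) * t < a * (u + h) := by
        rw [mul_add]; linarith
      exact lt_of_mul_lt_mul_left this ha0.le
  have hdisj : Set.PairwiseDisjoint (P : Set ℤ) J := by
    intro p _ p' _ hpp
    refine Set.disjoint_left.2 fun t ht ht' => hpp ?_
    have h1 := (hmemJ p t).1 ht
    have h2 := (hmemJ p' t).1 ht'
    have h3 : (p : ℝ) < p' + 1 := by linarith
    have h4 : (p' : ℝ) < p + 1 := by linarith
    have h5 : p < p' + 1 := by exact_mod_cast h3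
    have h6 : p' < p + 1 := by exact_mod_cast h4
    omega
  calc ENNReal.ofReal (δ * h / 32) ≤ ENNReal.ofReal (P.card * (δ / 2 / a)) := by
        refine ENNReal.ofReal_le_ofReal ?_
        calc δ * h / 32 = a * h / 16 * (δ / 2 / a) := by field_simp; ring
          _ ≤ _ := by gcongr
    _ = ∑ p ∈ P, volume (J p) := by
        have : ∀ p, volume (J p) = ENNReal.ofReal (δ / 2 / a) := by
          intro p
          rw [hJ, Real.volume_Ico]
          congr 1
          ring
        rw [ENNReal.ofReal_mul (by positivity), ENNReal.ofReal_natCast]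
        simp only [this, Finset.sum_const, nsmul_eq_mul]
    _ = volume (⋃ p ∈ P, J p) := (measure_biUnion_finset hdisj fun p _ => measurableSet_Ico).symm
    _ ≤ _ := measure_mono hsub

end Line

section Line

/-- Reduced fractions with different denominators `a`, `a'` differ by at least the expected amount,
which makes the neighbourhoods of the two sets of reduced fractions quasi-independent. -/
theorem volume_near_coprime_inter_le {a a' : ℕ} (ha : 0 < a) (ha' : 0 < a') (hne : a ≠ a') (c : ℝ)
    {δ δ' : ℝ} (hδ0 : 0 ≤ δ) (hδ : δ ≤ 1) (hδ'0 : 0 ≤ δ') :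
    volume {u : ℝ | u ∈ Set.Ico c (c + 1) ∧ (∃ p : ℤ, Int.gcd p a = 1 ∧ |a * u - p| < δ) ∧
      ∃ p : ℤ, Int.gcd p a' = 1 ∧ |a' * u - p| < δ'} ≤ ENNReal.ofReal (32 * (δ * δ')) := by
  classical
  obtain ⟨e, he, a₁, a₁', hcop, rfl, rfl⟩ : ∃ e, 0 < e ∧ ∃ a₁ a₁' : ℕ, Nat.Coprime a₁ a₁' ∧
      a = e * a₁ ∧ a' = e * a₁' := by
    refine ⟨Nat.gcd a a', Nat.gcd_pos_of_pos_left _ ha, a / Nat.gcd a a', a' / Nat.gcd a a',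
      Nat.coprime_div_gcd_div_gcd (Nat.gcd_pos_of_pos_left _ ha),
      (Nat.mul_div_cancel' (Nat.gcd_dvd_left _ _)).symm,
      (Nat.mul_div_cancel' (Nat.gcd_dvd_right _ _)).symm⟩
  have h1 : 0 < a₁ := Nat.pos_of_mul_pos_left ha
  have h1' : 0 < a₁' := Nat.pos_of_mul_pos_left ha'
  have hr1 : (0 : ℝ) < a₁ := by exact_mod_cast h1
  have hr1' : (0 : ℝ) < a₁' := by exact_mod_cast h1'
  have hre : (1 : ℝ) ≤ e := by exact_mod_cast he
  -- If `p / a` and `p' / a'` are both close to `u`, then `k = p a₁' - p' a₁` is at most `R`. It does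
  -- not vanish as the fractions are reduced, and it determines `p` modulo `a₁`.
  set R : ℝ := a₁' * δ + a₁ * δ' with hR
  have hR0 : 0 ≤ R := by positivity
  set KS : Finset ℤ := (Finset.Icc (-⌊R⌋) ⌊R⌋).erase 0 with hKS
  set P : ℤ := ⌊((e * a₁ : ℕ) : ℝ) * c⌋ with hP
  set M : ℕ := e * a₁ + 2 with hM
  set PS : ℤ → Finset ℤ := fun k => (Finset.Ico P (P + M)).filter
    fun p => (a₁ : ℤ) ∣ p * a₁' - k with hPS
  have hKcard : (KS.card : ℝ) ≤ 2 * R := by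
    have hf : 0 ≤ ⌊R⌋ := Int.floor_nonneg.2 hR0
    have : (KS.card : ℤ) = 2 * ⌊R⌋ := by
      rw [hKS, Finset.card_erase_of_mem (by simp [hf]), Int.card_Icc]
      omega
    have h2 : (KS.card : ℝ) = 2 * ⌊R⌋ := by exact_mod_cast this
    rw [h2]
    linarith [Int.floor_le R]
  have hPcard : ∀ k, ((PS k).card : ℝ) ≤ 4 * e := by
    intro k
    rcases (PS k).eq_empty_or_nonempty with h | ⟨p₀, hp₀⟩
    · rw [h]; simp
    · have hsub : PS k ⊆ (Finset.Ico P (P + M)).filter fun p => p ≡ p₀ [ZMOD a₁] := by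
        intro p hp
        have h2 := Finset.mem_filter.1 hp
        have h3 := (Finset.mem_filter.1 hp₀).2
        refine Finset.mem_filter.2 ⟨h2.1, ?_⟩
        have h4 : (a₁ : ℤ) ∣ a₁' * (p₀ - p) := by
          have := dvd_sub h3 h2.2
          have h5 : p₀ * (a₁' : ℤ) - k - (p * a₁' - k) = a₁' * (p₀ - p) := by ring
          rwa [h5] at this
        have h5 : IsCoprime (a₁ : ℤ) a₁' := Nat.isCoprime_iff_coprime.2 hcop
        exact Int.modEq_iff_dvd.2 (h5.dvd_of_dvd_mul_left h4)
      calc ((PS k).card : ℝ) ≤ M / a₁ + 1 :=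
            le_trans (by exact_mod_cast Finset.card_le_card hsub) (card_filter_modEq_le P M h1 p₀)
        _ = e + 2 / a₁ + 1 := by
            rw [hM]; push_cast; field_simp
        _ ≤ e + 2 / 1 + 1 := by
            gcongr
            exact_mod_cast h1
        _ ≤ 4 * e := by linarith
  set J : ℤ → ℤ → Set ℝ := fun k p => {u | |((e * a₁ : ℕ) : ℝ) * u + 0 - p| < δ ∧
    |((e * a₁' : ℕ) : ℝ) * u + 0 - ((p * a₁' - k) / a₁ : ℤ)| < δ'} with hJ
  have har : (0 : ℝ) < ((e * a₁ : ℕ) : ℝ) := by exact_mod_cast ha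
  have har' : (0 : ℝ) < ((e * a₁' : ℕ) : ℝ) := by exact_mod_cast ha'
  set μ : ℝ := min (2 * δ / ((e * a₁ : ℕ) : ℝ)) (2 * δ' / ((e * a₁' : ℕ) : ℝ)) with hμ
  have hμ0 : 0 ≤ μ := le_min (by positivity) (by positivity)
  have hJvol : ∀ k p, volume (J k p) ≤ ENNReal.ofReal μ := by
    intro k p
    rw [hμ, ENNReal.ofReal_min]
    refine le_min ?_ ?_
    · rw [← volume_abs_mul_add_sub_lt har 0 p]
      exact measure_mono fun u hu => hu.1
    · rw [← volume_abs_mul_add_sub_lt har' 0 ((p * a₁' - k) / a₁ : ℤ)]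
      exact measure_mono fun u hu => hu.2
  have hcov : {u : ℝ | u ∈ Set.Ico c (c + 1) ∧
      (∃ p : ℤ, Int.gcd p (e * a₁ : ℕ) = 1 ∧ |((e * a₁ : ℕ) : ℝ) * u - p| < δ) ∧
      ∃ p : ℤ, Int.gcd p (e * a₁' : ℕ) = 1 ∧ |((e * a₁' : ℕ) : ℝ) * u - p| < δ'} ⊆
      ⋃ k ∈ KS, ⋃ p ∈ PS k, J k p := by
    rintro u ⟨⟨hu1, hu2⟩, ⟨p, hp, hpu⟩, p', hp', hpu'⟩
    set k : ℤ := p * a₁' - p' * a₁ with hk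
    have hk0 : k ≠ 0 := by
      intro h0
      -- two reduced fractions with a common value have the same denominator
      have h2 : p * (e * a₁' : ℕ) = p' * (e * a₁ : ℕ) := by
        push_cast
        linear_combination (e : ℤ) * h0
      have h3 : IsCoprime p ((e * a₁ : ℕ) : ℤ) := Int.isCoprime_iff_gcd_eq_one.2 hp
      have h4 : IsCoprime p' ((e * a₁' : ℕ) : ℤ) := Int.isCoprime_iff_gcd_eq_one.2 hp'
      have h5 : ((e * a₁ : ℕ) : ℤ) ∣ (e * a₁' : ℕ) := h3.symm.dvd_of_dvd_mul_left ⟨p', by rw [h2]; ring⟩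
      have h6 : ((e * a₁' : ℕ) : ℤ) ∣ (e * a₁ : ℕ) := h4.symm.dvd_of_dvd_mul_left ⟨p, by rw [← h2]; ring⟩
      exact hne (Nat.dvd_antisymm (by exact_mod_cast h5) (by exact_mod_cast h6))
    have hkR : |(k : ℝ)| ≤ R := by
      have h2 : (k : ℝ) = a₁ * (((e * a₁' : ℕ) : ℝ) * u - p') - a₁' * (((e * a₁ : ℕ) : ℝ) * u - p) := by
        rw [hk]; push_cast; ring
      rw [h2]
      refine (abs_sub _ _).trans ?_
      rw [abs_mul, abs_mul, abs_of_pos hr1, abs_of_pos hr1', hR, add_comm]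
      gcongr
    refine Set.mem_biUnion (Finset.mem_coe.2 (Finset.mem_erase.2 ⟨hk0, Finset.mem_Icc.2 ?_⟩))
      (Set.mem_biUnion (x := p) (Finset.mem_coe.2 (Finset.mem_filter.2 ⟨Finset.mem_Ico.2 ?_, ?_⟩)) ?_)
    · have h2 := abs_le.1 hkR
      have h3 : k ≤ ⌊R⌋ := Int.le_floor.2 h2.2
      have h4 : -k ≤ ⌊R⌋ := Int.le_floor.2 (by push_cast; linarith)
      constructor <;> linarith
    · have h2 := abs_lt.1 hpu
      have h3 : ((e * a₁ : ℕ) : ℝ) * c ≤ ((e * a₁ : ℕ) : ℝ) * u := by gcongr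
      have h4 : ((e * a₁ : ℕ) : ℝ) * u < ((e * a₁ : ℕ) : ℝ) * c + ((e * a₁ : ℕ) : ℝ) := by
        calc _ < ((e * a₁ : ℕ) : ℝ) * (c + 1) := by gcongr
          _ = _ := by ring
      have h5 := Int.floor_le (((e * a₁ : ℕ) : ℝ) * c)
      have h6 := Int.lt_floor_add_one (((e * a₁ : ℕ) : ℝ) * c)
      constructor
      · have : (P : ℝ) < p + 1 := by linarith
        have : P < p + 1 := by exact_mod_cast this
        omega
      · have : (p : ℝ) < P + M := by
          have hMr : (M : ℝ) = ((e * a₁ : ℕ) : ℝ) + 2 := by rw [hM]; push_cast; rfl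
          rw [hMr]; linarith [h2.1]
        exact_mod_cast this
    · exact ⟨p', by rw [hk]; ring⟩
    · refine ⟨by simpa using hpu, ?_⟩
      have h2 : (p * a₁' - k) / (a₁ : ℤ) = p' := by
        rw [hk, sub_sub_cancel]
        exact Int.mul_ediv_cancel _ (by exact_mod_cast h1.ne')
      rw [h2]
      simpa using hpu'
  calc _ ≤ volume (⋃ k ∈ KS, ⋃ p ∈ PS k, J k p) := measure_mono hcov
    _ ≤ ∑ k ∈ KS, ∑ p ∈ PS k, volume (J k p) :=
        (measure_biUnion_finset_le _ _).trans
          (Finset.sum_le_sum fun k _ => measure_biUnion_finset_le _ _)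
    _ ≤ ∑ k ∈ KS, ∑ p ∈ PS k, ENNReal.ofReal μ :=
        Finset.sum_le_sum fun k _ => Finset.sum_le_sum fun p _ => hJvol k p
    _ ≤ ∑ k ∈ KS, ENNReal.ofReal (4 * e * μ) := by
        refine Finset.sum_le_sum fun k _ => ?_
        rw [Finset.sum_const, nsmul_eq_mul, ENNReal.ofReal_mul (by positivity),
          ← ENNReal.ofReal_natCast]
        gcongr
        exact hPcard k
    _ = ENNReal.ofReal (KS.card * (4 * e * μ)) := by
        rw [Finset.sum_const, nsmul_eq_mul, ENNReal.ofReal_mul (p := (KS.card : ℝ)) (by positivity),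
          ENNReal.ofReal_natCast]
    _ ≤ _ := by
        refine ENNReal.ofReal_le_ofReal ?_
        have h2 : δ * ((e * a₁' : ℕ) : ℝ) * μ ≤ 2 * (δ * δ') := by
          calc _ ≤ δ * ((e * a₁' : ℕ) : ℝ) * (2 * δ' / ((e * a₁' : ℕ) : ℝ)) := by
                gcongr
                exact min_le_right _ _
            _ = _ := by field_simp
        have h3 : δ' * ((e * a₁ : ℕ) : ℝ) * μ ≤ 2 * (δ * δ') := by
          calc _ ≤ δ' * ((e * a₁ : ℕ) : ℝ) * (2 * δ / ((e * a₁ : ℕ) : ℝ)) := by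
                gcongr
                exact min_le_left _ _
            _ = _ := by field_simp
        calc (KS.card : ℝ) * (4 * e * μ) ≤ 2 * R * (4 * e * μ) := by gcongr
          _ = 8 * (δ * ((e * a₁' : ℕ) : ℝ) * μ) + 8 * (δ' * ((e * a₁ : ℕ) : ℝ) * μ) := by
              rw [hR]; push_cast; ring
          _ ≤ _ := by linarith

end Line

/-! ### Linear forms on a single column -/

section Column

theorem volume_eq_lintegral_insertNth {N : ℕ} (i₀ : Fin (N + 1)) {S : Set (Fin (N + 1) → ℝ)}
    (hS : MeasurableSet S) :
    volume S = ∫⁻ z : Fin N → ℝ, volume {t : ℝ | i₀.insertNth (α := fun _ => ℝ) t z ∈ S} := by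
  set E := MeasurableEquiv.piFinSuccAbove (fun _ : Fin (N + 1) => ℝ) i₀
  have hE := (volume_preserving_piFinSuccAbove (fun _ : Fin (N + 1) => ℝ) i₀).symm
  rw [← hE.measure_preimage hS.nullMeasurableSet, Measure.volume_eq_prod,
    Measure.prod_apply_symm (E.symm.measurable hS)]
  rfl

theorem sum_insertNth {N : ℕ} (i₀ : Fin (N + 1)) (c : Fin (N + 1) → ℝ) (t : ℝ) (z : Fin N → ℝ) :
    ∑ i, c i * (i₀.insertNth (α := fun _ => ℝ) t z) i =
      c i₀ * t + ∑ i, c (i₀.succAbove i) * z i := by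
  rw [Fin.sum_univ_succAbove _ i₀]
  simp

theorem setOf_insertNth {N : ℕ} (i₀ : Fin (N + 1)) (c : Fin (N + 1) → ℝ) (T : Set ℝ)
    (I : Fin (N + 1) → Set ℝ) (z : Fin N → ℝ) :
    {t : ℝ | i₀.insertNth (α := fun _ => ℝ) t z ∈
      {y : Fin (N + 1) → ℝ | (∀ i, y i ∈ I i) ∧ ∑ i, c i * y i ∈ T}} =
    {t | (∀ i, z i ∈ I (i₀.succAbove i)) ∧ t ∈ I i₀ ∧
      c i₀ * t + ∑ i, c (i₀.succAbove i) * z i ∈ T} := by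
  ext t
  simp only [Set.mem_ofPred_eq, sum_insertNth]
  rw [Fin.forall_iff_succAbove i₀]
  simp only [Fin.insertNth_apply_same, Fin.insertNth_apply_succAbove]
  tauto

theorem measurableSet_box_inter {N : ℕ} (c : Fin N → ℝ) {T : Set ℝ} (hT : MeasurableSet T)
    {I : Fin N → Set ℝ} (hI : ∀ i, MeasurableSet (I i)) :
    MeasurableSet {y : Fin N → ℝ | (∀ i, y i ∈ I i) ∧ ∑ i, c i * y i ∈ T} := by
  have h1 : MeasurableSet {y : Fin N → ℝ | ∀ i, y i ∈ I i} := by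
    have : {y : Fin N → ℝ | ∀ i, y i ∈ I i} = Set.pi Set.univ I := by ext; simp
    rw [this]
    exact MeasurableSet.univ_pi hI
  have h2 : Measurable fun y : Fin N → ℝ => ∑ i, c i * y i := by fun_prop
  exact h1.inter (h2 hT)

/-- Bounds for the one-dimensional slices in direction `i₀` give bounds for the set of points of a
box at which a linear form takes values in `T`. -/
theorem volume_box_inter_le {N : ℕ} (i₀ : Fin (N + 1)) (c : Fin (N + 1) → ℝ) {T : Set ℝ}
    (hT : MeasurableSet T) {I : Fin (N + 1) → Set ℝ} (hI : ∀ i, MeasurableSet (I i)) {K : ℝ≥0∞}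
    (h : ∀ β, volume {t | t ∈ I i₀ ∧ c i₀ * t + β ∈ T} ≤ K) :
    volume {y : Fin (N + 1) → ℝ | (∀ i, y i ∈ I i) ∧ ∑ i, c i * y i ∈ T} ≤
      K * ∏ i : Fin N, volume (I (i₀.succAbove i)) := by
  rw [volume_eq_lintegral_insertNth i₀ (measurableSet_box_inter c hT hI), ← volume_pi_pi]
  calc _ ≤ ∫⁻ z, (Set.pi Set.univ fun i => I (i₀.succAbove i)).indicator (fun _ => K) z := by
        refine lintegral_mono fun z => ?_
        rw [setOf_insertNth]
        by_cases hz : ∀ i, z i ∈ I (i₀.succAbove i)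
        · rw [Set.indicator_of_mem (by simpa using hz)]
          exact (measure_mono fun t ht => ht.2).trans (h (∑ i, c (i₀.succAbove i) * z i))
        · simp [hz]
    _ = _ := by
        rw [lintegral_indicator (MeasurableSet.univ_pi fun i => hI _), setLIntegral_const]

theorem le_volume_box_inter {N : ℕ} (i₀ : Fin (N + 1)) (c : Fin (N + 1) → ℝ) {T : Set ℝ}
    (hT : MeasurableSet T) {I : Fin (N + 1) → Set ℝ} (hI : ∀ i, MeasurableSet (I i)) {K : ℝ≥0∞}
    (h : ∀ β, K ≤ volume {t | t ∈ I i₀ ∧ c i₀ * t + β ∈ T}) :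
    K * ∏ i : Fin N, volume (I (i₀.succAbove i)) ≤
      volume {y : Fin (N + 1) → ℝ | (∀ i, y i ∈ I i) ∧ ∑ i, c i * y i ∈ T} := by
  rw [volume_eq_lintegral_insertNth i₀ (measurableSet_box_inter c hT hI), ← volume_pi_pi]
  calc _ = ∫⁻ z, (Set.pi Set.univ fun i => I (i₀.succAbove i)).indicator (fun _ => K) z := by
        rw [lintegral_indicator (MeasurableSet.univ_pi fun i => hI _), setLIntegral_const]
    _ ≤ _ := by
        refine lintegral_mono fun z => ?_
        rw [setOf_insertNth]
        by_cases hz : ∀ i, z i ∈ I (i₀.succAbove i)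
        · rw [Set.indicator_of_mem (by simpa using hz)]
          refine (h (∑ i, c (i₀.succAbove i) * z i)).trans (measure_mono fun t ht => ⟨hz, ht⟩)
        · rw [Set.indicator_of_notMem (by simpa using hz)]
          exact zero_le

end Column

section Column

variable {n : ℕ}

/-- The linear form `y ↦ ∑ i, q i * y i` on a column. -/
def colDot (q : Fin n → ℤ) (y : Fin n → ℝ) : ℝ := ∑ i, (q i : ℝ) * y i

/-- The half-open dyadic cube of side `2⁻ˡ` and index `z` in the space of columns. -/
def colCube (l : ℕ) (z : Fin n → ℤ) : Set (Fin n → ℝ) :=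
  {y | ∀ i, y i ∈ Set.Ico ((z i : ℝ) / 2 ^ l) ((z i + 1 : ℝ) / 2 ^ l)}

theorem measurable_colDot (q : Fin n → ℤ) : Measurable (colDot q) := by
  unfold colDot; fun_prop

theorem continuous_colDot (q : Fin n → ℤ) : Continuous (colDot q) := by
  unfold colDot; fun_prop

theorem volume_Ico_dyadic (l : ℕ) (a : ℝ) :
    volume (Set.Ico (a / 2 ^ l) ((a + 1) / 2 ^ l)) = ENNReal.ofReal ((2 : ℝ)⁻¹ ^ l) := by
  rw [Real.volume_Ico, ← sub_div, add_sub_cancel_left, one_div, ← inv_pow]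

theorem colCube_eq_pi (l : ℕ) (z : Fin n → ℤ) : colCube l z =
    Set.pi Set.univ fun i => Set.Ico ((z i : ℝ) / 2 ^ l) ((z i + 1 : ℝ) / 2 ^ l) := by
  ext; simp [colCube]

theorem measurableSet_colCube (l : ℕ) (z : Fin n → ℤ) : MeasurableSet (colCube l z) := by
  rw [colCube_eq_pi]
  exact MeasurableSet.univ_pi fun i => measurableSet_Ico

theorem volume_colCube (l : ℕ) (z : Fin n → ℤ) :
    volume (colCube l z) = ENNReal.ofReal ((2 : ℝ)⁻¹ ^ l) ^ n := by
  rw [colCube_eq_pi, volume_pi_pi]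
  simp only [volume_Ico_dyadic, Finset.prod_const, Finset.card_univ, Fintype.card_fin]

theorem cell_eq_setOf {m : ℕ} (l : ℕ) (x : Cols n m) :
    cell l x = Set.pi Set.univ fun j => colCube l (dyIdx l x j) := by
  rw [cell_eq_pi]
  simp only [colCube_eq_pi]

theorem volume_cell_eq_prod {m : ℕ} (l : ℕ) (x : Cols n m) :
    volume (cell l x) = ∏ j, volume (colCube l (dyIdx l x j)) := by
  rw [cell_eq_setOf, volume_pi_pi]

theorem measurableSet_near_int (δ : ℝ) (G : ℤ → Prop) (θ : ℝ) :
    MeasurableSet {s : ℝ | ∃ p : ℤ, G p ∧ |θ * s - p| < δ} := by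
  have : {s : ℝ | ∃ p : ℤ, G p ∧ |θ * s - p| < δ} = ⋃ p, ⋃ (_ : G p), {s : ℝ | |θ * s - (p : ℤ)| < δ} := by
    ext; simp
  rw [this]
  refine MeasurableSet.iUnion fun p => MeasurableSet.iUnion fun _ => ?_
  exact measurableSet_lt (by fun_prop) measurable_const

theorem volume_colCube_near_int_le {q : Fin n → ℤ} {i₀ : Fin n} {l : ℕ} (hq : (2 : ℤ) ^ l ≤ q i₀)
    (z : Fin n → ℤ) {δ : ℝ} (hδ0 : 0 ≤ δ) (hδ : δ ≤ 1) :
    volume {y | y ∈ colCube l z ∧ ∃ p : ℤ, |colDot q y - p| < δ} ≤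
      ENNReal.ofReal (8 * δ) * volume (colCube l z) := by
  obtain ⟨N, rfl⟩ : ∃ N, n = N + 1 := ⟨n - 1, by have := i₀.2; omega⟩
  have hq' : (2 : ℝ) ^ l ≤ q i₀ := by exact_mod_cast hq
  have hq0 : (0 : ℝ) < q i₀ := lt_of_lt_of_le (by positivity) hq'
  have hT := measurableSet_near_int δ (fun _ => True) 1
  simp only [true_and, one_mul] at hT
  have := volume_box_inter_le i₀ (fun i => (q i : ℝ)) hT
    (I := fun i => Set.Ico ((z i : ℝ) / 2 ^ l) ((z i + 1 : ℝ) / 2 ^ l)) (fun i => measurableSet_Ico)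
    (K := ENNReal.ofReal (8 * δ * 2⁻¹ ^ l)) ?_
  · refine this.trans (le_of_eq ?_)
    simp only [volume_Ico_dyadic, Finset.prod_const, volume_colCube, Finset.card_univ, Fintype.card_fin]
    rw [ENNReal.ofReal_mul (by positivity), mul_assoc, ← pow_succ']
  · intro β
    have h1 : ((z i₀ : ℝ) + 1) / 2 ^ l = (z i₀ : ℝ) / 2 ^ l + 2⁻¹ ^ l := by
      rw [add_div, one_div, inv_pow]
    rw [h1]
    refine volume_near_int_le hq0 β _ ?_ hδ0 hδ
    calc (1 : ℝ) = 2 ^ l * 2⁻¹ ^ l := by rw [← mul_pow]; norm_num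
      _ ≤ _ := by gcongr

theorem le_volume_colCube_near_coprime {q : Fin n → ℤ} {i₀ : Fin n} {a : ℕ} (hqa : q i₀ = a)
    (ha : a ∈ sparsePrimeFactors) {l : ℕ} (hl : 16 * (Nat.log 2 a + 1) * (2 : ℝ) ^ l ≤ a)
    (z : Fin n → ℤ) {δ : ℝ} (hδ0 : 0 < δ) (hδ : δ ≤ 1) :
    ENNReal.ofReal (δ / 32) * volume (colCube l z) ≤ volume {y | y ∈ colCube l z ∧
      ∃ p : ℤ, Int.gcd p a = 1 ∧ δ / 2 ≤ colDot q y - p ∧ colDot q y - p < δ} := by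
  obtain ⟨N, rfl⟩ : ∃ N, n = N + 1 := ⟨n - 1, by have := i₀.2; omega⟩
  have hT : MeasurableSet {s : ℝ | ∃ p : ℤ, Int.gcd p a = 1 ∧ δ / 2 ≤ s - p ∧ s - p < δ} := by
    have : {s : ℝ | ∃ p : ℤ, Int.gcd p a = 1 ∧ δ / 2 ≤ s - p ∧ s - p < δ} =
        ⋃ p : ℤ, ⋃ (_ : Int.gcd p a = 1), ({s : ℝ | δ / 2 ≤ s - p} ∩ {s : ℝ | s - p < δ}) := by
      ext s
      simp only [Set.mem_iUnion, Set.mem_inter_iff, Set.mem_ofPred_eq, exists_prop]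
    rw [this]
    refine MeasurableSet.iUnion fun p => MeasurableSet.iUnion fun _ => ?_
    exact (measurableSet_le measurable_const (by fun_prop)).inter
      (measurableSet_lt (by fun_prop) measurable_const)
  have := le_volume_box_inter i₀ (fun i => (q i : ℝ)) hT
    (I := fun i => Set.Ico ((z i : ℝ) / 2 ^ l) ((z i + 1 : ℝ) / 2 ^ l)) (fun i => measurableSet_Ico)
    (K := ENNReal.ofReal (δ * 2⁻¹ ^ l / 32)) ?_
  · refine le_trans (le_of_eq ?_) this
    simp only [volume_Ico_dyadic, Finset.prod_const, volume_colCube, Finset.card_univ, Fintype.card_fin]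
    rw [mul_div_right_comm, ENNReal.ofReal_mul (by positivity), mul_assoc, ← pow_succ']
  · intro β
    have h1 : ((z i₀ : ℝ) + 1) / 2 ^ l = (z i₀ : ℝ) / 2 ^ l + 2⁻¹ ^ l := by
      rw [add_div, one_div, inv_pow]
    have h2 : (q i₀ : ℝ) = a := by rw [hqa]; simp
    rw [h1]
    simp only [h2]
    refine le_volume_near_coprime ha β _ ?_ hδ0 hδ
    rw [inv_pow, ← div_eq_mul_inv, le_div_iff₀ (by positivity)]
    exact hl

/-- Two linearly independent integer forms are independent random variables on the torus, as they
form a surjective homomorphism to the two-dimensional torus. -/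
theorem volume_closedBall_torus_le {q q' : Fin n → ℤ} {i₀ i₁ : Fin n}
    (hdet : q i₀ * q' i₁ ≠ q i₁ * q' i₀) (δ δ' : ℝ) :
    volume {y : Fin n → ℝ | (∀ i, y i ∈ Set.Ioc (0 : ℝ) 1) ∧
      ‖(colDot q y : UnitAddCircle)‖ ≤ δ ∧ ‖(colDot q' y : UnitAddCircle)‖ ≤ δ'} ≤
      ENNReal.ofReal (2 * δ) * ENNReal.ofReal (2 * δ') := by
  let ev : (q : Fin n → ℤ) → (Fin n → UnitAddCircle) →+ UnitAddCircle := fun q =>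
    ∑ i, q i • Pi.evalAddMonoidHom (fun _ : Fin n => UnitAddCircle) i
  have hev : ∀ (q : Fin n → ℤ) w, ev q w = ∑ i, q i • w i := fun q w => by
    simp [ev, AddMonoidHom.finsetSum_apply]
  have hevc : ∀ q : Fin n → ℤ, Continuous (ev q) := by
    intro q
    have : ⇑(ev q) = fun w => ∑ i, q i • w i := funext (hev q)
    rw [this]
    fun_prop
  have hevm : ∀ (q : Fin n → ℤ) (y : Fin n → ℝ), ev q (fun i => (y i : UnitAddCircle)) =
      (colDot q y : UnitAddCircle) := by
    intro q y
    rw [hev, colDot]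
    have : ∀ i, q i • (y i : UnitAddCircle) = (((q i : ℝ) * y i : ℝ) : UnitAddCircle) := by
      intro i
      rw [← zsmul_eq_mul]
      rfl
    simp only [this]
    exact (map_sum (QuotientAddGroup.mk' (AddSubgroup.zmultiples (1 : ℝ))) _ _).symm
  let Φ : (Fin n → UnitAddCircle) →+ UnitAddCircle × UnitAddCircle := (ev q).prod (ev q')
  have hΦs : Function.Surjective Φ := by
    rintro ⟨u, v⟩
    obtain ⟨u, rfl⟩ := QuotientAddGroup.mk_surjective u
    obtain ⟨v, rfl⟩ := QuotientAddGroup.mk_surjective v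
    have hne : i₀ ≠ i₁ := by
      rintro rfl
      exact hdet rfl
    set D : ℝ := (q i₀ : ℝ) * q' i₁ - q i₁ * q' i₀ with hD
    have hD0 : D ≠ 0 := by
      rw [hD, sub_ne_zero]
      exact_mod_cast hdet
    -- solve the two equations in the two coordinates `i₀`, `i₁`
    set y : Fin n → ℝ := Pi.single i₀ ((u * q' i₁ - q i₁ * v) / D) +
      Pi.single i₁ ((q i₀ * v - u * q' i₀) / D) with hy
    have hdot : ∀ c : Fin n → ℤ, colDot c y = c i₀ * ((u * q' i₁ - q i₁ * v) / D) +
        c i₁ * ((q i₀ * v - u * q' i₀) / D) := by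
      intro c
      simp only [colDot, hy, Pi.add_apply, mul_add, Finset.sum_add_distrib]
      rw [Finset.sum_eq_single i₀, Finset.sum_eq_single i₁]
      · simp
      · intro i _ hi; simp [hi]
      · simp
      · intro i _ hi; simp [hi]
      · simp
    refine ⟨fun i => (y i : UnitAddCircle), ?_⟩
    show (ev q _, ev q' _) = _
    rw [hevm, hevm, hdot, hdot]
    congr 2
    · field_simp; rw [hD]; ring
    · field_simp; rw [hD]; ring
  have hprob : IsProbabilityMeasure (volume : Measure UnitAddCircle) :=
    ⟨by simp⟩
  have hΦ : MeasurePreserving Φ (Measure.pi fun _ : Fin n => (volume : Measure UnitAddCircle))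
      (volume.prod volume) :=
    AddMonoidHom.measurePreserving ((hevc q).prodMk (hevc q')) hΦs (by
      rw [measure_univ, measure_univ])
  have hπ : MeasurePreserving (fun (y : Fin n → ℝ) i => (y i : UnitAddCircle))
      (Measure.pi fun _ : Fin n => (volume : Measure ℝ).restrict (Set.Ioc 0 (0 + 1)))
      (Measure.pi fun _ : Fin n => (volume : Measure UnitAddCircle)) :=
    measurePreserving_pi _ _ fun _ => UnitAddCircle.measurePreserving_mk 0
  have hcomp := hΦ.comp hπ
  have hB : MeasurableSet (Metric.closedBall (0 : UnitAddCircle) δ ×ˢ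
      Metric.closedBall (0 : UnitAddCircle) δ') :=
    Metric.isClosed_closedBall.measurableSet.prod Metric.isClosed_closedBall.measurableSet
  have hpre := hcomp.measure_preimage hB.nullMeasurableSet
  rw [← Measure.restrict_pi_pi, Measure.restrict_apply (hcomp.measurable hB),
    Measure.prod_prod, AddCircle.volume_closedBall, AddCircle.volume_closedBall] at hpre
  calc _ ≤ _ := measure_mono ?_
    _ = _ := hpre
    _ ≤ _ := by
        gcongr <;> exact min_le_right _ _
  rintro y ⟨h1, h2, h3⟩
  refine ⟨⟨?_, ?_⟩, fun i _ => by simpa using h1 i⟩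
  · rw [mem_closedBall_zero_iff]
    show ‖ev q _‖ ≤ δ
    rwa [hevm]
  · rw [mem_closedBall_zero_iff]
    show ‖ev q' _‖ ≤ δ'
    rwa [hevm]

theorem volume_colCube_near_coprime_inter_le {q q' : Fin n → ℤ} {i₀ : Fin n} (hq : 0 < q i₀)
    (hq' : 0 < q' i₀) (hne : q ≠ q') {δ δ' : ℝ} (hδ0 : 0 ≤ δ) (hδ : δ ≤ 1) (hδ'0 : 0 ≤ δ') :
    volume {y : Fin n → ℝ | y ∈ colCube 0 0 ∧
      (∃ p : ℤ, Int.gcd p (q i₀) = 1 ∧ |colDot q y - p| < δ) ∧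
      ∃ p : ℤ, Int.gcd p (q' i₀) = 1 ∧ |colDot q' y - p| < δ'} ≤
      ENNReal.ofReal (32 * (δ * δ')) := by
  by_cases hpar : ∃ i₁, q i₀ * q' i₁ ≠ q i₁ * q' i₀
  · obtain ⟨i₁, hdet⟩ := hpar
    have hnear : ∀ (s : ℝ) (p : ℤ) (ε : ℝ), |s - p| < ε → ‖(s : UnitAddCircle)‖ ≤ ε := by
      intro s p ε h
      rw [UnitAddCircle.norm_eq]
      exact (round_le s p).trans h.le
    set S := {y : Fin n → ℝ | ‖(colDot q y : UnitAddCircle)‖ ≤ δ ∧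
      ‖(colDot q' y : UnitAddCircle)‖ ≤ δ'} with hS
    have hae : (Set.pi Set.univ fun _ : Fin n => Set.Ioc (0 : ℝ) 1) =ᵐ[volume]
        Set.Icc (fun _ => 0) (fun _ => 1) := Measure.univ_pi_Ioc_ae_eq_Icc
    calc _ ≤ volume (Set.Icc (fun _ => 0) (fun _ => 1) ∩ S) := by
          refine measure_mono ?_
          rintro y ⟨h1, ⟨p, -, h2⟩, p', -, h3⟩
          refine ⟨⟨fun i => ?_, fun i => ?_⟩, hnear _ p _ h2, hnear _ p' _ h3⟩
          · have := (h1 i).1; simpa using this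
          · have := (h1 i).2.le; simpa using this
      _ = volume ((Set.pi Set.univ fun _ : Fin n => Set.Ioc (0 : ℝ) 1) ∩ S) :=
          measure_congr (hae.symm.inter (Filter.EventuallyEq.refl _ _))
      _ ≤ ENNReal.ofReal (2 * δ) * ENNReal.ofReal (2 * δ') := by
          refine le_trans (measure_mono ?_) (volume_closedBall_torus_le hdet δ δ')
          rintro y ⟨h1, h2, h3⟩
          exact ⟨fun i => h1 i trivial, h2, h3⟩
      _ ≤ _ := by
          rw [← ENNReal.ofReal_mul (by positivity)]
          refine ENNReal.ofReal_le_ofReal ?_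
          have : 0 ≤ δ * δ' := by positivity
          linarith
  · push Not at hpar
    obtain ⟨N, rfl⟩ : ∃ N, n = N + 1 := ⟨n - 1, by have := i₀.2; omega⟩
    obtain ⟨a, ha⟩ : ∃ a : ℕ, q i₀ = a := ⟨(q i₀).toNat, by omega⟩
    obtain ⟨a', ha'⟩ : ∃ a : ℕ, q' i₀ = a := ⟨(q' i₀).toNat, by omega⟩
    have ha0 : 0 < a := by omega
    have ha'0 : 0 < a' := by omega
    have har : (0 : ℝ) < a := by exact_mod_cast ha0
    have haa : a ≠ a' := by
      rintro rfl
      refine hne (funext fun i => ?_)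
      have := hpar i
      rw [ha, ha', mul_comm] at this
      exact (mul_right_cancel₀ (by omega) this).symm
    -- the second form is a multiple of the first one
    have hdot : ∀ y, colDot q' y = (a' / a : ℝ) * colDot q y := by
      intro y
      rw [colDot, colDot, Finset.mul_sum]
      refine Finset.sum_congr rfl fun i _ => ?_
      have h1 : (a : ℝ) * q' i = q i * a' := by
        have := hpar i
        rw [ha, ha'] at this
        exact_mod_cast this
      field_simp
      linear_combination (y i) * h1
    have hT := (measurableSet_near_int δ (fun p => Int.gcd p a = 1) 1).inter
      (measurableSet_near_int δ' (fun p => Int.gcd p a' = 1) (a' / a : ℝ))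
    have := volume_box_inter_le i₀ (fun i => (q i : ℝ)) hT
      (I := fun i => Set.Ico (((0 : Fin (N + 1) → ℤ) i : ℝ) / 2 ^ 0)
        (((0 : Fin (N + 1) → ℤ) i + 1 : ℝ) / 2 ^ 0)) (fun i => measurableSet_Ico)
      (K := ENNReal.ofReal (32 * (δ * δ'))) ?_
    · rw [Finset.prod_congr rfl fun i _ => volume_Ico_dyadic 0 _] at this
      simp only [pow_zero, ENNReal.ofReal_one, Finset.prod_const_one, mul_one] at this
      refine le_trans (measure_mono ?_) this
      rintro y ⟨h1, h2, h3⟩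
      refine ⟨by simpa [colCube] using h1, ?_, ?_⟩
      · simpa only [one_mul, ha, colDot, Set.mem_ofPred_eq] using h2
      · rw [hdot] at h3
        simpa only [ha', colDot, Set.mem_ofPred_eq] using h3
    · intro β
      have h2 : (q i₀ : ℝ) = a := by rw [ha]; simp
      simp only [h2]
      have hshift := measure_preimage_add_right (volume : Measure ℝ) (β / a)
        {u : ℝ | u ∈ Set.Ico (β / a) (β / a + 1) ∧ (∃ p : ℤ, Int.gcd p a = 1 ∧ |a * u - p| < δ) ∧
          ∃ p : ℤ, Int.gcd p a' = 1 ∧ |a' * u - p| < δ'}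
      refine le_trans (measure_mono ?_) (hshift.le.trans
        (volume_near_coprime_inter_le ha0 ha'0 haa (β / a) hδ0 hδ hδ'0))
      rintro t ⟨⟨ht1, ht2⟩, ⟨p, hp, hp'⟩, p', hp2, hp2'⟩
      simp only [pow_zero, div_one, Pi.zero_apply, Int.cast_zero, zero_add] at ht1 ht2
      have e1 : (a : ℝ) * (t + β / a) = 1 * (a * t + β) := by field_simp
      have e2 : (a' : ℝ) * (t + β / a) = a' / a * (a * t + β) := by field_simp
      refine ⟨⟨by linarith, by linarith⟩, ⟨p, hp, ?_⟩, p', hp2, ?_⟩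
      · rwa [e1]
      · rwa [e2]

end Column

/-! ### The quasi-independent family attached to the resonant sets -/

section Family

variable {n m : ℕ}

theorem distInt_eq_norm (y : ℝ) : distInt y = ‖(y : UnitAddCircle)‖ :=
  UnitAddCircle.norm_eq.symm

theorem continuous_distInt : Continuous distInt := by
  have : distInt = fun y : ℝ => ‖(y : UnitAddCircle)‖ := funext distInt_eq_norm
  rw [this]
  exact continuous_norm.comp (AddCircle.continuous_mk' 1)

theorem distInt_nonneg (y : ℝ) : 0 ≤ distInt y := abs_nonneg _

theorem distInt_le (y : ℝ) (p : ℤ) : distInt y ≤ |y - p| := round_le y p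

/-- The vectors of non-negative integer exponents with sum `L`. -/
noncomputable def exponents (m L : ℕ) : Finset (Fin m → ℕ) := Finset.piAntidiag Finset.univ L

theorem mem_exponents {L : ℕ} {b : Fin m → ℕ} : b ∈ exponents m L ↔ ∑ j, b j = L := by
  simp [exponents, Finset.mem_piAntidiag]

theorem le_of_mem_exponents {L : ℕ} {b : Fin m → ℕ} (hb : b ∈ exponents m L) (j : Fin m) :
    b j ≤ L := by
  rw [← mem_exponents.1 hb]
  exact Finset.single_le_sum (f := b) (fun _ _ => Nat.zero_le _) (Finset.mem_univ j)

/-- Up to constants, the measure of the set of points of `[0, 1)ᵐ` whose coordinates have product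
less than `2⁻ᴸ`. -/
noncomputable def shellVolume (m L : ℕ) : ℝ≥0 := (exponents m L).card * 2⁻¹ ^ L

theorem prod_ofReal_exponents {L : ℕ} {b : Fin m → ℕ} (hb : b ∈ exponents m L) {c : ℝ} (hc : 0 ≤ c) :
    ∏ j, ENNReal.ofReal (c * 2⁻¹ ^ b j) = ENNReal.ofReal (c ^ m * 2⁻¹ ^ L) := by
  rw [← ENNReal.ofReal_prod_of_nonneg (fun _ _ => by positivity), Finset.prod_mul_distrib,
    Finset.prod_pow_eq_pow_sum, mem_exponents.1 hb]
  simp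

theorem sum_ofReal_exponents (m L : ℕ) (c : ℝ≥0) :
    ∑ _b ∈ exponents m L, ENNReal.ofReal ((c : ℝ) * 2⁻¹ ^ L) = (c * shellVolume m L : ℝ≥0) := by
  rw [Finset.sum_const, nsmul_eq_mul]
  have : (c : ℝ) * 2⁻¹ ^ L = ((c * 2⁻¹ ^ L : ℝ≥0) : ℝ) := by push_cast; rfl
  rw [this, ENNReal.ofReal_coe_nnreal, shellVolume]
  push_cast
  ring

/-- The points of a column that are within `δ` of a hyperplane `q · y = p` with `p` coprime
to the coordinate `q i₀`. -/
def nearCoprime (i₀ : Fin n) (q : Fin n → ℤ) (δ : ℝ) : Set (Fin n → ℝ) :=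
  {y | ∃ p : ℤ, Int.gcd p (q i₀) = 1 ∧ |colDot q y - p| < δ}

/-- The points of a column at distance between `δ / 2` and `δ` on the positive side of a
hyperplane `q · y = p` with `p` coprime to `q i₀`. -/
def coprimeShell (i₀ : Fin n) (q : Fin n → ℤ) (δ : ℝ) : Set (Fin n → ℝ) :=
  {y | ∃ p : ℤ, Int.gcd p (q i₀) = 1 ∧ δ / 2 ≤ colDot q y - p ∧ colDot q y - p < δ}

/-- A union of products of shells which, up to constants, exhausts the set of matrices
with `∏ ‖q xⱼ‖ < 2⁻ᴸ`. -/
def shellCore (m : ℕ) (i₀ : Fin n) (q : Fin n → ℤ) (L : ℕ) : Set (Cols n m) :=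
  {x | x ∈ cell 0 0 ∧ ∃ b ∈ exponents m L, ∀ j, x j ∈ coprimeShell i₀ q (2⁻¹ ^ (b j + 1))}

/-- The dyadic scale below which `∏ ‖q xⱼ‖` is almost constant near `shellCore m i₀ q L`. -/
def shellScale (q : Fin n → ℤ) (L : ℕ) : ℕ := (∑ i, (q i).natAbs) + L + 2

/-- The union of the dyadic cubes of scale `shellScale q L` that meet `shellCore m i₀ q L`. -/
def shellCover (m : ℕ) (i₀ : Fin n) (q : Fin n → ℤ) (L : ℕ) : Set (Cols n m) :=
  {x | ∃ x' ∈ shellCore m i₀ q L, dyIdx (shellScale q L) x = dyIdx (shellScale q L) x'}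

theorem shellCore_subset_shellCover (i₀ : Fin n) (q : Fin n → ℤ) (L : ℕ) :
    shellCore m i₀ q L ⊆ shellCover m i₀ q L := fun x hx => ⟨x, hx, rfl⟩

theorem isStep_shellCover (i₀ : Fin n) (q : Fin n → ℤ) (L : ℕ) :
    IsStep (shellScale q L) (· ∈ shellCover m i₀ q L) := by
  intro x y hxy
  simp only [shellCover, Set.mem_ofPred_eq, hxy]

theorem shellCover_subset (i₀ : Fin n) (q : Fin n → ℤ) (L : ℕ) :
    shellCover m i₀ q L ⊆ cell 0 0 := by
  rintro x ⟨x', hx', h⟩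
  exact (dyIdx_eq_of_le (Nat.zero_le _) h).trans hx'.1

theorem abs_sub_lt_of_dyIdx_eq {l : ℕ} {x x' : Cols n m} (h : dyIdx l x = dyIdx l x') (j : Fin m)
    (i : Fin n) : |x j i - x' j i| < 2⁻¹ ^ l := by
  have h1 := Int.abs_sub_lt_one_of_floor_eq_floor (congrFun (congrFun h j) i)
  rw [← mul_sub, abs_mul, abs_of_pos (by positivity), mul_comm, ← lt_div_iff₀ (by positivity)] at h1
  rwa [inv_pow, ← one_div]

theorem abs_colDot_sub_le {l : ℕ} {x x' : Cols n m} (h : dyIdx l x = dyIdx l x') (q : Fin n → ℤ)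
    (j : Fin m) : |colDot q (x j) - colDot q (x' j)| ≤ (∑ i, (q i).natAbs : ℕ) * 2⁻¹ ^ l := by
  rw [colDot, colDot, ← Finset.sum_sub_distrib]
  refine (Finset.abs_sum_le_sum_abs _ _).trans ?_
  push_cast
  rw [Finset.sum_mul]
  refine Finset.sum_le_sum fun i _ => ?_
  rw [← mul_sub, abs_mul]
  have : |(q i : ℝ)| = ((q i).natAbs : ℝ) := by rw [Nat.cast_natAbs]; push_cast; rfl
  rw [this]
  gcongr
  exact (abs_sub_lt_of_dyIdx_eq h j i).le

theorem abs_colDot_sub_le_of_shellScale {q : Fin n → ℤ} {L : ℕ} {x x' : Cols n m}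
    (h : dyIdx (shellScale q L) x = dyIdx (shellScale q L) x') (j : Fin m) :
    |colDot q (x j) - colDot q (x' j)| ≤ 2⁻¹ ^ (L + 2) := by
  refine (abs_colDot_sub_le h q j).trans ?_
  set s := ∑ i, (q i).natAbs with hs
  have h1 : (s : ℝ) ≤ 2 ^ s := by exact_mod_cast s.lt_two_pow_self.le
  calc (s : ℝ) * 2⁻¹ ^ shellScale q L ≤ 2 ^ s * 2⁻¹ ^ (s + (L + 2)) := by
        rw [shellScale, ← hs, add_assoc]; gcongr
    _ = (2 * 2⁻¹) ^ s * 2⁻¹ ^ (L + 2) := by rw [pow_add, mul_pow]; ring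
    _ = _ := by norm_num

theorem shellCover_near (i₀ : Fin n) (q : Fin n → ℤ) (L : ℕ) {x : Cols n m}
    (hx : x ∈ shellCover m i₀ q L) :
    ∃ b ∈ exponents m L, ∀ j, x j ∈ nearCoprime i₀ q (2⁻¹ ^ b j) := by
  obtain ⟨x', ⟨-, b, hb, hx'⟩, h⟩ := hx
  refine ⟨b, hb, fun j => ?_⟩
  obtain ⟨p, hp, h1, h2⟩ := hx' j
  refine ⟨p, hp, ?_⟩
  have h3 := abs_colDot_sub_le_of_shellScale h j
  have h4 : (2 : ℝ)⁻¹ ^ (L + 2) ≤ 2⁻¹ ^ (b j + 2) :=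
    pow_le_pow_of_le_one (by norm_num) (by norm_num)
      (Nat.add_le_add_right (le_of_mem_exponents hb j) 2)
  have h5 : (0 : ℝ) < 2⁻¹ ^ b j := by positivity
  have h6 : |colDot q (x' j) - p| < 2⁻¹ ^ (b j + 1) := by
    rw [abs_of_nonneg (le_trans (by positivity) h1)]; exact h2
  calc |colDot q (x j) - p| = |(colDot q (x j) - colDot q (x' j)) + (colDot q (x' j) - p)| := by
        congr 1; ring
    _ ≤ |colDot q (x j) - colDot q (x' j)| + |colDot q (x' j) - p| := abs_add_le _ _
    _ < 2⁻¹ ^ (b j + 2) + 2⁻¹ ^ (b j + 1) := by linarith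
    _ ≤ 2⁻¹ ^ b j := by rw [pow_add, pow_add]; linarith

/-- The closed set `∏ ‖q xⱼ‖ ≤ 2⁻ᴸ`. -/
def closedMult (m : ℕ) (q : Fin n → ℤ) (L : ℕ) : Set (Cols n m) :=
  {x | ∏ j, distInt (colDot q (x j)) ≤ 2⁻¹ ^ L}

theorem isClosed_closedMult (q : Fin n → ℤ) (L : ℕ) : IsClosed (closedMult m q L) := by
  refine isClosed_le (continuous_finsetProd _ fun j _ => ?_) continuous_const
  exact continuous_distInt.comp ((continuous_colDot q).comp (continuous_apply j))

theorem shellCover_subset_closedMult (i₀ : Fin n) (q : Fin n → ℤ) (L : ℕ) :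
    shellCover m i₀ q L ⊆ closedMult m q L := by
  intro x hx
  obtain ⟨b, hb, h⟩ := shellCover_near i₀ q L hx
  calc ∏ j, distInt (colDot q (x j)) ≤ ∏ j, (2 : ℝ)⁻¹ ^ b j := by
        refine Finset.prod_le_prod (fun j _ => distInt_nonneg _) fun j _ => ?_
        obtain ⟨p, -, hp⟩ := h j
        exact (distInt_le _ p).trans hp.le
    _ = 2⁻¹ ^ L := by rw [Finset.prod_pow_eq_pow_sum, mem_exponents.1 hb]

theorem volume_shellCover_inter_cell_le {i₀ : Fin n} {q : Fin n → ℤ} {l : ℕ}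
    (hq : (2 : ℤ) ^ l ≤ q i₀) (L : ℕ) (x : Cols n m) :
    volume (shellCover m i₀ q L ∩ cell l x) ≤
      (8 ^ m * shellVolume m L : ℝ≥0) * volume (cell l x) := by
  have hsub : shellCover m i₀ q L ∩ cell l x ⊆ ⋃ b ∈ exponents m L,
      Set.pi Set.univ fun j => {y | y ∈ colCube l (dyIdx l x j) ∧
        ∃ p : ℤ, |colDot q y - p| < 2⁻¹ ^ b j} := by
    rintro y ⟨hy, hyx⟩
    obtain ⟨b, hb, h⟩ := shellCover_near i₀ q L hy
    rw [cell_eq_setOf] at hyx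
    refine Set.mem_biUnion hb fun j _ => ⟨hyx j trivial, ?_⟩
    obtain ⟨p, -, hp⟩ := h j
    exact ⟨p, hp⟩
  calc _ ≤ ∑ b ∈ exponents m L, volume (Set.pi Set.univ fun j => {y | y ∈ colCube l (dyIdx l x j) ∧
        ∃ p : ℤ, |colDot q y - p| < 2⁻¹ ^ b j}) :=
        (measure_mono hsub).trans (measure_biUnion_finset_le _ _)
    _ ≤ ∑ b ∈ exponents m L, ENNReal.ofReal (((8 ^ m : ℝ≥0) : ℝ) * 2⁻¹ ^ L) * volume (cell l x) := by
        refine Finset.sum_le_sum fun b hb => ?_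
        have : ((8 ^ m : ℝ≥0) : ℝ) = (8 : ℝ) ^ m := by push_cast; rfl
        rw [volume_pi_pi, volume_cell_eq_prod, this, ← prod_ofReal_exponents hb (by norm_num),
          ← Finset.prod_mul_distrib]
        exact Finset.prod_le_prod' fun j _ => volume_colCube_near_int_le hq _ (by positivity)
          (pow_le_one₀ (by norm_num) (by norm_num))
    _ = _ := by rw [← Finset.sum_mul, sum_ofReal_exponents]

theorem volume_shellCover_inter_le {i₀ : Fin n} {q q' : Fin n → ℤ} (hq : 0 < q i₀) (hq' : 0 < q' i₀)
    (hne : q ≠ q') (L L' : ℕ) :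
    volume (shellCover m i₀ q L ∩ shellCover m i₀ q' L') ≤
      (32 ^ m * (shellVolume m L * shellVolume m L') : ℝ≥0) := by
  set S : (Fin m → ℕ) → (Fin m → ℕ) → Fin m → Set (Fin n → ℝ) := fun b b' j => {y | y ∈ colCube 0 0 ∧
    (∃ p : ℤ, Int.gcd p (q i₀) = 1 ∧ |colDot q y - p| < 2⁻¹ ^ b j) ∧
      ∃ p : ℤ, Int.gcd p (q' i₀) = 1 ∧ |colDot q' y - p| < 2⁻¹ ^ b' j} with hS
  have hsub : shellCover m i₀ q L ∩ shellCover m i₀ q' L' ⊆ ⋃ b ∈ exponents m L,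
      ⋃ b' ∈ exponents m L', Set.pi Set.univ (S b b') := by
    rintro y ⟨hy, hy'⟩
    have hyc := shellCover_subset i₀ q L hy
    obtain ⟨b, hb, h⟩ := shellCover_near i₀ q L hy
    obtain ⟨b', hb', h'⟩ := shellCover_near i₀ q' L' hy'
    rw [cell_eq_setOf] at hyc
    refine Set.mem_biUnion hb (Set.mem_biUnion hb' fun j _ => ⟨?_, h j, h' j⟩)
    have : y j ∈ colCube 0 (dyIdx 0 (0 : Cols n m) j) := hyc j trivial
    have h0 : dyIdx 0 (0 : Cols n m) j = 0 := by funext i; simp [dyIdx]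
    rwa [h0] at this
  have hvol : ∀ b ∈ exponents m L, ∀ b' ∈ exponents m L', volume (Set.pi Set.univ (S b b')) ≤
      ENNReal.ofReal (32 ^ m * (2⁻¹ ^ L * 2⁻¹ ^ L')) := by
    intro b hb b' hb'
    rw [volume_pi_pi]
    calc ∏ j, volume (S b b' j) ≤ ∏ j, ENNReal.ofReal (32 * (2⁻¹ ^ b j * 2⁻¹ ^ b' j)) :=
          Finset.prod_le_prod' fun j _ => volume_colCube_near_coprime_inter_le hq hq' hne
            (by positivity) (pow_le_one₀ (by norm_num) (by norm_num)) (by positivity)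
      _ = _ := by
          rw [← ENNReal.ofReal_prod_of_nonneg (fun _ _ => by positivity), Finset.prod_mul_distrib,
            Finset.prod_mul_distrib, Finset.prod_pow_eq_pow_sum, Finset.prod_pow_eq_pow_sum,
            mem_exponents.1 hb, mem_exponents.1 hb']
          simp
  calc _ ≤ ∑ b ∈ exponents m L, ∑ b' ∈ exponents m L', volume (Set.pi Set.univ (S b b')) :=
        (measure_mono hsub).trans ((measure_biUnion_finset_le _ _).trans
          (Finset.sum_le_sum fun b _ => measure_biUnion_finset_le _ _))
    _ ≤ ∑ b ∈ exponents m L, ∑ b' ∈ exponents m L',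
        ENNReal.ofReal (32 ^ m * (2⁻¹ ^ L * 2⁻¹ ^ L')) :=
        Finset.sum_le_sum fun b hb => Finset.sum_le_sum fun b' hb' => hvol b hb b' hb'
    _ = _ := by
        have : (32 : ℝ) ^ m * (2⁻¹ ^ L * 2⁻¹ ^ L') =
            ((32 ^ m * (2⁻¹ ^ L * 2⁻¹ ^ L') : ℝ≥0) : ℝ) := by push_cast; rfl
        rw [this, ENNReal.ofReal_coe_nnreal]
        simp only [Finset.sum_const, nsmul_eq_mul, shellVolume]
        push_cast
        ring

theorem measurableSet_coprimeShell (i₀ : Fin n) (q : Fin n → ℤ) (δ : ℝ) :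
    MeasurableSet (coprimeShell i₀ q δ) := by
  have : coprimeShell i₀ q δ = ⋃ p : ℤ, ⋃ (_ : Int.gcd p (q i₀) = 1),
      ({y | δ / 2 ≤ colDot q y - p} ∩ {y | colDot q y - p < δ}) := by
    ext y
    simp only [coprimeShell, Set.mem_iUnion, Set.mem_inter_iff, Set.mem_ofPred_eq, exists_prop]
  rw [this]
  have hm := measurable_colDot q
  exact MeasurableSet.iUnion fun p => MeasurableSet.iUnion fun _ =>
    (measurableSet_le measurable_const (by fun_prop)).inter
      (measurableSet_lt (by fun_prop) measurable_const)

theorem coprimeShell_disjoint {i₀ : Fin n} {q : Fin n → ℤ} {b b' : ℕ} (hbb : b ≠ b') :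
    Disjoint (coprimeShell i₀ q (2⁻¹ ^ (b + 1))) (coprimeShell i₀ q (2⁻¹ ^ (b' + 1))) := by
  wlog hlt : b < b' generalizing b b'
  · exact (this hbb.symm (by omega)).symm
  refine Set.disjoint_left.2 ?_
  rintro y ⟨p, -, h1, h2⟩ ⟨p', -, h1', h2'⟩
  have hpos : ∀ c : ℕ, (0 : ℝ) < 2⁻¹ ^ (c + 1) := fun c => by positivity
  have hle : ∀ c : ℕ, (2 : ℝ)⁻¹ ^ (c + 1) ≤ 1 := fun c =>
    pow_le_one₀ (by norm_num) (by norm_num)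
  have hp : p = p' := by
    have e1 : (p : ℝ) < p' + 1 := by linarith [hpos b, hle b']
    have e2 : (p' : ℝ) < p + 1 := by linarith [hpos b', hle b]
    have e3 : p < p' + 1 := by exact_mod_cast e1
    have e4 : p' < p + 1 := by exact_mod_cast e2
    omega
  subst hp
  have : (2 : ℝ)⁻¹ ^ (b' + 1) ≤ 2⁻¹ ^ (b + 1 + 1) :=
    pow_le_pow_of_le_one (by norm_num) (by norm_num) (by omega)
  rw [pow_succ _ (b + 1)] at this
  linarith

theorem le_volume_shellCover_inter_cell {i₀ : Fin n} {q : Fin n → ℤ} {a : ℕ} (hqa : q i₀ = a)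
    (ha : a ∈ sparsePrimeFactors) {l : ℕ} (hl : 16 * (Nat.log 2 a + 1) * (2 : ℝ) ^ l ≤ a) (L : ℕ)
    {x : Cols n m} (hx : x ∈ cell 0 0) :
    ((1 / 64) ^ m * shellVolume m L : ℝ≥0) * volume (cell l x) ≤
      volume (shellCover m i₀ q L ∩ cell l x) := by
  set S : (Fin m → ℕ) → Set (Cols n m) := fun b => Set.pi Set.univ fun j =>
    colCube l (dyIdx l x j) ∩ coprimeShell i₀ q (2⁻¹ ^ (b j + 1)) with hS
  have hsub : (⋃ b ∈ exponents m L, S b) ⊆ shellCover m i₀ q L ∩ cell l x := by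
    refine Set.iUnion₂_subset fun b hb y hy => ?_
    have hyc : y ∈ cell l x := by
      rw [cell_eq_setOf]
      exact fun j hj => (hy j hj).1
    exact ⟨shellCore_subset_shellCover i₀ q L ⟨cell_subset_cell (Nat.zero_le l) hx hyc, b, hb,
      fun j => (hy j trivial).2⟩, hyc⟩
  have hmeas : ∀ b, MeasurableSet (S b) := fun b => MeasurableSet.univ_pi fun j =>
    (measurableSet_colCube l _).inter (measurableSet_coprimeShell i₀ q _)
  have hdisj : Set.PairwiseDisjoint (exponents m L : Set (Fin m → ℕ)) S := by
    intro b _ b' _ hbb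
    obtain ⟨j, hj⟩ := Function.ne_iff.1 hbb
    exact Set.disjoint_left.2 fun y hy hy' =>
      Set.disjoint_left.1 (coprimeShell_disjoint hj) (hy j trivial).2 (hy' j trivial).2
  calc _ = ∑ b ∈ exponents m L, ENNReal.ofReal ((((1 / 64) ^ m : ℝ≥0) : ℝ) * 2⁻¹ ^ L) *
        volume (cell l x) := by rw [← Finset.sum_mul, sum_ofReal_exponents]
    _ ≤ ∑ b ∈ exponents m L, volume (S b) := by
        refine Finset.sum_le_sum fun b hb => ?_
        have : (((1 / 64) ^ m : ℝ≥0) : ℝ) = (1 / 64 : ℝ) ^ m := by push_cast; rfl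
        rw [hS, volume_pi_pi, volume_cell_eq_prod, this, ← prod_ofReal_exponents hb (by norm_num),
          ← Finset.prod_mul_distrib]
        refine Finset.prod_le_prod' fun j _ => ?_
        have h1 := le_volume_colCube_near_coprime hqa ha hl (dyIdx l x j) (δ := 2⁻¹ ^ (b j + 1))
          (by positivity) (pow_le_one₀ (by norm_num) (by norm_num))
        have h2 : (1 / 64 : ℝ) * 2⁻¹ ^ b j = 2⁻¹ ^ (b j + 1) / 32 := by rw [pow_succ]; ring
        rw [h2]
        refine h1.trans (le_of_eq ?_)
        rw [← hqa]
        rfl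
    _ = volume (⋃ b ∈ exponents m L, S b) :=
        (measure_biUnion_finset hdisj fun b _ => hmeas b).symm
    _ ≤ _ := measure_mono hsub

theorem exists_log_mul_le (l : ℕ) : ∃ N : ℕ, ∀ k, N ≤ k → 16 * ((k : ℝ) + 1) * 2 ^ l ≤ 2 ^ k := by
  have h := (tendsto_pow_const_div_const_pow_of_one_lt 1 (one_lt_two (α := ℝ))).eventually
    (eventually_le_nhds (show (0 : ℝ) < 1 / (32 * 2 ^ l) by positivity))
  obtain ⟨N, hN⟩ := Filter.eventually_atTop.1 h
  refine ⟨max N 1, fun k hk => ?_⟩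
  have h1 := hN k ((le_max_left _ _).trans hk)
  have h2 : (1 : ℝ) ≤ k := by exact_mod_cast (le_max_right _ _).trans hk
  rw [pow_one, div_le_div_iff₀ (by positivity) (by positivity)] at h1
  have h3 : (0 : ℝ) < 2 ^ l := by positivity
  nlinarith

/-- The heights of the family are the dyadic sizes of the coordinate `q i₀`. -/
theorem quasiIndepFamily_shellCover (i₀ : Fin n) {𝒬 : Set (Fin n → ℤ)}
    (h𝒬 : ∀ q ∈ 𝒬, 0 < q i₀ ∧ (q i₀).toNat ∈ sparsePrimeFactors) (L : (Fin n → ℤ) → ℕ) :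
    QuasiIndepFamily (fun q : 𝒬 => shellCover m i₀ (q : Fin n → ℤ) (L q))
      (fun q => Nat.log 2 ((q : Fin n → ℤ) i₀).toNat) (fun q => shellVolume m (L q))
      ((1 / 64) ^ m) (8 ^ m) (32 ^ m) where
  pos := by positivity
  isStep q := ⟨_, isStep_shellCover i₀ q (L q)⟩
  subset q := shellCover_subset i₀ q (L q)
  lower l := by
    obtain ⟨N, hN⟩ := exists_log_mul_le l
    refine ⟨N, fun q hq x hx => ?_⟩
    obtain ⟨h1, h2⟩ := h𝒬 q q.2
    refine le_volume_shellCover_inter_cell (a := ((q : Fin n → ℤ) i₀).toNat) (by omega) h2 ?_ _ hx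
    refine (hN _ hq).trans ?_
    exact_mod_cast Nat.pow_log_le_self 2 h2.1.ne'
  upper q l x hl := by
    obtain ⟨h1, h2⟩ := h𝒬 q q.2
    refine volume_shellCover_inter_cell_le ?_ _ x
    have h3 : 2 ^ l ≤ ((q : Fin n → ℤ) i₀).toNat :=
      (Nat.pow_le_pow_right two_pos hl).trans (Nat.pow_log_le_self 2 h2.1.ne')
    have h4 : ((2 ^ l : ℕ) : ℤ) ≤ (((q : Fin n → ℤ) i₀).toNat : ℤ) := by exact_mod_cast h3
    rw [Int.toNat_of_nonneg h1.le] at h4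
    exact_mod_cast h4
  inter q q' hne := volume_shellCover_inter_le (h𝒬 q q.2).1 (h𝒬 q' q'.2).1
    (fun h => hne (Subtype.ext h)) _ _

end Family

/-! ### Integers with few small prime factors have positive lower density -/

section Sparse

theorem sum_one_div_sq_le (X : ℕ) : ∑ ℓ ∈ Finset.Icc 2 X, (1 / (ℓ : ℝ) ^ 2) ≤ 3 / 4 := by
  have key : ∀ k : ℕ, ∑ ℓ ∈ Finset.Icc 2 (k + 2), (1 / (ℓ : ℝ) ^ 2) ≤
      3 / 4 - 1 / ((k : ℝ) + 2) := by
    intro k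
    induction k with
    | zero => norm_num
    | succ k ih =>
      rw [show k + 1 + 2 = (k + 2) + 1 by ring, Finset.sum_Icc_succ_top (by omega)]
      have h : (1 : ℝ) / ((k : ℝ) + 2 + 1) ^ 2 ≤ 1 / (k + 2) - 1 / (k + 2 + 1) := by
        rw [div_sub_div _ _ (by positivity) (by positivity), div_le_div_iff₀ (by positivity)
          (by positivity)]
        have : (0 : ℝ) ≤ k := by positivity
        nlinarith
      push_cast
      have e : (k : ℝ) + 1 + 2 = k + 2 + 1 := by ring
      rw [e]
      linarith
  rcases Nat.lt_or_ge X 2 with h | h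
  · rw [Finset.Icc_eq_empty (by omega)]; norm_num
  · obtain ⟨k, rfl⟩ := Nat.exists_eq_add_of_le' h
    refine (key k).trans ?_
    have : (0 : ℝ) ≤ 1 / ((k : ℝ) + 2) := by positivity
    linarith

/-- On average over `a`, the sum of the reciprocals of the prime factors is at most `∑ 1 / p ^ 2`. -/
theorem sum_sum_primeFactors_le (X : ℕ) :
    ∑ a ∈ Finset.Icc 1 X, ∑ ℓ ∈ a.primeFactors, (1 / ℓ : ℝ) ≤ 3 / 4 * X := by
  have hcard : ∀ ℓ ∈ Finset.Icc 2 X,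
      ∑ a ∈ Finset.Icc 1 X, (if ℓ ∣ a then (1 / ℓ : ℝ) else 0) ≤ X * (1 / (ℓ : ℝ) ^ 2) := by
    intro ℓ hℓ
    have hℓ0 : (0 : ℝ) < ℓ := by
      have := (Finset.mem_Icc.1 hℓ).1
      exact_mod_cast (by omega : 0 < ℓ)
    rw [← Finset.sum_filter, Finset.sum_const, nsmul_eq_mul]
    have h1 : ((Finset.Icc 1 X).filter fun a => ℓ ∣ a).card = X / ℓ := by
      rw [← Nat.Ioc_filter_dvd_card_eq_div]
      rfl
    rw [h1]
    calc ((X / ℓ : ℕ) : ℝ) * (1 / ℓ) ≤ X / ℓ * (1 / ℓ) := by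
          gcongr; exact Nat.cast_div_le
      _ = _ := by field_simp
  calc _ ≤ ∑ a ∈ Finset.Icc 1 X, ∑ ℓ ∈ Finset.Icc 2 X, (if ℓ ∣ a then (1 / ℓ : ℝ) else 0) := by
        refine Finset.sum_le_sum fun a ha => ?_
        rw [← Finset.sum_filter]
        refine Finset.sum_le_sum_of_subset_of_nonneg ?_ fun _ _ _ => by positivity
        intro ℓ hℓ
        have hp := Nat.prime_of_mem_primeFactors hℓ
        have hd := Nat.dvd_of_mem_primeFactors hℓ
        have ha' := Finset.mem_Icc.1 ha
        exact Finset.mem_filter.2 ⟨Finset.mem_Icc.2 ⟨hp.two_le,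
          (Nat.le_of_dvd (by omega) hd).trans ha'.2⟩, hd⟩
    _ = ∑ ℓ ∈ Finset.Icc 2 X, ∑ a ∈ Finset.Icc 1 X, (if ℓ ∣ a then (1 / ℓ : ℝ) else 0) :=
        Finset.sum_comm
    _ ≤ ∑ ℓ ∈ Finset.Icc 2 X, X * (1 / (ℓ : ℝ) ^ 2) := Finset.sum_le_sum hcard
    _ ≤ _ := by
        rw [← Finset.mul_sum, mul_comm]
        gcongr
        exact sum_one_div_sq_le X

open Classical in
theorem le_count_sparsePrimeFactors (X : ℕ) :
    (X : ℝ) / 7 ≤ Nat.count (· ∈ sparsePrimeFactors) (X + 1) := by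
  set good := (Finset.Icc 1 X).filter (· ∈ sparsePrimeFactors) with hgood
  set bad := (Finset.Icc 1 X).filter (¬ · ∈ sparsePrimeFactors) with hbad
  have h1 : (bad.card : ℝ) * (7 / 8) ≤ 3 / 4 * X := by
    refine le_trans ?_ (sum_sum_primeFactors_le X)
    calc (bad.card : ℝ) * (7 / 8) = ∑ _a ∈ bad, (7 / 8 : ℝ) := by
          rw [Finset.sum_const, nsmul_eq_mul]
      _ ≤ ∑ a ∈ bad, ∑ ℓ ∈ a.primeFactors, (1 / ℓ : ℝ) := by
          refine Finset.sum_le_sum fun a ha => ?_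
          have h2 := Finset.mem_filter.1 ha
          by_contra! h3
          exact h2.2 ⟨(Finset.mem_Icc.1 h2.1).1, h3.le⟩
      _ ≤ _ := Finset.sum_le_sum_of_subset_of_nonneg (Finset.filter_subset _ _)
          fun a _ _ => Finset.sum_nonneg fun ℓ _ => by positivity
  have h2 : good.card + bad.card = X := by
    rw [hgood, hbad, Finset.card_filter_add_card_filter_not]
    simp
  have h3 : good.card ≤ Nat.count (· ∈ sparsePrimeFactors) (X + 1) := by
    rw [Nat.count_eq_card_filter_range]
    refine Finset.card_le_card fun a ha => ?_
    have h4 := Finset.mem_filter.1 ha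
    have h5 := Finset.mem_Icc.1 h4.1
    exact Finset.mem_filter.2 ⟨Finset.mem_range.2 (by omega), h4.2⟩
  have h4 : (good.card : ℝ) + bad.card = X := by exact_mod_cast h2
  have h5 : (good.card : ℝ) ≤ Nat.count (· ∈ sparsePrimeFactors) (X + 1) := by exact_mod_cast h3
  linarith

theorem infinite_sparsePrimeFactors : sparsePrimeFactors.Infinite := by
  classical
  intro hfin
  set K := hfin.toFinset.card with hK
  have h1 := le_count_sparsePrimeFactors (7 * (K + 1))
  have h2 : Nat.count (· ∈ sparsePrimeFactors) (7 * (K + 1) + 1) ≤ K := by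
    rw [Nat.count_eq_card_filter_range]
    refine Finset.card_le_card fun a ha => ?_
    exact hfin.mem_toFinset.2 (Finset.mem_filter.1 ha).2
  have h3 : (Nat.count (· ∈ sparsePrimeFactors) (7 * (K + 1) + 1) : ℝ) ≤ K := by exact_mod_cast h2
  push_cast at h1 h3
  linarith

/-- An element of `sparsePrimeFactors` below `a` and of comparable size; each value is taken at
most eight times. -/
noncomputable def sparseBelow (a : ℕ) : ℕ := Nat.nth (· ∈ sparsePrimeFactors) (a / 8)

theorem sparseBelow_mem (a : ℕ) : sparseBelow a ∈ sparsePrimeFactors :=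
  Nat.nth_mem_of_infinite infinite_sparsePrimeFactors _

theorem sparseBelow_le {a : ℕ} (ha : 0 < a) : sparseBelow a ≤ a := by
  classical
  refine Nat.lt_succ_iff.1 (Nat.nth_lt_of_lt_count ?_)
  have h1 := le_count_sparsePrimeFactors a
  have h2 : ((a / 8 : ℕ) : ℝ) ≤ a / 8 := Nat.cast_div_le
  have h3 : (0 : ℝ) < a := by exact_mod_cast ha
  have h4 : ((a / 8 : ℕ) : ℝ) < Nat.count (· ∈ sparsePrimeFactors) (a + 1) := by linarith
  exact_mod_cast h4

theorem le_sparseBelow (a : ℕ) : a ≤ 15 * sparseBelow a := by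
  have h1 : a / 8 ≤ sparseBelow a := (Nat.nth_strictMono infinite_sparsePrimeFactors).le_apply
  have h2 := (sparseBelow_mem a).1
  omega

theorem sparseBelow_inj {a b : ℕ} (h : sparseBelow a = sparseBelow b) (hmod : a % 8 = b % 8) :
    a = b := by
  have := Nat.nth_injective infinite_sparsePrimeFactors h
  omega

end Sparse

/-! ### Growth of the gauge function and of the volumes -/

section Growth

variable {f : ℝ → ℝ} {d : ℕ}

/-- The growth condition in terms of the gauge density. -/
theorem IsAdmissible.exists_gaugeDensity_le_mul (hf : IsAdmissible d f) {t : ℝ} (ht0 : 0 < t)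
    (ht1 : t < 1) : ∃ r₀ : ℝ, 0 < r₀ ∧ ∃ C : ℝ, 0 < C ∧ ∀ r α : ℝ, 0 < r → 1 < α → α < r ^ (-t) →
      α * r < r₀ → gaugeDensity d f r ≤ C * gaugeDensity d f (α * r) := by
  obtain ⟨r₀, hr₀, C, hC, h⟩ := hf.growth t ht0 ht1
  refine ⟨r₀, hr₀, C, hC, fun r α hr hα hαt hαr => ?_⟩
  have h1 := (h r α hr hα hαt hαr).1
  have hα0 : 0 < α := by linarith
  have hfr : 0 < f r := by
    have := hf.gaugeDensity_pos hr
    rw [gaugeDensity] at this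
    exact (div_pos_iff_of_pos_right (by positivity)).1 this
  rw [gaugeDensity, gaugeDensity, mul_pow]
  rw [le_div_iff₀ hfr, inv_mul_eq_div, div_mul_eq_mul_div, div_le_iff₀ hC] at h1
  rw [mul_div_assoc', div_le_div_iff₀ (by positivity) (by positivity)]
  calc f r * (α ^ d * r ^ d) = α ^ d * f r * r ^ d := by ring
    _ ≤ f (α * r) * C * r ^ d := by gcongr
    _ = _ := by ring

/-- The gauge density grows more slowly than `r ^ (-1/4)`. -/
theorem IsAdmissible.exists_gaugeDensity_le_rpow (hf : IsAdmissible d f) :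
    ∃ r₀ : ℝ, 0 < r₀ ∧ ∃ C : ℝ, 0 < C ∧ ∀ r : ℝ, 0 < r → r < r₀ →
      gaugeDensity d f r ≤ C * r ^ (-(1 / 4) : ℝ) := by
  obtain ⟨r₀, hr₀, C, hC, h⟩ := hf.exists_gaugeDensity_le_mul (t := 7 / 8) (by norm_num) (by norm_num)
  have hg1 := hf.gaugeDensity_pos one_pos
  refine ⟨min 1 (r₀ ^ 4), by positivity, C * gaugeDensity d f 1, by positivity, fun r hr hr' => ?_⟩
  have hr1 : r < 1 := hr'.trans_le (min_le_left _ _)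
  have hr4 : r < r₀ ^ 4 := hr'.trans_le (min_le_right _ _)
  have he : r ^ (-(3 / 4) : ℝ) * r = r ^ (1 / 4 : ℝ) := by
    rw [← Real.rpow_add_one hr.ne']; norm_num
  have hlt : r ^ (1 / 4 : ℝ) < r₀ := by
    have := Real.rpow_lt_rpow hr.le hr4 (show (0 : ℝ) < 1 / 4 by norm_num)
    rwa [← Real.rpow_natCast r₀ 4, ← Real.rpow_mul hr₀.le, show ((4 : ℕ) : ℝ) * (1 / 4) = 1 by norm_num,
      Real.rpow_one] at this
  -- the growth condition compares the scales `r` and `r ^ (1 / 4)`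
  have h1 := h r (r ^ (-(3 / 4) : ℝ)) hr (Real.one_lt_rpow_of_pos_of_lt_one_of_neg hr hr1 (by norm_num))
    (Real.rpow_lt_rpow_of_exponent_gt hr hr1 (by norm_num)) (by rw [he]; exact hlt)
  rw [he] at h1
  have hx0 : 0 < r ^ (1 / 4 : ℝ) := by positivity
  have h2 := hf.gaugeDensity_mul_mono hx0 (Real.rpow_le_one hr.le hr1.le (by norm_num))
  rw [mul_one] at h2
  have h3 : gaugeDensity d f (r ^ (1 / 4 : ℝ)) ≤ gaugeDensity d f 1 * r ^ (-(1 / 4) : ℝ) := by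
    rw [Real.rpow_neg hr.le, ← div_eq_mul_inv, le_div_iff₀ hx0]
    exact h2
  calc gaugeDensity d f r ≤ C * gaugeDensity d f (r ^ (1 / 4 : ℝ)) := h1
    _ ≤ C * (gaugeDensity d f 1 * r ^ (-(1 / 4) : ℝ)) := by gcongr
    _ = _ := by ring

/-- Polynomially related scales have comparable gauge densities. -/
theorem IsAdmissible.exists_gaugeDensity_pow_le (hf : IsAdmissible d f) {K : ℕ} (hK : 0 < K) :
    ∃ R : ℝ, 0 < R ∧ ∃ C : ℝ, 0 < C ∧ ∀ a : ℝ, R ≤ a →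
      gaugeDensity d f ((a ^ (K + 1))⁻¹) ≤ C * gaugeDensity d f a⁻¹ := by
  have hK' : (0 : ℝ) < K := by exact_mod_cast hK
  -- for `r = a ^ (-(K + 1))` the ratio `a ^ K` of the two scales is `r ^ (-K / (K + 1))`
  set t : ℝ := (K + 1 / 2) / (K + 1) with ht
  obtain ⟨r₀, hr₀, C, hC, h⟩ := hf.exists_gaugeDensity_le_mul (t := t) (by positivity)
    (by rw [ht, div_lt_one (by positivity)]; linarith)
  refine ⟨max 2 (2 / r₀), by positivity, C, hC, fun a ha => ?_⟩
  have ha2 : 2 ≤ a := (le_max_left _ _).trans ha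
  have ha0 : 0 < a := by linarith
  have har : 2 / r₀ ≤ a := (le_max_right _ _).trans ha
  have he : a ^ K * (a ^ (K + 1))⁻¹ = a⁻¹ := by
    rw [pow_succ]; field_simp
  have h1 := h ((a ^ (K + 1))⁻¹) (a ^ K) (by positivity) (one_lt_pow₀ (by linarith) hK.ne') ?_ ?_
  · rwa [he] at h1
  · rw [Real.inv_rpow (by positivity), ← Real.rpow_neg (by positivity), neg_neg, ← Real.rpow_natCast,
      ← Real.rpow_natCast, ← Real.rpow_mul ha0.le]
    refine Real.rpow_lt_rpow_of_exponent_lt (by linarith) ?_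
    rw [ht]; push_cast
    rw [mul_div_cancel₀ _ (by positivity)]
    linarith
  · rw [he, inv_lt_comm₀ ha0 hr₀]
    rw [div_le_iff₀ hr₀] at har
    rw [inv_lt_iff_one_lt_mul₀ hr₀]
    linarith

/-- The number of exponent vectors is at least of the order `L ^ (m - 1)`. -/
theorem le_card_exponents {m : ℕ} (hm : 0 < m) (L : ℕ) :
    (L : ℝ) ^ (m - 1) ≤ m ^ (m - 1) * (exponents m L).card := by
  obtain ⟨k, rfl⟩ : ∃ k, m = k + 1 := ⟨m - 1, by omega⟩
  rw [Nat.add_sub_cancel]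
  set s := L / (k + 1) with hs
  have hcard : (s + 1) ^ k ≤ (exponents (k + 1) L).card := by
    let φ : (Fin k → Fin (s + 1)) → Fin (k + 1) → ℕ := fun b =>
      Fin.cons (L - ∑ j, (b j : ℕ)) fun j => (b j : ℕ)
    have hφ : Function.Injective φ := by
      intro b b' h
      funext j
      have := congrFun h j.succ
      simp only [φ, Fin.cons_succ] at this
      exact Fin.ext this
    have hle : ∀ b : Fin k → Fin (s + 1), ∑ j, (b j : ℕ) ≤ L := by
      intro b
      calc ∑ j, (b j : ℕ) ≤ ∑ _j : Fin k, s := Finset.sum_le_sum fun j _ => Nat.lt_succ_iff.1 (b j).2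
        _ = k * s := by simp
        _ ≤ (k + 1) * s := by gcongr; omega
        _ ≤ L := Nat.mul_div_le L (k + 1)
    calc (s + 1) ^ k = (Finset.univ.image φ).card := by
          rw [Finset.card_image_of_injective _ hφ]; simp
      _ ≤ _ := by
          refine Finset.card_le_card fun x hx => ?_
          obtain ⟨b, -, rfl⟩ := Finset.mem_image.1 hx
          rw [mem_exponents, Fin.sum_univ_succ]
          simp only [φ, Fin.cons_zero, Fin.cons_succ]
          have := hle b
          omega
  have h1 : L ≤ (k + 1) * (s + 1) := by
    have := Nat.lt_mul_div_succ L (Nat.succ_pos k)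
    exact this.le
  calc (L : ℝ) ^ k ≤ (((k + 1) * (s + 1) : ℕ) : ℝ) ^ k := by gcongr
    _ = (k + 1 : ℕ) ^ k * (((s + 1) ^ k : ℕ) : ℝ) := by push_cast; rw [mul_pow]
    _ ≤ _ := by gcongr

theorem card_exponents_le {m : ℕ} (hm : 0 < m) (L : ℕ) :
    (exponents m L).card ≤ (L + 1) ^ (m - 1) := by
  obtain ⟨k, rfl⟩ : ∃ k, m = k + 1 := ⟨m - 1, by omega⟩
  rw [Nat.add_sub_cancel]
  let φ : (Fin (k + 1) → ℕ) → Fin k → ℕ := fun b j => b j.succ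
  calc (exponents (k + 1) L).card ≤ (Fintype.piFinset fun _ : Fin k => Finset.range (L + 1)).card := by
        refine Finset.card_le_card_of_injOn φ ?_ ?_
        · intro b hb
          rw [Finset.mem_coe, Fintype.mem_piFinset]
          exact fun j => Finset.mem_range.2 (Nat.lt_succ_iff.2 (le_of_mem_exponents hb _))
        · intro b hb b' hb' h
          have h1 := mem_exponents.1 (Finset.mem_coe.1 hb)
          have h2 := mem_exponents.1 (Finset.mem_coe.1 hb')
          rw [Fin.sum_univ_succ] at h1 h2
          have h3 : ∀ j : Fin k, b j.succ = b' j.succ := fun j => congrFun h j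
          simp only [h3] at h1
          funext j
          refine Fin.cases ?_ h3 j
          omega
    _ = _ := by simp

/-- The dyadic order of magnitude of a number `ψ` in `(0, 1)`. -/
noncomputable def depth (ψ : ℝ) : ℕ :=
  if h : 0 < ψ ∧ ψ < 1 then (exists_nat_pow_near_of_lt_one h.1 h.2.le
    (show (0 : ℝ) < 2⁻¹ by norm_num) (show (2 : ℝ)⁻¹ < 1 by norm_num)).choose + 1 else 0

theorem depth_spec {ψ : ℝ} (h0 : 0 < ψ) (h1 : ψ < 1) :
    (2 : ℝ)⁻¹ ^ depth ψ < ψ ∧ ψ ≤ 2 * 2⁻¹ ^ depth ψ := by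
  have := (exists_nat_pow_near_of_lt_one h0 h1.le
    (show (0 : ℝ) < 2⁻¹ by norm_num) (show (2 : ℝ)⁻¹ < 1 by norm_num)).choose_spec
  rw [depth, dif_pos ⟨h0, h1⟩]
  refine ⟨this.1, this.2.trans (le_of_eq ?_)⟩
  rw [pow_succ]; ring

/-- The factor `ψ log ^ (m - 1) (1 / ψ)` of the series is the order of magnitude of a volume. -/
theorem mul_log_pow_le_shellVolume {m : ℕ} (hm : 0 < m) {ψ : ℝ} (h0 : 0 < ψ) (h1 : ψ < 1) :
    ψ * Real.log ψ⁻¹ ^ (m - 1) ≤ 2 * m ^ (m - 1) * shellVolume m (depth ψ) := by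
  obtain ⟨h2, h3⟩ := depth_spec h0 h1
  set L := depth ψ
  have h4 : Real.log ψ⁻¹ ≤ L := by
    have h5 : ψ⁻¹ ≤ 2 ^ L := by
      rw [inv_pow] at h2
      exact (inv_le_comm₀ h0 (by positivity)).2 h2.le
    calc Real.log ψ⁻¹ ≤ Real.log (2 ^ L) := Real.log_le_log (by positivity) h5
      _ = L * Real.log 2 := Real.log_pow _ _
      _ ≤ L * 1 := by
          gcongr
          linarith [Real.log_two_lt_d9]
      _ = L := mul_one _
  have h6 : 0 ≤ Real.log ψ⁻¹ := Real.log_nonneg ((one_le_inv₀ h0).2 h1.le)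
  calc ψ * Real.log ψ⁻¹ ^ (m - 1) ≤ 2 * 2⁻¹ ^ L * (L : ℝ) ^ (m - 1) := by gcongr
    _ ≤ 2 * 2⁻¹ ^ L * (m ^ (m - 1) * (exponents m L).card) := by
        gcongr
        exact le_card_exponents hm L
    _ = _ := by
        rw [shellVolume]; push_cast; ring

/-- Away from `1`, the function `ψ log ^ k (1 / ψ)` is increasing up to a constant. -/
theorem exists_mul_log_pow_le (k : ℕ) {c : ℝ} (hc0 : 0 < c) (hc : c < 1) : ∃ C : ℝ, 0 < C ∧
    ∀ ψ ψ' : ℝ, 0 < ψ → ψ ≤ ψ' → ψ' ≤ c → ψ * Real.log ψ⁻¹ ^ k ≤ C * (ψ' * Real.log ψ'⁻¹ ^ k) := by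
  set c₀ := Real.log c⁻¹ with hc₀
  have hc₀0 : 0 < c₀ := Real.log_pos ((one_lt_inv₀ hc0).2 hc)
  set b : ℝ := max (k : ℝ) c₀⁻¹ + 1 with hb
  have hbk : (k : ℝ) ≤ b := by rw [hb]; linarith [le_max_left (k : ℝ) c₀⁻¹]
  have hbc : c₀⁻¹ ≤ b := by rw [hb]; linarith [le_max_right (k : ℝ) c₀⁻¹]
  have hb0 : 0 < b := by positivity
  refine ⟨(b * (k + 1)) ^ k, by positivity, fun ψ ψ' h0 h1 h2 => ?_⟩
  have h0' : 0 < ψ' := h0.trans_le h1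
  set x := Real.log (ψ' / ψ) with hx
  have hx0 : 0 ≤ x := Real.log_nonneg ((one_le_div h0).2 h1)
  set l := Real.log ψ'⁻¹ with hl
  have hcl : c₀ ≤ l := Real.log_le_log (by positivity) (inv_anti₀ h0' h2)
  have hl0 : 0 < l := hc₀0.trans_le hcl
  have hlog : Real.log ψ⁻¹ = l + x := by
    rw [hl, hx, ← Real.log_mul (by positivity) (by positivity)]
    congr 1
    field_simp
  have hψ : ψ = ψ' * Real.exp (-x) := by
    rw [Real.exp_neg, hx, Real.exp_log (by positivity)]
    field_simp
  -- the exponential decay of `ψ` beats the growth of the power of the logarithm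
  have h3 : l + x ≤ b * (k + 1) * (l * (Real.exp (x / (k + 1)))) := by
    have h4 : x / (k + 1) + 1 ≤ Real.exp (x / (k + 1)) := Real.add_one_le_exp _
    have h5 : 1 ≤ b * l := by
      calc 1 = c₀⁻¹ * c₀ := (inv_mul_cancel₀ hc₀0.ne').symm
        _ ≤ b * l := by gcongr
    have hb1 : 1 ≤ b := by
      have : 0 ≤ max (k : ℝ) c₀⁻¹ := le_trans (by positivity) (le_max_left _ _)
      linarith
    calc l + x ≤ l * (b * (k + 1)) + x * (b * l) := by
          refine add_le_add ?_ (le_mul_of_one_le_right hx0 h5)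
          refine le_mul_of_one_le_right hl0.le ?_
          have : (0 : ℝ) ≤ k := by positivity
          nlinarith
      _ = b * (k + 1) * (l * (x / (k + 1) + 1)) := by field_simp; ring
      _ ≤ _ := by gcongr
  calc ψ * Real.log ψ⁻¹ ^ k ≤ ψ * (b * (k + 1) * (l * (Real.exp (x / (k + 1))))) ^ k := by
        rw [hlog]; gcongr
    _ = (b * (k + 1)) ^ k * (ψ' * l ^ k) * (Real.exp (-x) * Real.exp (x / (k + 1)) ^ k) := by
        nth_rewrite 1 [hψ]
        rw [mul_pow, mul_pow]; ring
    _ ≤ (b * (k + 1)) ^ k * (ψ' * l ^ k) * 1 := by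
        gcongr
        rw [← Real.exp_nat_mul, ← Real.exp_add, Real.exp_le_one_iff]
        have : (k : ℝ) * (x / (k + 1)) ≤ x := by
          rw [mul_div_assoc', div_le_iff₀ (by positivity)]
          nlinarith
        linarith
    _ = _ := mul_one _

theorem exists_log_pow_le_rpow (k : ℕ) : ∃ C : ℝ, 0 < C ∧ ∀ ψ : ℝ, 0 < ψ → ψ < 1 →
    Real.log ψ⁻¹ ^ k ≤ C * ψ ^ (-(1 / 4) : ℝ) := by
  refine ⟨(4 * (k + 1)) ^ k, by positivity, fun ψ h0 h1 => ?_⟩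
  have hk : (0 : ℝ) < 1 / (4 * (k + 1)) := by positivity
  have hinv : 1 ≤ ψ⁻¹ := (one_le_inv₀ h0).2 h1.le
  have h2 := Real.log_le_rpow_div (x := ψ⁻¹) (by positivity) hk
  calc Real.log ψ⁻¹ ^ k ≤ (ψ⁻¹ ^ (1 / (4 * ((k : ℝ) + 1))) / (1 / (4 * (k + 1)))) ^ k := by
        have := Real.log_nonneg hinv
        gcongr
    _ = (4 * (k + 1)) ^ k * (ψ⁻¹ ^ (1 / (4 * ((k : ℝ) + 1)) * k)) := by
        rw [div_div_eq_mul_div, div_one, mul_pow, ← Real.rpow_mul_natCast (by positivity)]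
        ring
    _ ≤ (4 * (k + 1)) ^ k * ψ⁻¹ ^ (1 / 4 : ℝ) := by
        gcongr
        rw [div_mul_eq_mul_div, one_mul, div_le_div_iff₀ (by positivity) (by norm_num)]
        linarith
    _ = _ := by rw [Real.inv_rpow h0.le, Real.rpow_neg h0.le]

end Growth

/-! ### The series over the dominant coordinate -/

section Series

variable {n m : ℕ} {f : ℝ → ℝ} {ψ : (Fin n → ℤ) → ℝ}

theorem summable_prod_int_inv_sq (n : ℕ) :
    Summable fun q : Fin n → ℤ => ∏ i, ((1 + |(q i : ℝ)|) ^ 2)⁻¹ := by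
  have h1 : Summable fun a : ℤ => ((1 + |(a : ℝ)|) ^ 2)⁻¹ := by
    have h0 : Summable fun k : ℕ => ((1 + (k : ℝ)) ^ 2)⁻¹ := by
      have := (summable_nat_add_iff 1).2 (Real.summable_nat_pow_inv.2 one_lt_two)
      refine this.congr fun k => ?_
      push_cast; rw [add_comm]
    refine Summable.of_nat_of_neg ?_ ?_ <;> simpa using h0
  induction n with
  | zero => exact Summable.of_finite
  | succ n ih =>
    have := h1.mul_of_nonneg ih (fun _ => by positivity) fun _ => Finset.prod_nonneg fun _ _ => by
      positivity
    rw [← (Fin.consEquiv fun _ => ℤ).summable_iff]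
    refine this.congr fun p => ?_
    simp [Fin.prod_univ_succ, Fin.consEquiv, mul_comm]

/-- The integer vectors whose coordinate `i₀` is positive and dominates the others. -/
def dominantCone (i₀ : Fin n) : Set (Fin n → ℤ) := {q | 0 < q i₀ ∧ ∀ i, |q i| ≤ q i₀}

theorem norm_eq_of_mem_dominantCone {i₀ : Fin n} {q : Fin n → ℤ} (hq : q ∈ dominantCone i₀) :
    ‖q‖ = ((q i₀).toNat : ℝ) := by
  have h0 : (((q i₀).toNat : ℤ) : ℝ) = q i₀ := by rw [Int.toNat_of_nonneg hq.1.le]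
  have h1 : ((q i₀).toNat : ℝ) = q i₀ := by exact_mod_cast h0
  rw [h1]
  refine le_antisymm ((pi_norm_le_iff_of_nonneg (by exact_mod_cast hq.1.le)).2 fun i => ?_) ?_
  · rw [Int.norm_eq_abs]; exact_mod_cast hq.2 i
  · refine le_trans ?_ (norm_le_pi_norm q i₀)
    rw [Int.norm_eq_abs]; exact le_abs_self _

theorem exists_mem_dominantCone {q : Fin n → ℤ} (hq : q ≠ 0) :
    ∃ i₀, q ∈ dominantCone i₀ ∨ -q ∈ dominantCone i₀ := by
  obtain ⟨j, hj⟩ := Function.ne_iff.1 hq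
  obtain ⟨i₀, -, h⟩ := Finset.exists_max_image Finset.univ (fun i => |q i|) ⟨j, Finset.mem_univ _⟩
  have h1 : 0 < |q i₀| := (abs_pos.2 hj).trans_le (h j (Finset.mem_univ _))
  refine ⟨i₀, ?_⟩
  rcases lt_or_gt_of_ne (abs_pos.1 h1) with h2 | h2
  · right
    rw [abs_of_neg h2] at h
    exact ⟨by simpa using h2, fun i => by simpa using h i (Finset.mem_univ _)⟩
  · left
    rw [abs_of_pos h2] at h
    exact ⟨h2, fun i => h i (Finset.mem_univ _)⟩

theorem seriesTerm_eq (f : ℝ → ℝ) {q : Fin n → ℤ} (hψ : 0 < ψ q) (hq : q ≠ 0) :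
    seriesTerm n m f ψ q =
      gaugeDensity (n * m) f (ψ q / ‖q‖) * (ψ q * Real.log (ψ q)⁻¹ ^ (m - 1)) := by
  have hq0 : 0 < ‖q‖ := norm_pos_iff.2 hq
  have h1 : (ψ q / ‖q‖) ^ (1 - (n : ℤ) * (m : ℤ)) = ψ q / ‖q‖ / (ψ q / ‖q‖) ^ (n * m) := by
    rw [zpow_sub₀ (by positivity), zpow_one, ← Nat.cast_mul, zpow_natCast]
  rw [seriesTerm, h1, gaugeDensity]
  field_simp

theorem finite_norm_le (R : ℝ) : {q : Fin n → ℤ | ‖q‖ ≤ R}.Finite := by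
  have := (isCompact_closedBall (0 : Fin n → ℤ) R).finite_of_discrete
  simpa [Metric.closedBall] using this

/-- A non-increasing function that is below `1` off a finite set is bounded away from `1` there. -/
theorem NonIncreasing.exists_le_const (hmono : NonIncreasing ψ) (hn : 0 < n) (hψ : ∀ q, 0 < ψ q)
    (hfin : {q | 1 ≤ ψ q}.Finite) :
    ∃ c : ℝ, 0 < c ∧ c < 1 ∧ ∃ R : ℝ, 0 < R ∧ ∀ q, R ≤ ‖q‖ → ψ q ≤ c := by
  obtain ⟨B, hB⟩ := (hfin.image fun q => ‖q‖).bddAbove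
  set N : ℕ := ⌈B⌉₊ + 1 with hN
  have hBN : B < N := by
    have := Nat.le_ceil B
    push_cast [hN]; linarith
  -- every vector of norm at least `N` dominates one of the `2 n` vectors `± N eₗ`
  let pt : Fin n × Bool → Fin n → ℤ := fun p => Pi.single p.1 (if p.2 then (N : ℤ) else -N)
  have hpt : ∀ p, ψ (pt p) < 1 := by
    intro p
    by_contra! h
    have h1 : ‖pt p‖ ≤ B := hB ⟨_, h, rfl⟩
    have h2 : ‖pt p p.1‖ ≤ ‖pt p‖ := norm_le_pi_norm _ _
    have h3 : ‖pt p p.1‖ = N := by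
      simp only [pt, Pi.single_eq_same]
      split_ifs <;> simp
    linarith
  have hne : (Finset.univ : Finset (Fin n × Bool)).Nonempty := ⟨(⟨0, hn⟩, true), Finset.mem_univ _⟩
  refine ⟨Finset.univ.sup' hne fun p => ψ (pt p), ?_, ?_, N, by positivity, fun q hq => ?_⟩
  · exact (hψ _).trans_le (Finset.le_sup' (fun p => ψ (pt p)) (Finset.mem_univ (⟨0, hn⟩, true)))
  · exact (Finset.sup'_lt_iff hne).2 fun p _ => hpt p
  · obtain ⟨l, hl⟩ : ∃ l, (N : ℤ) ≤ |q l| := by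
      by_contra! h
      have h1 : ‖q‖ ≤ (N : ℝ) - 1 := by
        refine (pi_norm_le_iff_of_nonneg (by push_cast [hN]; linarith [Nat.cast_nonneg (α := ℝ) ⌈B⌉₊])).2
          fun l => ?_
        rw [Int.norm_eq_abs]
        have : |q l| ≤ (N : ℤ) - 1 := by have := h l; omega
        exact_mod_cast this
      linarith
    have key : ∀ s : Bool, (pt (l, s) l) ∈ Set.uIcc 0 (q l) → ψ q ≤ ψ (pt (l, s)) := by
      intro s hs
      refine hmono _ _ fun i => ?_
      by_cases hi : i = l
      · subst hi; exact hs
      · simp [pt, hi]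
    rcases le_total 0 (q l) with h | h
    · refine (key true ?_).trans (Finset.le_sup' (fun p => ψ (pt p)) (Finset.mem_univ (l, true)))
      rw [abs_of_nonneg h] at hl
      simp only [pt, Pi.single_eq_same, if_true, Set.uIcc_of_le h]
      exact ⟨by positivity, hl⟩
    · refine (key false ?_).trans (Finset.le_sup' (fun p => ψ (pt p)) (Finset.mem_univ (l, false)))
      rw [abs_of_nonpos h] at hl
      simp only [pt, Pi.single_eq_same, Set.uIcc_of_ge h]
      constructor
      · simp; omega
      · simp

/-- The vectors whose coordinate `i₀` has few small prime factors and is comparable to the norm. -/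
def sparseVectors (ψ : (Fin n → ℤ) → ℝ) (i₀ : Fin n) : Set (Fin n → ℤ) :=
  {q | 0 < q i₀ ∧ (q i₀).toNat ∈ sparsePrimeFactors ∧ ‖q‖ ≤ 16 * (q i₀).toNat ∧ ψ q < 1}

/-- The expected contribution of the vector `q` to the Hausdorff measure. -/
noncomputable def vectorWeight (m : ℕ) (f : ℝ → ℝ) (ψ : (Fin n → ℤ) → ℝ) (i₀ : Fin n)
    (q : Fin n → ℤ) : ℝ≥0 :=
  dyadicDensity (n * m) f (Nat.log 2 (q i₀).toNat) * shellVolume m (depth (ψ q))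

/-- Divergence of the thinned series makes the limsup set have infinite measure. -/
theorem hausdorffFMeasure_multSet_eq_top (hf : IsAdmissible (n * m) f) (hψ : ∀ q, 0 < ψ q)
    (i₀ : Fin n) (h : ¬ Summable fun q : sparseVectors ψ i₀ => vectorWeight m f ψ i₀ q) :
    hausdorffFMeasure f (multSet n m ψ) = ⊤ := by
  classical
  refine (quasiIndepFamily_shellCover (m := m) i₀ (𝒬 := sparseVectors ψ i₀)
    (fun q hq => ⟨hq.1, hq.2.1⟩) fun q => depth (ψ q)).hausdorffFMeasure_eq_top hf ?_
    (V := fun q => closedMult m (q : Fin n → ℤ) (depth (ψ q)))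
    (fun q => isClosed_closedMult _ _) (fun q => shellCover_subset_closedMult _ _ _) ?_
  · intro N T
    have hfin : {q : sparseVectors ψ i₀ | Nat.log 2 ((q : Fin n → ℤ) i₀).toNat < N}.Finite := by
      refine Set.Finite.of_finite_image ((finite_norm_le (n := n) (16 * 2 ^ N)).subset ?_)
        Subtype.val_injective.injOn
      rintro _ ⟨q, hq, rfl⟩
      refine q.2.2.2.1.trans ?_
      have h1 : ((q : Fin n → ℤ) i₀).toNat < 2 ^ N := Nat.lt_pow_of_log_lt one_lt_two hq
      have h2 : (((q : Fin n → ℤ) i₀).toNat : ℝ) ≤ 2 ^ N := by exact_mod_cast h1.le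
      linarith
    by_contra! hcon
    refine h (NNReal.summable_coe.1 (summable_of_sum_le
      (c := ∑ q ∈ hfin.toFinset, (vectorWeight m f ψ i₀ q : ℝ) + T) (fun _ => NNReal.coe_nonneg _)
      fun s => ?_))
    rw [← Finset.sum_filter_add_sum_filter_not s
      fun q => Nat.log 2 ((q : Fin n → ℤ) i₀).toNat < N]
    refine add_le_add (Finset.sum_le_sum_of_subset_of_nonneg ?_ fun _ _ _ => NNReal.coe_nonneg _) ?_
    · intro q hq
      exact hfin.mem_toFinset.2 (Finset.mem_filter.1 hq).2
    · have := (hcon (s.filter fun q => ¬ Nat.log 2 ((q : Fin n → ℤ) i₀).toNat < N)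
        fun q hq => not_lt.1 (Finset.mem_filter.1 hq).2).le
      exact_mod_cast this
  · intro x hx hN
    refine ⟨hx, Set.Infinite.of_image (fun q => Nat.log 2 (q i₀).toNat)
      (Set.infinite_of_forall_exists_gt fun N => ?_)⟩
    obtain ⟨q, hq, hq'⟩ := hN (N + 1)
    refine ⟨_, ⟨q, ?_, rfl⟩, hq⟩
    exact lt_of_le_of_lt hq' (depth_spec (hψ q) q.2.2.2.2).1

end Series

/-! ### Thinning out the series -/

section Thinning

variable {n m : ℕ} {f : ℝ → ℝ} {ψ : (Fin n → ℤ) → ℝ}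

/-- The terms with very small `ψ q` are dominated by a convergent series. -/
theorem IsAdmissible.exists_seriesTerm_le_prod (hf : IsAdmissible (n * m) f) :
    ∃ R : ℝ, 0 < R ∧ ∃ C : ℝ, 0 < C ∧ ∀ (ψ : (Fin n → ℤ) → ℝ) (q : Fin n → ℤ), R ≤ ‖q‖ → 0 < ψ q →
      ψ q < (‖q‖ ^ (4 * n + 1))⁻¹ → seriesTerm n m f ψ q ≤ C * ∏ i, ((1 + |(q i : ℝ)|) ^ 2)⁻¹ := by
  obtain ⟨r₀, hr₀, C₁, hC₁, h1⟩ := hf.exists_gaugeDensity_le_rpow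
  obtain ⟨C₂, hC₂, h2⟩ := exists_log_pow_le_rpow (m - 1)
  refine ⟨max 1 (2 / r₀), by positivity, C₁ * C₂ * 4 ^ n, by positivity, fun ψ q hq hψ hsmall => ?_⟩
  set A := ‖q‖ with hA
  have hA1 : 1 ≤ A := (le_max_left _ _).trans hq
  have hA0 : 0 < A := by linarith
  have hAr : 2 / r₀ ≤ A := (le_max_right _ _).trans hq
  have hψ1 : ψ q < 1 := hsmall.trans_le (inv_le_one_of_one_le₀ (one_le_pow₀ hA1))
  rw [seriesTerm_eq f hψ (norm_pos_iff.1 hA0), ← hA]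
  have h3 : ψ q / A < r₀ := by
    rw [div_le_iff₀ hr₀] at hAr
    rw [div_lt_iff₀ hA0]
    linarith
  have h4 := h1 (ψ q / A) (by positivity) h3
  have h5 := h2 (ψ q) hψ hψ1
  have h6 : (ψ q / A) ^ (-(1 / 4) : ℝ) * (ψ q * ψ q ^ (-(1 / 4) : ℝ)) ≤ (A ^ (2 * n))⁻¹ := by
    have e1 : (ψ q / A) ^ (-(1 / 4) : ℝ) * (ψ q * ψ q ^ (-(1 / 4) : ℝ)) =
        A ^ (1 / 4 : ℝ) * ψ q ^ (1 / 2 : ℝ) := by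
      rw [Real.div_rpow hψ.le hA0.le, Real.rpow_neg hA0.le, div_inv_eq_mul]
      have : ψ q ^ (1 / 2 : ℝ) = ψ q ^ (-(1 / 4) : ℝ) * (ψ q * ψ q ^ (-(1 / 4) : ℝ)) := by
        rw [mul_comm (ψ q), ← Real.rpow_add_one hψ.ne', ← Real.rpow_add hψ]
        norm_num
      rw [this]; ring
    have e2 : ψ q ^ (1 / 2 : ℝ) ≤ A ^ (-(2 * n + 1 / 2) : ℝ) := by
      calc ψ q ^ (1 / 2 : ℝ) ≤ ((A ^ (4 * n + 1))⁻¹) ^ (1 / 2 : ℝ) := by gcongr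
        _ = A ^ (-(2 * n + 1 / 2) : ℝ) := by
          rw [← Real.rpow_natCast, ← Real.rpow_neg hA0.le, ← Real.rpow_mul hA0.le]
          congr 1
          push_cast; ring
    rw [e1]
    calc A ^ (1 / 4 : ℝ) * ψ q ^ (1 / 2 : ℝ) ≤ A ^ (1 / 4 : ℝ) * A ^ (-(2 * n + 1 / 2) : ℝ) := by
          gcongr
      _ = A ^ (1 / 4 + -(2 * n + 1 / 2) : ℝ) := (Real.rpow_add hA0 _ _).symm
      _ ≤ A ^ (-((2 * n : ℕ) : ℝ)) := by
          refine Real.rpow_le_rpow_of_exponent_le hA1 ?_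
          push_cast; linarith
      _ = _ := by rw [Real.rpow_neg hA0.le, Real.rpow_natCast]
  have h7 : ∏ i, (1 + |(q i : ℝ)|) ^ 2 ≤ 4 ^ n * A ^ (2 * n) := by
    calc ∏ i, (1 + |(q i : ℝ)|) ^ 2 ≤ ∏ _i : Fin n, (2 * A) ^ 2 := by
          refine Finset.prod_le_prod (fun _ _ => by positivity) fun i _ => ?_
          have : |(q i : ℝ)| ≤ A := by
            rw [← Int.norm_eq_abs]; exact norm_le_pi_norm q i
          gcongr
          linarith
      _ = _ := by
          rw [Finset.prod_const, Finset.card_univ, Fintype.card_fin, ← pow_mul, mul_pow, pow_mul]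
          norm_num
  have hlog : 0 ≤ Real.log (ψ q)⁻¹ := Real.log_nonneg ((one_le_inv₀ hψ).2 hψ1.le)
  calc gaugeDensity (n * m) f (ψ q / A) * (ψ q * Real.log (ψ q)⁻¹ ^ (m - 1))
      ≤ (C₁ * (ψ q / A) ^ (-(1 / 4) : ℝ)) * (ψ q * (C₂ * ψ q ^ (-(1 / 4) : ℝ))) := by gcongr
    _ = C₁ * C₂ * ((ψ q / A) ^ (-(1 / 4) : ℝ) * (ψ q * ψ q ^ (-(1 / 4) : ℝ))) := by ring
    _ ≤ C₁ * C₂ * (A ^ (2 * n))⁻¹ := by gcongr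
    _ ≤ C₁ * C₂ * (4 ^ n * ∏ i, ((1 + |(q i : ℝ)|) ^ 2)⁻¹) := by
        gcongr
        rw [Finset.prod_inv_distrib, ← div_eq_mul_inv, le_div_iff₀ (Finset.prod_pos fun _ _ => by positivity),
          inv_mul_le_iff₀ (by positivity), mul_comm]
        exact h7
    _ = _ := by ring

/-- The vector obtained by pushing the coordinate `i₀` down to an integer with few small prime
factors. -/
noncomputable def thin (i₀ : Fin n) (q : Fin n → ℤ) : Fin n → ℤ :=
  Function.update q i₀ (sparseBelow (q i₀).toNat)

theorem thin_self (i₀ : Fin n) (q : Fin n → ℤ) : (thin i₀ q i₀).toNat = sparseBelow (q i₀).toNat := by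
  simp [thin]

theorem thin_injOn (i₀ : Fin n) (r : ℕ) :
    Set.InjOn (thin i₀) {q | q ∈ dominantCone i₀ ∧ (q i₀).toNat % 8 = r} := by
  intro q hq q' hq' h
  have h1 : (q i₀).toNat = (q' i₀).toNat := by
    refine sparseBelow_inj ?_ (hq.2.trans hq'.2.symm)
    rw [← thin_self, ← thin_self, h]
  funext i
  by_cases hi : i = i₀
  · subst hi
    have := hq.1.1
    have := hq'.1.1
    omega
  · have := congrFun h i
    simpa [thin, hi] using this

theorem thin_mem_uIcc {i₀ : Fin n} {q : Fin n → ℤ} (hq : 0 < q i₀) (i : Fin n) :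
    thin i₀ q i ∈ Set.uIcc 0 (q i) := by
  by_cases hi : i = i₀
  · subst hi
    have h1 := sparseBelow_le (a := (q i).toNat) (by omega)
    rw [Set.uIcc_of_le hq.le, thin, Function.update_self]
    exact ⟨by positivity, by omega⟩
  · simp [thin, hi]

theorem norm_thin_le {i₀ : Fin n} {q : Fin n → ℤ} (hq : q ∈ dominantCone i₀) :
    ‖thin i₀ q‖ ≤ 16 * (sparseBelow (q i₀).toNat : ℝ) := by
  refine (pi_norm_le_iff_of_nonneg (by positivity)).2 fun i => ?_
  rw [Int.norm_eq_abs]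
  have h1 := le_sparseBelow (q i₀).toNat
  have h2 := hq.1
  have : |thin i₀ q i| ≤ 16 * (sparseBelow (q i₀).toNat : ℤ) := by
    by_cases hi : i = i₀
    · subst hi
      simp only [thin, Function.update_self]
      rw [abs_of_nonneg (by positivity)]
      omega
    · have := hq.2 i
      simp only [thin, hi, ne_eq, not_false_eq_true, Function.update_of_ne]
      omega
  exact_mod_cast this

theorem le_norm_thin (i₀ : Fin n) (q : Fin n → ℤ) :
    (sparseBelow (q i₀).toNat : ℝ) ≤ ‖thin i₀ q‖ := by
  refine le_trans (le_of_eq ?_) (norm_le_pi_norm (thin i₀ q) i₀)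
  simp [thin]

/-- The terms with `ψ q` not too small are dominated by the weights of the thinned vectors. -/
theorem IsAdmissible.exists_seriesTerm_le_vectorWeight (hf : IsAdmissible (n * m) f) (hm : 0 < m)
    (hmono : NonIncreasing ψ) (hn : 0 < n) (hψ : ∀ q, 0 < ψ q) (hfin : {q | 1 ≤ ψ q}.Finite)
    (i₀ : Fin n) :
    ∃ R : ℝ, 0 < R ∧ ∃ C : ℝ, 0 < C ∧ ∀ q ∈ dominantCone i₀, R ≤ ‖q‖ →
      (‖q‖ ^ (4 * n + 1))⁻¹ ≤ ψ q → thin i₀ q ∈ sparseVectors ψ i₀ ∧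
        seriesTerm n m f ψ q ≤ C * vectorWeight m f ψ i₀ (thin i₀ q) := by
  obtain ⟨c, hc0, hc1, R₁, hR₁, h1⟩ := hmono.exists_le_const hn hψ hfin
  obtain ⟨R₂, hR₂, C₂, hC₂, h2⟩ := hf.exists_gaugeDensity_pow_le (K := 4 * n + 1) (by omega)
  obtain ⟨C₃, hC₃, h3⟩ := exists_mul_log_pow_le (m - 1) hc0 hc1
  refine ⟨max (15 * R₁) R₂, by positivity, C₂ * 30 * (C₃ * (2 * m ^ (m - 1))), by positivity,
    fun q hq hqR hlarge => ?_⟩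
  have hA := norm_eq_of_mem_dominantCone hq
  set a := (q i₀).toNat with ha
  set a' := sparseBelow a with ha'
  have ha0 : 0 < a := by have := hq.1; omega
  have haR : (0 : ℝ) < a := by exact_mod_cast ha0
  have h4 : a ≤ 15 * a' := le_sparseBelow a
  have h4' : (a : ℝ) ≤ 15 * a' := by exact_mod_cast h4
  have h5 : ψ (thin i₀ q) ≤ c := by
    refine h1 _ (le_trans ?_ (le_norm_thin i₀ q))
    have := (le_max_left _ _).trans hqR
    rw [hA] at this
    linarith
  have h6 : ψ q ≤ ψ (thin i₀ q) := hmono _ _ fun i => thin_mem_uIcc hq.1 i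
  refine ⟨⟨?_, ?_, ?_, h5.trans_lt hc1⟩, ?_⟩
  · simp only [thin, Function.update_self]
    have := (sparseBelow_mem a).1
    exact_mod_cast (by omega : 0 < sparseBelow a)
  · rw [thin_self]; exact sparseBelow_mem a
  · rw [thin_self]; exact norm_thin_le hq
  · have hq0 : q ≠ 0 := by rintro rfl; exact lt_irrefl _ hq.1
    rw [seriesTerm_eq f (hψ q) hq0, vectorWeight, thin_self, NNReal.coe_mul, hf.coe_dyadicDensity]
    set k := Nat.log 2 a' with hk
    have ha'0 : a' ≠ 0 := by omega
    have hk1 : (2 : ℝ) ^ k ≤ a := by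
      exact_mod_cast (Nat.pow_log_le_self 2 ha'0).trans (sparseBelow_le ha0)
    have hk2 : (a : ℝ) ≤ 30 * 2 ^ k := by
      have := Nat.lt_pow_succ_log_self one_lt_two a'
      rw [← hk, pow_succ] at this
      exact_mod_cast (by omega : a ≤ 30 * 2 ^ k)
    have hg1 : gaugeDensity (n * m) f (ψ q / ‖q‖) ≤ C₂ * gaugeDensity (n * m) f (a : ℝ)⁻¹ := by
      have haR₂ : R₂ ≤ a := by rw [← hA]; exact (le_max_right _ _).trans hqR
      refine le_trans (hf.gaugeDensity_anti (by positivity) ?_) (h2 a haR₂)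
      rw [hA] at hlarge ⊢
      rw [pow_succ, mul_inv, ← div_eq_mul_inv]
      gcongr
    have hg2 : gaugeDensity (n * m) f (a : ℝ)⁻¹ ≤ 30 * gaugeDensity (n * m) f (2⁻¹ ^ k) := by
      have hle : (a : ℝ)⁻¹ ≤ 2⁻¹ ^ k := by
        rw [inv_pow]; exact inv_anti₀ (by positivity) hk1
      have := hf.gaugeDensity_mul_mono (by positivity) hle
      rw [← div_eq_mul_inv, div_le_iff₀ haR] at this
      have hg : 0 ≤ gaugeDensity (n * m) f (2⁻¹ ^ k) := hf.gaugeDensity_nonneg (by positivity)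
      calc _ ≤ gaugeDensity (n * m) f (2⁻¹ ^ k) * 2⁻¹ ^ k * a := this
        _ ≤ gaugeDensity (n * m) f (2⁻¹ ^ k) * 2⁻¹ ^ k * (30 * 2 ^ k) := by gcongr
        _ = 30 * gaugeDensity (n * m) f (2⁻¹ ^ k) * (2⁻¹ * 2) ^ k := by rw [mul_pow]; ring
        _ = _ := by norm_num
    have hlog : 0 ≤ Real.log (ψ q)⁻¹ :=
      Real.log_nonneg ((one_le_inv₀ (hψ q)).2 (h6.trans (h5.trans hc1.le)))
    have hlog' : 0 ≤ ψ q * Real.log (ψ q)⁻¹ ^ (m - 1) := mul_nonneg (hψ q).le (pow_nonneg hlog _)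
    have hg0 : 0 ≤ gaugeDensity (n * m) f (2⁻¹ ^ k) := hf.gaugeDensity_nonneg (by positivity)
    have hv := mul_log_pow_le_shellVolume hm (hψ (thin i₀ q)) (h5.trans_lt hc1)
    calc _ ≤ (C₂ * (30 * gaugeDensity (n * m) f (2⁻¹ ^ k))) *
          (C₃ * (2 * m ^ (m - 1) * shellVolume m (depth (ψ (thin i₀ q))))) := by
          refine mul_le_mul (hg1.trans (by gcongr)) ((h3 _ _ (hψ q) h6 h5).trans (by gcongr)) hlog'
            (by positivity)
      _ = _ := by ring

/-- Convergence of the thinned series implies convergence of the whole series over a cone. -/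
theorem summable_dominantCone (hf : IsAdmissible (n * m) f) (hm : 0 < m)
    (hmono : NonIncreasing ψ) (hn : 0 < n) (hψ : ∀ q, 0 < ψ q) (hfin : {q | 1 ≤ ψ q}.Finite)
    (i₀ : Fin n) (h : Summable fun q : sparseVectors ψ i₀ => vectorWeight m f ψ i₀ q) :
    Summable ((dominantCone i₀).indicator (seriesTerm n m f ψ)) := by
  classical
  obtain ⟨R₁, hR₁, C₁, hC₁, h1⟩ := hf.exists_seriesTerm_le_prod
  obtain ⟨R₂, hR₂, C₂, hC₂, h2⟩ := hf.exists_seriesTerm_le_vectorWeight hm hmono hn hψ hfin i₀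
  -- on each residue class of the coordinate `i₀` modulo `8` the thinning is injective
  let S : ℕ → Set (Fin n → ℤ) := fun r =>
    {q | q ∈ dominantCone i₀ ∧ (q i₀).toNat % 8 = r ∧ thin i₀ q ∈ sparseVectors ψ i₀}
  let w : (Fin n → ℤ) → ℝ := fun q => vectorWeight m f ψ i₀ (thin i₀ q)
  have hw0 : ∀ q, 0 ≤ w q := fun q => NNReal.coe_nonneg _
  have hS : ∀ r, Summable ((S r).indicator w) := by
    intro r
    rw [← summable_subtype_iff_indicator]
    have := (NNReal.summable_coe.2 h).comp_injective
      (i := fun q : S r => (⟨thin i₀ q, q.2.2.2⟩ : sparseVectors ψ i₀)) ?_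
    · exact this
    · intro q q' hqq
      exact Subtype.ext (thin_injOn i₀ r ⟨q.2.1, q.2.2.1⟩ ⟨q'.2.1, q'.2.2.1⟩
        (congrArg Subtype.val hqq))
  have hG := ((summable_prod_int_inv_sq n).mul_left C₁).add
    ((summable_sum fun r (_ : r ∈ Finset.range 8) => hS r).mul_left C₂)
  obtain ⟨c, hc0, hc1, R₃, hR₃, h3⟩ := hmono.exists_le_const hn hψ hfin
  refine Summable.of_norm_bounded_eventually hG ?_
  rw [Filter.eventually_cofinite]
  refine (finite_norm_le (n := n) (max R₁ (max R₂ R₃))).subset fun q hq => ?_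
  rw [Set.mem_ofPred_eq] at hq ⊢
  by_contra! hR
  apply hq
  have hR1 : R₁ ≤ ‖q‖ := (le_max_left _ _).trans hR.le
  have hR2 : R₂ ≤ ‖q‖ := ((le_max_left _ _).trans (le_max_right _ _)).trans hR.le
  have hR3 : R₃ ≤ ‖q‖ := ((le_max_right _ _).trans (le_max_right _ _)).trans hR.le
  have hP : 0 ≤ C₁ * ∏ i, ((1 + |(q i : ℝ)|) ^ 2)⁻¹ :=
    mul_nonneg hC₁.le (Finset.prod_nonneg fun _ _ => by positivity)
  have hI : ∀ r, 0 ≤ (S r).indicator w q := fun r => Set.indicator_nonneg (fun q _ => hw0 q) q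
  have hT : 0 ≤ C₂ * ∑ r ∈ Finset.range 8, (S r).indicator w q :=
    mul_nonneg hC₂.le (Finset.sum_nonneg fun r _ => hI r)
  by_cases hqc : q ∈ dominantCone i₀
  · have hq0 : q ≠ 0 := by rintro rfl; exact lt_irrefl _ hqc.1
    have hterm : 0 ≤ seriesTerm n m f ψ q := by
      rw [seriesTerm_eq f (hψ q) hq0]
      have := Real.log_nonneg ((one_le_inv₀ (hψ q)).2 ((h3 q hR3).trans hc1.le))
      exact mul_nonneg (hf.gaugeDensity_nonneg (div_pos (hψ q) (norm_pos_iff.2 hq0)))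
        (mul_nonneg (hψ q).le (pow_nonneg this _))
    rw [Set.indicator_of_mem hqc, Real.norm_of_nonneg hterm]
    rcases lt_or_ge (ψ q) ((‖q‖ ^ (4 * n + 1))⁻¹) with hs | hl
    · exact (h1 ψ q hR1 (hψ q) hs).trans (le_add_of_nonneg_right hT)
    · obtain ⟨h4, h5⟩ := h2 q hqc hR2 hl
      refine (h5.trans ?_).trans (le_add_of_nonneg_left hP)
      gcongr
      have hmem : q ∈ S ((q i₀).toNat % 8) := ⟨hqc, rfl, h4⟩
      calc (vectorWeight m f ψ i₀ (thin i₀ q) : ℝ) = (S ((q i₀).toNat % 8)).indicator w q :=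
            (Set.indicator_of_mem hmem w).symm
        _ ≤ _ := Finset.single_le_sum (f := fun r => (S r).indicator w q) (fun r _ => hI r)
            (Finset.mem_range.2 (Nat.mod_lt _ (by norm_num)))
  · rw [Set.indicator_of_notMem hqc, norm_zero]
    exact add_nonneg hP hT

theorem distInt_neg (y : ℝ) : distInt (-y) = distInt y := by
  rw [distInt_eq_norm, distInt_eq_norm, AddCircle.coe_neg, norm_neg]

theorem multSet_comp_neg (n m : ℕ) (ψ : (Fin n → ℤ) → ℝ) :
    multSet n m (fun q => ψ (-q)) = multSet n m ψ := by
  ext x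
  refine and_congr_right fun _ => ?_
  rw [← Set.infinite_image_iff (f := fun q : Fin n → ℤ => -q) neg_injective.injOn]
  congr! 1
  ext q
  rw [Set.mem_image]
  refine ⟨?_, fun h => ⟨-q, ?_, neg_neg q⟩⟩
  · rintro ⟨q, h, rfl⟩
    rw [Set.mem_ofPred_eq] at h ⊢
    convert h using 2 with j
    rw [← distInt_neg]
    congr 1
    simp
  · rw [Set.mem_ofPred_eq] at h ⊢
    simp only [neg_neg]
    convert h using 2 with j
    rw [← distInt_neg]
    congr 1
    simp

theorem seriesTerm_comp_neg (n m : ℕ) (f : ℝ → ℝ) (ψ : (Fin n → ℤ) → ℝ) (q : Fin n → ℤ) :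
    seriesTerm n m f (fun q => ψ (-q)) (-q) = seriesTerm n m f ψ q := by
  simp [seriesTerm]

theorem NonIncreasing.comp_neg (hmono : NonIncreasing ψ) : NonIncreasing fun q => ψ (-q) := by
  intro q q' h
  refine hmono _ _ fun l => ?_
  have := h l
  rw [Set.mem_uIcc] at this ⊢
  simp only [Pi.neg_apply]
  omega

/-- If the set has finite measure, the series converges. -/
theorem summable_of_hausdorffFMeasure_ne_top (hf : IsAdmissible (n * m) f) (hm : 0 < m)
    (hmono : NonIncreasing ψ) (hn : 0 < n) (hψ : ∀ q, 0 < ψ q) (hfin : {q | 1 ≤ ψ q}.Finite)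
    (h : hausdorffFMeasure f (multSet n m ψ) ≠ ⊤) :
    Summable fun q : {q : Fin n → ℤ // q ≠ 0} => seriesTerm n m f ψ q := by
  classical
  have h1 : ∀ i₀, Summable ((dominantCone i₀).indicator (seriesTerm n m f ψ)) := by
    intro i₀
    refine summable_dominantCone hf hm hmono hn hψ hfin i₀ ?_
    by_contra hcon
    exact h (hausdorffFMeasure_multSet_eq_top hf hψ i₀ hcon)
  have hfin' : {q | 1 ≤ ψ (-q)}.Finite :=
    hfin.preimage (f := fun q => -q) neg_injective.injOn
  have h2 : ∀ i₀, Summable fun q =>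
      (dominantCone i₀).indicator (seriesTerm n m f fun q => ψ (-q)) (-q) := by
    intro i₀
    refine (Equiv.neg (Fin n → ℤ)).summable_iff.2 (summable_dominantCone hf hm hmono.comp_neg hn
      (fun q => hψ _) hfin' i₀ ?_)
    by_contra hcon
    refine h ?_
    rw [← multSet_comp_neg]
    exact hausdorffFMeasure_multSet_eq_top hf (fun q => hψ _) i₀ hcon
  have h3 := (summable_sum fun i₀ (_ : i₀ ∈ Finset.univ) => (h1 i₀).abs).add
    (summable_sum fun i₀ (_ : i₀ ∈ Finset.univ) => (h2 i₀).abs)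
  refine Summable.of_norm_bounded (h3.subtype {q | q ≠ 0}) fun q => ?_
  obtain ⟨i₀, hi⟩ := exists_mem_dominantCone q.2
  simp only [Function.comp_apply]
  rcases hi with hi | hi
  · refine le_trans ?_ (le_add_of_nonneg_right (Finset.sum_nonneg fun _ _ => abs_nonneg _))
    refine le_trans (le_of_eq ?_) (Finset.single_le_sum (fun _ _ => abs_nonneg _) (Finset.mem_univ i₀))
    rw [Set.indicator_of_mem hi, Real.norm_eq_abs]
  · refine le_trans ?_ (le_add_of_nonneg_left (Finset.sum_nonneg fun _ _ => abs_nonneg _))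
    refine le_trans (le_of_eq ?_) (Finset.single_le_sum (fun _ _ => abs_nonneg _) (Finset.mem_univ i₀))
    rw [Set.indicator_of_mem hi, Real.norm_eq_abs, seriesTerm_comp_neg]

end Thinning

/-! ### Covering the set of matrices with a small product -/

section Cover

variable {n m : ℕ}

theorem distInt_le_add (y y' : ℝ) : distInt y ≤ distInt y' + |y - y'| := by
  calc distInt y ≤ |y - round y'| := distInt_le y _
    _ = |(y' - round y') + (y - y')| := by congr 1; ring
    _ ≤ _ := abs_add_le _ _

theorem exists_sum_eq_of_le_sum {L : ℕ} (e : Fin m → ℕ) (he : L ≤ ∑ j, e j) :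
    ∃ b ∈ exponents m L, ∀ j, b j ≤ e j := by
  obtain ⟨k, hk⟩ := Nat.exists_eq_add_of_le he
  induction k generalizing e with
  | zero => exact ⟨e, mem_exponents.2 hk, fun _ => le_rfl⟩
  | succ k ih =>
    obtain ⟨j, -, hj⟩ : ∃ j ∈ Finset.univ, e j ≠ 0 := by
      by_contra! h
      rw [Finset.sum_eq_zero h] at hk
      omega
    have h1 : ∑ i, e i = ∑ i, Function.update e j (e j - 1) i + 1 := by
      rw [Finset.sum_update_of_mem (Finset.mem_univ j),
        ← Finset.sum_sdiff (Finset.subset_univ {j}), Finset.sum_singleton]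
      omega
    obtain ⟨b, hb, hbe⟩ := ih (Function.update e j (e j - 1)) (by omega) (by omega)
    refine ⟨b, hb, fun i => (hbe i).trans ?_⟩
    by_cases hi : i = j
    · subst hi; simp
    · simp [hi]

/-- A point of the region `∏ uⱼ < 2⁻ᴸ` lies in one of the boxes `uⱼ ≤ 2 * 2^(-bⱼ)` with
`∑ bⱼ = L`. -/
theorem exists_exponents_of_prod_lt {L : ℕ} {u : Fin m → ℝ}
    (hu1 : ∀ j, u j ≤ 1) (h : ∏ j, u j < 2⁻¹ ^ L) :
    ∃ b ∈ exponents m L, ∀ j, u j ≤ 2 * 2⁻¹ ^ b j := by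
  suffices ∃ e : Fin m → ℕ, L ≤ ∑ j, e j ∧ ∀ j, u j ≤ 2 * 2⁻¹ ^ e j by
    obtain ⟨e, he, hue⟩ := this
    obtain ⟨b, hb, hbe⟩ := exists_sum_eq_of_le_sum e he
    refine ⟨b, hb, fun j => (hue j).trans ?_⟩
    have := pow_le_pow_of_le_one (show (0 : ℝ) ≤ 2⁻¹ by norm_num) (by norm_num) (hbe j)
    linarith
  by_cases hsmall : ∃ j, u j ≤ 2 * 2⁻¹ ^ L
  -- one very small coordinate can absorb the whole exponent
  · obtain ⟨j, hj⟩ := hsmall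
    refine ⟨Pi.single j L, by simp, fun i => ?_⟩
    by_cases hi : i = j
    · subst hi; simpa using hj
    · simp only [Pi.single_apply, hi, if_false, pow_zero]
      linarith [hu1 i]
  · push Not at hsmall
    have hpos : ∀ j, 0 < u j := fun j => lt_trans (by positivity) (hsmall j)
    choose e he1 he2 using fun j => exists_nat_pow_near_of_lt_one (hpos j) (hu1 j)
      (show (0 : ℝ) < 2⁻¹ by norm_num) (show (2 : ℝ)⁻¹ < 1 by norm_num)
    refine ⟨fun j => e j + 1, ?_, fun j => (he2 j).trans (le_of_eq (by rw [pow_succ]; ring))⟩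
    have h1 : (2 : ℝ)⁻¹ ^ (∑ j, (e j + 1)) < 2⁻¹ ^ L := by
      rw [← Finset.prod_pow_eq_pow_sum]
      exact lt_of_le_of_lt (Finset.prod_le_prod (fun _ _ => by positivity) fun j _ => (he1 j).le) h
    exact ((pow_lt_pow_iff_right_of_lt_one₀ (by norm_num) (by norm_num)).1 h1).le

theorem volume_colCube_distInt_lt_le {q : Fin n → ℤ} (hq : q ≠ 0) (z : Fin n → ℤ) {δ : ℝ}
    (hδ0 : 0 ≤ δ) :
    volume {y | y ∈ colCube 0 z ∧ distInt (colDot q y) < δ} ≤ ENNReal.ofReal (8 * δ) := by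
  have h1 : volume (colCube 0 z) = 1 := by rw [volume_colCube]; simp
  rcases le_total δ 1 with hδ | hδ
  · obtain ⟨i₀, hi₀⟩ := Function.ne_iff.1 hq
    rcases lt_or_gt_of_ne hi₀ with h | h
    · have := volume_colCube_near_int_le (q := -q) (i₀ := i₀) (l := 0) (z := z)
        (by simp only [Pi.zero_apply] at h; simp; omega) hδ0 hδ
      rw [h1, mul_one] at this
      refine (measure_mono ?_).trans this
      rintro y ⟨hy, hy'⟩
      refine ⟨hy, -round (colDot q y), ?_⟩
      have : colDot (-q) y = -colDot q y := by simp [colDot]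
      rw [this]
      push_cast
      rwa [sub_neg_eq_add, neg_add_eq_sub, abs_sub_comm]
    · have := volume_colCube_near_int_le (q := q) (i₀ := i₀) (l := 0) (z := z)
        (by simp only [Pi.zero_apply] at h; simp; omega) hδ0 hδ
      rw [h1, mul_one] at this
      refine (measure_mono ?_).trans this
      rintro y ⟨hy, hy'⟩
      exact ⟨hy, round (colDot q y), hy'⟩
  · refine (measure_mono (t := colCube 0 z) fun y hy => hy.1).trans ?_
    rw [h1, ENNReal.one_le_ofReal]
    linarith

theorem card_mul_volume_le {l : ℕ} {s : Finset (Cols n m)} (hs : Set.InjOn (dyIdx l) (s : Set (Cols n m)))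
    {B : Set (Cols n m)} (hB : ∀ x ∈ s, cell l x ⊆ B) :
    (s.card : ℝ≥0∞) * ((2 : ℝ≥0∞)⁻¹ ^ l) ^ (n * m) ≤ volume B := by
  calc (s.card : ℝ≥0∞) * ((2 : ℝ≥0∞)⁻¹ ^ l) ^ (n * m) = ∑ x ∈ s, volume (cell l x) := by
        simp only [volume_cell, Finset.sum_const, nsmul_eq_mul]
    _ = volume (⋃ x ∈ s, cell l x) := by
        refine (measure_biUnion_finset ?_ fun x _ => measurableSet_cell l x).symm
        intro x hx y hy hxy
        refine Set.disjoint_left.2 fun w hwx hwy => hxy (hs hx hy ?_)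
        exact Eq.trans (Eq.symm hwx) hwy
    _ ≤ _ := measure_mono (Set.iUnion₂_subset hB)

theorem depth_pos {t : ℝ} (h0 : 0 < t) (h1 : t < 1) : 0 < depth t := by
  have := (depth_spec h0 h1).1
  by_contra! h
  rw [Nat.le_zero.1 h, pow_zero] at this
  linarith

theorem le_pow_depth_sub_one {t : ℝ} (h0 : 0 < t) (h1 : t < 1) : t ≤ 2⁻¹ ^ (depth t - 1) := by
  have := (depth_spec h0 h1).2
  obtain ⟨k, hk⟩ := Nat.exists_eq_succ_of_ne_zero (depth_pos h0 h1).ne'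
  rw [hk] at this ⊢
  rw [Nat.succ_eq_add_one, pow_succ] at this
  rw [Nat.succ_eq_add_one, Nat.add_sub_cancel]
  linarith

/-- The number of dyadic cubes needed to cover the region `∏ ‖q xⱼ‖ < t` of the unit cube is
controlled by the volume of a slightly larger region. -/
theorem exists_cells_of_prod_lt {q : Fin n → ℤ} (hq : q ≠ 0) {t : ℝ} (ht0 : 0 < t) (ht1 : t < 1)
    {l : ℕ} (hl : (∑ i, (q i).natAbs : ℕ) * (2 : ℝ)⁻¹ ^ l ≤ t) {A : Set (Cols n m)}
    (hA : ∀ x ∈ A, (∀ j i, 0 ≤ x j i ∧ x j i ≤ 1) ∧ ∏ j, distInt (colDot q (x j)) < t) :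
    ∃ s : Finset (Cols n m), (∀ x ∈ A, ∃ y ∈ s, dyIdx l x = dyIdx l y) ∧
      (s.card : ℝ) * ((2 : ℝ)⁻¹ ^ l) ^ (n * m) ≤
        2 ^ (n * m) * 32 ^ m * shellVolume m (depth t - 1) := by
  classical
  set L := depth t - 1 with hL
  have hfin : (dyIdx l '' A).Finite := by
    refine (Set.finite_Icc (0 : Fin m → Fin n → ℤ) (fun _ _ => 2 ^ l)).subset ?_
    rintro _ ⟨x, hx, rfl⟩
    refine ⟨fun j i => ?_, fun j i => ?_⟩
    · exact Int.floor_nonneg.2 (mul_nonneg (by positivity) ((hA x hx).1 j i).1)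
    · refine Int.floor_le_iff.2 ?_
      push_cast
      have : (2 : ℝ) ^ l * x j i ≤ 2 ^ l * 1 := by gcongr; exact ((hA x hx).1 j i).2
      linarith
  obtain ⟨s', hs'A, hbij⟩ := Set.exists_subset_bijOn A (dyIdx l)
  have hs'fin : s'.Finite := hbij.finite_iff_finite.2 hfin
  refine ⟨hs'fin.toFinset, fun x hx => ?_, ?_⟩
  · obtain ⟨y, hy, hxy⟩ := hbij.surjOn ⟨x, hx, rfl⟩
    exact ⟨y, hs'fin.mem_toFinset.2 hy, hxy.symm⟩
  set B : Set (Cols n m) := ⋃ z : Fin m → Fin n → Fin 2, ⋃ b ∈ exponents m L,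
    Set.pi Set.univ fun j => {y | y ∈ colCube 0 (fun i => ((z j i : ℕ) : ℤ)) ∧
      distInt (colDot q y) < 4 * 2⁻¹ ^ b j} with hB
  have hsub : ∀ x ∈ hs'fin.toFinset, cell l x ⊆ B := by
    intro x hx y hy
    have hxA := hA x (hs'A (hs'fin.mem_toFinset.1 hx))
    obtain ⟨b, hb, hu⟩ := exists_exponents_of_prod_lt (L := L)
      (u := fun j => distInt (colDot q (x j)))
      (fun j => (abs_sub_round _).trans (by norm_num))
      (hxA.2.trans_le (le_pow_depth_sub_one ht0 ht1))
    have hz : ∀ j i, ∃ e : Fin 2, ⌊x j i⌋ = ((e : ℕ) : ℤ) := by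
      intro j i
      have h1 : 0 ≤ ⌊x j i⌋ := Int.floor_nonneg.2 (hxA.1 j i).1
      have h2 : ⌊x j i⌋ < 2 := Int.floor_lt.2 (by push_cast; linarith [(hxA.1 j i).2])
      exact ⟨⟨⌊x j i⌋.toNat, by omega⟩, by simp [h1]⟩
    choose z hz using hz
    refine Set.mem_iUnion.2 ⟨z, Set.mem_biUnion hb fun j _ => ⟨?_, ?_⟩⟩
    · have h0 : y ∈ cell 0 x := dyIdx_eq_of_le (Nat.zero_le l) hy
      rw [cell_eq_setOf] at h0
      have := h0 j trivial
      convert this using 1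
      congr 1
      funext i
      rw [← hz]
      simp [dyIdx]
    · have h1 := distInt_le_add (colDot q (y j)) (colDot q (x j))
      have h2 := (abs_colDot_sub_le hy q j).trans (hl.trans (le_pow_depth_sub_one ht0 ht1))
      have h3 : (2 : ℝ)⁻¹ ^ L ≤ 2⁻¹ ^ b j :=
        pow_le_pow_of_le_one (by norm_num) (by norm_num) (le_of_mem_exponents hb j)
      have h4 := hu j
      have h5 : (0 : ℝ) < 2⁻¹ ^ b j := by positivity
      linarith
  have hvol : volume B ≤ ((2 ^ (n * m) * 32 ^ m * shellVolume m L : ℝ≥0) : ℝ≥0∞) := by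
    have hone : ∀ z : Fin m → Fin n → Fin 2, volume (⋃ b ∈ exponents m L,
        Set.pi Set.univ fun j => {y | y ∈ colCube 0 (fun i => ((z j i : ℕ) : ℤ)) ∧
          distInt (colDot q y) < 4 * 2⁻¹ ^ b j}) ≤ ((32 ^ m * shellVolume m L : ℝ≥0) : ℝ≥0∞) := by
      intro z
      refine (measure_biUnion_finset_le _ _).trans ?_
      rw [← sum_ofReal_exponents]
      refine Finset.sum_le_sum fun b hb => ?_
      have : ((32 ^ m : ℝ≥0) : ℝ) = (32 : ℝ) ^ m := by push_cast; rfl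
      rw [volume_pi_pi, this, ← prod_ofReal_exponents hb (by norm_num)]
      refine Finset.prod_le_prod' fun j _ => ?_
      refine (volume_colCube_distInt_lt_le hq _ (by positivity)).trans (le_of_eq ?_)
      congr 1; ring
    calc volume B ≤ ∑ z : Fin m → Fin n → Fin 2, volume (⋃ b ∈ exponents m L,
        Set.pi Set.univ fun j => {y | y ∈ colCube 0 (fun i => ((z j i : ℕ) : ℤ)) ∧
          distInt (colDot q y) < 4 * 2⁻¹ ^ b j}) := measure_iUnion_fintype_le _ _
      _ ≤ ∑ _z : Fin m → Fin n → Fin 2, ((32 ^ m * shellVolume m L : ℝ≥0) : ℝ≥0∞) :=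
          Finset.sum_le_sum fun z _ => hone z
      _ = _ := by
          rw [Finset.sum_const, nsmul_eq_mul, Finset.card_univ]
          have : Fintype.card (Fin m → Fin n → Fin 2) = 2 ^ (n * m) := by simp [pow_mul]
          rw [this]
          push_cast
          ring
  have hinj : Set.InjOn (dyIdx l) (hs'fin.toFinset : Set (Cols n m)) := by
    rw [Set.Finite.coe_toFinset]; exact hbij.injOn
  have key := (card_mul_volume_le hinj hsub).trans hvol
  have hcoe : ((hs'fin.toFinset.card : ℝ≥0∞)) * ((2 : ℝ≥0∞)⁻¹ ^ l) ^ (n * m) =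
      (((hs'fin.toFinset.card : ℝ≥0) * ((2 : ℝ≥0)⁻¹ ^ l) ^ (n * m) : ℝ≥0) : ℝ≥0∞) := by
    rw [ENNReal.coe_mul, ENNReal.coe_natCast, ENNReal.coe_pow, ENNReal.coe_pow,
      ENNReal.coe_inv two_ne_zero, ENNReal.coe_ofNat]
  rw [hcoe, ENNReal.coe_le_coe, ← NNReal.coe_le_coe] at key
  push_cast at key
  exact key

theorem exists_shellVolume_le {m : ℕ} (hm : 0 < m) {c : ℝ} (hc0 : 0 < c) (hc1 : c < 1) :
    ∃ C : ℝ, 0 < C ∧ ∀ t : ℝ, 0 < t → t ≤ c →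
      shellVolume m (depth t - 1) ≤ C * (t * Real.log t⁻¹ ^ (m - 1)) := by
  set c₀ := Real.log c⁻¹ with hc₀
  have hc₀0 : 0 < c₀ := Real.log_pos ((one_lt_inv₀ hc0).2 hc1)
  refine ⟨2 * (2 + c₀⁻¹) ^ (m - 1), by positivity, fun t h0 h1 => ?_⟩
  have ht1 := h1.trans_lt hc1
  set L := depth t - 1 with hL
  have hdepth : depth t = L + 1 := by have := depth_pos h0 ht1; omega
  have hcl : c₀ ≤ Real.log t⁻¹ := Real.log_le_log (by positivity) (inv_anti₀ h0 h1)
  have h2 : (L : ℝ) ≤ 2 * Real.log t⁻¹ := by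
    have h3 : (2 : ℝ) ^ L ≤ t⁻¹ := by
      have := le_pow_depth_sub_one h0 ht1
      rw [inv_pow] at this
      exact (le_inv_comm₀ (by positivity) h0).2 this
    have h4 := Real.log_le_log (by positivity) h3
    rw [Real.log_pow] at h4
    have h5 := Real.log_two_gt_d9
    have h6 : (L : ℝ) * 2⁻¹ ≤ L * Real.log 2 := by gcongr; linarith
    linarith
  have h3 : (L : ℝ) + 1 ≤ (2 + c₀⁻¹) * Real.log t⁻¹ := by
    have : 1 ≤ c₀⁻¹ * Real.log t⁻¹ := by
      calc 1 = c₀⁻¹ * c₀ := (inv_mul_cancel₀ hc₀0.ne').symm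
        _ ≤ _ := by gcongr
    linarith
  have h4 : (2 : ℝ)⁻¹ ^ L ≤ 2 * t := by
    have := (depth_spec h0 ht1).1
    rw [hdepth, pow_succ] at this
    linarith
  have h5 : ((exponents m L).card : ℝ) ≤ ((L : ℝ) + 1) ^ (m - 1) := by
    exact_mod_cast card_exponents_le hm L
  have hlog : 0 ≤ Real.log t⁻¹ := hc₀0.le.trans hcl
  calc (shellVolume m L : ℝ) = (exponents m L).card * 2⁻¹ ^ L := by rw [shellVolume]; push_cast; rfl
    _ ≤ ((2 + c₀⁻¹) * Real.log t⁻¹) ^ (m - 1) * (2 * t) := by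
        gcongr
        exact h5.trans (by gcongr)
    _ = _ := by rw [mul_pow]; ring

end Cover

/-! ### The convergence case -/

section Convergence

variable {n m : ℕ} {f : ℝ → ℝ} {ψ : (Fin n → ℤ) → ℝ}

theorem hausdorffFMeasure_mono {X : Type*} [PseudoMetricSpace X] (f : ℝ → ℝ) {E F : Set X}
    (h : E ⊆ F) : hausdorffFMeasure f E ≤ hausdorffFMeasure f F := by
  refine iSup₂_mono fun η _ => ?_
  exact iInf₂_mono fun c r => iInf_mono' fun h' => ⟨h.trans h', le_rfl⟩

/-- Covers indexed by an arbitrary countable type are admissible; balls of radius `0`, of mass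
`f 0 = 0`, fill up the missing indices. -/
theorem hausdorffPremeasure_le_tsum {X ι : Type*} [PseudoMetricSpace X] [Nonempty X] [Countable ι]
    {f : ℝ → ℝ} (hf : f 0 = 0) {η : ℝ} (hη : 0 ≤ η) {E : Set X} (c : ι → X) (r : ι → ℝ)
    (hE : E ⊆ ⋃ i, Metric.closedBall (c i) (r i))
    (hr : ∀ i, Metric.diam (Metric.closedBall (c i) (r i)) ≤ η) :
    hausdorffPremeasure f η E ≤
      ∑' i, ENNReal.ofReal (f (Metric.diam (Metric.closedBall (c i) (r i)))) := by
  obtain ⟨e, he⟩ := Countable.exists_injective_nat ι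
  let x₀ : X := Classical.arbitrary X
  let c' : ℕ → X := Function.extend e c fun _ => x₀
  let r' : ℕ → ℝ := Function.extend e r 0
  have hball : ∀ i, Metric.closedBall (c' (e i)) (r' (e i)) = Metric.closedBall (c i) (r i) := by
    intro i
    simp only [c', r', he.extend_apply]
  have hdiam : ∀ k, k ∉ Set.range e → Metric.diam (Metric.closedBall (c' k) (r' k)) = 0 := by
    intro k hk
    have h0 : r' k = 0 := 
      Function.extend_apply' r (0 : ℕ → ℝ) k fun ⟨i, hi⟩ => hk ⟨i, hi⟩
    rw [h0]
    refine le_antisymm ?_ Metric.diam_nonneg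
    simpa using Metric.diam_closedBall (x := c' k) le_rfl
  refine (iInf₂_le_of_le c' r' (iInf₂_le_of_le ?_ ?_ le_rfl)).trans (le_of_eq ?_)
  · refine hE.trans (Set.iUnion_subset fun i => ?_)
    rw [← hball]
    exact Set.subset_iUnion (fun k => Metric.closedBall (c' k) (r' k)) (e i)
  · intro k
    by_cases hk : k ∈ Set.range e
    · obtain ⟨i, rfl⟩ := hk
      rw [hball]; exact hr i
    · rw [hdiam k hk]; exact hη
  · rw [← he.tsum_eq]
    · simp only [hball]
    · intro k hk
      by_contra hk'
      apply hk
      simp only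
      rw [hdiam k hk', hf, ENNReal.ofReal_zero]

theorem dist_le_of_dyIdx_eq {l : ℕ} {x y : EuclideanSpace ℝ (Fin n × Fin m)}
    (h : dyIdx l (toCols x) = dyIdx l (toCols y)) : dist x y ≤ (n * m : ℕ) * 2⁻¹ ^ l := by
  have hpos : (0 : ℝ) < 2⁻¹ ^ l := by positivity
  rw [EuclideanSpace.dist_eq, Real.sqrt_le_left (by positivity)]
  calc ∑ p, dist (x p) (y p) ^ 2 ≤ ∑ _p : Fin n × Fin m, ((2 : ℝ)⁻¹ ^ l) ^ 2 := by
        refine Finset.sum_le_sum fun p _ => ?_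
        have := (abs_sub_lt_of_dyIdx_eq h p.2 p.1).le
        rw [Real.dist_eq]
        gcongr
        exact this
    _ = (n * m : ℕ) * ((2 : ℝ)⁻¹ ^ l) ^ 2 := by simp
    _ ≤ _ := by
        rw [mul_pow]
        gcongr
        exact_mod_cast Nat.le_self_pow two_ne_zero (n * m)

/-- The points of the unit cube with `∏ ‖q xⱼ‖ < ψ q`, for one vector `q`. -/
def multSlice (n m : ℕ) (ψ : (Fin n → ℤ) → ℝ) (q : Fin n → ℤ) :
    Set (EuclideanSpace ℝ (Fin n × Fin m)) :=
  {x | x ∈ unitCube n m ∧ ∏ j : Fin m, distInt (∑ i : Fin n, (q i : ℝ) * x (i, j)) < ψ q}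

/-- The region attached to one vector `q` is covered by balls whose total `f`-mass is at most
a multiple of the term of the series. -/
theorem IsAdmissible.exists_cover_multSlice (hf : IsAdmissible (n * m) f) (hn : 0 < n) (hm : 0 < m)
    (hmono : NonIncreasing ψ) (hψ : ∀ q, 0 < ψ q) (hfin : {q | 1 ≤ ψ q}.Finite) :
    ∃ R : ℝ, 0 < R ∧ ∃ C : ℝ, 0 < C ∧ ∀ q : Fin n → ℤ, q ≠ 0 → R ≤ ‖q‖ →
      ∃ (s : Finset (EuclideanSpace ℝ (Fin n × Fin m))) (r : ℝ), 0 ≤ r ∧ 2 * r ≤ R / ‖q‖ ∧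
        multSlice n m ψ q ⊆ ⋃ y ∈ s, Metric.closedBall y r ∧
        s.card * f (2 * r) ≤ C * seriesTerm n m f ψ q := by
  classical
  obtain ⟨c, hc0, hc1, R₁, hR₁, h1⟩ := hmono.exists_le_const hn hψ hfin
  obtain ⟨C₁, hC₁, h2⟩ := exists_shellVolume_le hm hc0 hc1
  set d := n * m with hd
  have hd0 : 0 < d := Nat.mul_pos hn hm
  have hn' : (1 : ℝ) ≤ n := by exact_mod_cast hn
  have hd' : (1 : ℝ) ≤ d := by exact_mod_cast hd0
  refine ⟨max R₁ (max 1 (2 * d)), by positivity,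
    (2 * d) ^ d * (2 * n) ^ d * (2 ^ d * 32 ^ m * C₁), by positivity, fun q hq hqR => ?_⟩
  have hA1 : 1 ≤ ‖q‖ := ((le_max_left _ _).trans (le_max_right _ _)).trans hqR
  have hA0 : 0 < ‖q‖ := by linarith
  have ht0 := hψ q
  have htc : ψ q ≤ c := h1 q ((le_max_left _ _).trans hqR)
  have ht1 : ψ q < 1 := htc.trans_lt hc1
  set t := ψ q with ht
  have hx0 : 0 < t / (n * ‖q‖) := by positivity
  have hx1 : t / (n * ‖q‖) ≤ 1 := by
    rw [div_le_one (by positivity)]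
    nlinarith
  -- dyadic cubes of side just below `t / (n ‖q‖)`, on which the form `q` varies by at most `t`
  obtain ⟨l', hl1, hl2⟩ := exists_nat_pow_near_of_lt_one hx0 hx1
    (show (0 : ℝ) < 2⁻¹ by norm_num) (show (2 : ℝ)⁻¹ < 1 by norm_num)
  set l := l' + 1 with hl
  have hl3 : t / (n * ‖q‖) ≤ 2 * 2⁻¹ ^ l := hl2.trans (le_of_eq (by rw [hl, pow_succ]; ring))
  have hside : (0 : ℝ) < 2⁻¹ ^ l := by positivity
  have hl4 : (2 : ℝ)⁻¹ ^ l ≤ t / ‖q‖ := by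
    refine hl1.le.trans (div_le_div_of_nonneg_left ht0.le hA0 ?_)
    exact le_mul_of_one_le_left hA0.le hn'
  have hl5 : t / ‖q‖ ≤ 2 * n * 2⁻¹ ^ l := by
    have : t / ‖q‖ = n * (t / (n * ‖q‖)) := by field_simp
    rw [this]
    calc (n : ℝ) * (t / (n * ‖q‖)) ≤ n * (2 * 2⁻¹ ^ l) := by gcongr
      _ = _ := by ring
  have hsum : ((∑ i, (q i).natAbs : ℕ) : ℝ) * 2⁻¹ ^ l ≤ t := by
    have h3 : ((∑ i, (q i).natAbs : ℕ) : ℝ) ≤ n * ‖q‖ := by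
      push_cast
      calc ∑ i, ((q i).natAbs : ℝ) ≤ ∑ _i : Fin n, ‖q‖ := by
            refine Finset.sum_le_sum fun i _ => le_trans (le_of_eq ?_) (norm_le_pi_norm q i)
            rw [Nat.cast_natAbs, Int.norm_eq_abs]; push_cast; rfl
        _ = _ := by simp
    calc _ ≤ n * ‖q‖ * (t / (n * ‖q‖)) := by gcongr
      _ = t := by field_simp
  obtain ⟨s, hs, hcard⟩ := exists_cells_of_prod_lt (m := m) hq ht0 ht1 hsum
    (A := toCols '' multSlice n m ψ q) (by
      rintro _ ⟨x, hx, rfl⟩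
      exact ⟨fun j i => hx.1 (i, j), hx.2⟩)
  choose pt hpt using toCols_surjective (n := n) (m := m)
  refine ⟨s.image pt, d * 2⁻¹ ^ l, by positivity, ?_, ?_, ?_⟩
  · rw [le_div_iff₀ hA0]
    have h3 : (2 : ℝ)⁻¹ ^ l * ‖q‖ ≤ 1 := by
      calc (2 : ℝ)⁻¹ ^ l * ‖q‖ ≤ t / ‖q‖ * ‖q‖ := by gcongr
        _ = t := by field_simp
        _ ≤ 1 := ht1.le
    calc 2 * (d * (2 : ℝ)⁻¹ ^ l) * ‖q‖ = 2 * d * ((2 : ℝ)⁻¹ ^ l * ‖q‖) := by ring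
      _ ≤ 2 * d * 1 := by gcongr
      _ ≤ _ := by rw [mul_one]; exact (le_max_right _ _).trans (le_max_right _ _)
  · intro x hx
    obtain ⟨y, hy, hxy⟩ := hs _ ⟨x, hx, rfl⟩
    refine Set.mem_biUnion (Finset.mem_image_of_mem pt hy) ?_
    rw [Metric.mem_closedBall]
    exact dist_le_of_dyIdx_eq (by rw [hpt]; exact hxy)
  · rw [seriesTerm_eq f ht0 hq, ← ht]
    set g := gaugeDensity d f (t / ‖q‖) with hg
    have hg0 : 0 ≤ g := hf.gaugeDensity_nonneg (by positivity)
    have hball : f (2 * (d * 2⁻¹ ^ l)) ≤ (2 * d) ^ d * (g * (2 * n * 2⁻¹ ^ l) ^ d) := by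
      calc f (2 * (d * 2⁻¹ ^ l)) = f (2 * d * 2⁻¹ ^ l) := by rw [mul_assoc]
        _ ≤ (2 * d) ^ d * f (2⁻¹ ^ l) := hf.map_mul_le hside (by linarith)
        _ ≤ (2 * d) ^ d * f (t / ‖q‖) := by
            gcongr
            exact hf.dimensionFunction.monotoneOn hside.le (hside.le.trans hl4) hl4
        _ = (2 * d) ^ d * (g * (t / ‖q‖) ^ d) := by
            rw [hg, gaugeDensity_mul_pow d f (by positivity)]
        _ ≤ _ := by gcongr
    have hball0 : 0 ≤ f (2 * (d * 2⁻¹ ^ l)) := hf.nonneg (by positivity)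
    calc ((s.image pt).card : ℝ) * f (2 * (d * 2⁻¹ ^ l))
        ≤ s.card * ((2 * d) ^ d * (g * (2 * n * 2⁻¹ ^ l) ^ d)) := by
          gcongr
          exact Finset.card_image_le
      _ = (2 * d) ^ d * (2 * n) ^ d * g * (s.card * ((2 : ℝ)⁻¹ ^ l) ^ d) := by
          rw [mul_pow (2 * (n : ℝ))]; ring
      _ ≤ (2 * d) ^ d * (2 * n) ^ d * g * (2 ^ d * 32 ^ m * shellVolume m (depth t - 1)) := by
          gcongr
      _ ≤ (2 * d) ^ d * (2 * n) ^ d * g * (2 ^ d * 32 ^ m * (C₁ * (t * Real.log t⁻¹ ^ (m - 1)))) := by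
          gcongr
          exact h2 t ht0 htc
      _ = _ := by ring

theorem hausdorffFMeasure_multSet_eq_zero (hf : IsAdmissible (n * m) f) (hn : 0 < n) (hm : 0 < m)
    (hmono : NonIncreasing ψ) (hψ : ∀ q, 0 < ψ q) (hfin : {q | 1 ≤ ψ q}.Finite)
    (hsum : Summable fun q : {q : Fin n → ℤ // q ≠ 0} => seriesTerm n m f ψ q) :
    hausdorffFMeasure f (multSet n m ψ) = 0 := by
  classical
  obtain ⟨R, hR, C, hC, hcover⟩ := hf.exists_cover_multSlice hn hm hmono hψ hfin
  refine le_antisymm (iSup₂_le fun η hη => ?_) (zero_le)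
  refine le_of_forall_gt fun ε hε => ?_
  have hne : ∑' q : {q : Fin n → ℤ // q ≠ 0}, ENNReal.ofReal (C * seriesTerm n m f ψ q) ≠ ⊤ :=
    (hsum.mul_left C).tsum_ofReal_ne_top
  have htail := (ENNReal.tendsto_tsum_compl_atTop_zero hne).eventually (gt_mem_nhds hε)
  -- beyond `F` the radii are small and the terms of the series sum to less than `ε`
  have hfar : {q : {q : Fin n → ℤ // q ≠ 0} | ‖(q : Fin n → ℤ)‖ ≤ max R (R / η)}.Finite :=
    (finite_norm_le _).preimage Subtype.val_injective.injOn
  obtain ⟨F, hF1, hF2⟩ := (htail.and (Filter.eventually_ge_atTop hfar.toFinset)).exists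
  have hlarge : ∀ q : {q : {q : Fin n → ℤ // q ≠ 0} // q ∉ F}, R ≤ ‖(q.1.1 : Fin n → ℤ)‖ ∧
      R / ‖(q.1.1 : Fin n → ℤ)‖ ≤ η := by
    intro q
    have h1 : max R (R / η) < ‖(q.1.1 : Fin n → ℤ)‖ := by
      by_contra! h
      exact q.2 (hF2 (hfar.mem_toFinset.2 h))
    have h2 : R < ‖(q.1.1 : Fin n → ℤ)‖ := (le_max_left _ _).trans_lt h1
    have h3 : R / η < ‖(q.1.1 : Fin n → ℤ)‖ := (le_max_right _ _).trans_lt h1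
    refine ⟨h2.le, ?_⟩
    rw [div_le_iff₀ (hR.trans h2), mul_comm, ← div_le_iff₀ hη]
    exact h3.le
  choose s r hr0 hr hs hmass using fun q : {q : {q : Fin n → ℤ // q ≠ 0} // q ∉ F} =>
    hcover q.1.1 q.1.2 (hlarge q).1
  have hdiam : ∀ p : (Σ q, s q), Metric.diam (Metric.closedBall p.2.1 (r p.1)) ≤ 2 * r p.1 :=
    fun p => Metric.diam_closedBall (hr0 p.1)
  refine lt_of_le_of_lt (hausdorffPremeasure_le_tsum (ι := Σ q, s q)
    hf.dimensionFunction.map_zero hη.le (fun p => p.2.1) (fun p => r p.1) ?_ fun p =>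
      (hdiam p).trans ((hr p.1).trans (hlarge p.1).2)) ?_
  · intro x hx
    have hinf := hx.2.sdiff ((F.image Subtype.val ∪ {0} : Finset (Fin n → ℤ)).finite_toSet)
    obtain ⟨q, hq1, hq2⟩ := hinf.nonempty
    rw [Finset.mem_coe, Finset.mem_union, Finset.mem_singleton, not_or] at hq2
    have hqF : (⟨q, hq2.2⟩ : {q : Fin n → ℤ // q ≠ 0}) ∉ F := fun h =>
      hq2.1 (Finset.mem_image_of_mem _ h)
    have := hs ⟨⟨q, hq2.2⟩, hqF⟩ ⟨hx.1, hq1⟩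
    obtain ⟨y, hy, hxy⟩ := Set.mem_iUnion₂.1 this
    exact Set.mem_iUnion.2 ⟨⟨⟨⟨q, hq2.2⟩, hqF⟩, ⟨y, hy⟩⟩, hxy⟩
  · refine lt_of_le_of_lt ?_ hF1
    rw [ENNReal.tsum_sigma' fun p : (Σ q, s q) =>
      ENNReal.ofReal (f (Metric.diam (Metric.closedBall p.2.1 (r p.1))))]
    refine ENNReal.tsum_le_tsum fun q => ?_
    rw [tsum_fintype]
    calc ∑ y : s q, ENNReal.ofReal (f (Metric.diam (Metric.closedBall y.1 (r q))))
        ≤ ∑ _y : s q, ENNReal.ofReal (f (2 * r q)) := by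
          refine Finset.sum_le_sum fun y _ => ENNReal.ofReal_le_ofReal ?_
          exact hf.dimensionFunction.monotoneOn Metric.diam_nonneg
            (mul_nonneg zero_le_two (hr0 q)) (hdiam ⟨q, y⟩)
      _ = ENNReal.ofReal ((s q).card * f (2 * r q)) := by
          rw [Finset.sum_const, nsmul_eq_mul, ENNReal.ofReal_mul (by positivity), ENNReal.ofReal_natCast]
          simp
      _ ≤ _ := ENNReal.ofReal_le_ofReal (hmass q)

end Convergence

/-! ### An admissible gauge function -/

section Example

/-- The gauge function `rᵈ * max (log (1/r)) 1`, written so as to be continuous at `0`. -/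
noncomputable def logGauge (d : ℕ) (r : ℝ) : ℝ := r ^ (d - 1) * max (-(r * Real.log r)) r

theorem logGauge_eq {d : ℕ} (hd : 0 < d) {r : ℝ} (hr : 0 < r) :
    logGauge d r = r ^ d * max (-Real.log r) 1 := by
  obtain ⟨k, rfl⟩ : ∃ k, d = k + 1 := ⟨d - 1, by omega⟩
  rw [logGauge, Nat.add_sub_cancel, pow_succ, mul_assoc, mul_max_of_nonneg _ _ hr.le, mul_neg, mul_one]

theorem monotoneOn_max_mul_log : MonotoneOn (fun r : ℝ => max (-(r * Real.log r)) r) (Set.Ici 0) := by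
  intro x hx y hy hxy
  rw [Set.mem_Ici] at hx hy
  refine max_le ?_ (hxy.trans (le_max_right _ _))
  rcases hx.eq_or_lt with rfl | hx0
  · simpa using Or.inr hy
  have hy0 : 0 < y := hx0.trans_le hxy
  set M := max (-Real.log y) 1 with hM
  have hkey : max (-(y * Real.log y)) y = y * M := by
    rw [hM, mul_max_of_nonneg _ _ hy, mul_neg, mul_one]
  have h1 : -Real.log x ≤ (y / x - 1) + -Real.log y := by
    have := Real.log_le_sub_one_of_pos (div_pos hy0 hx0)
    rw [Real.log_div hy0.ne' hx0.ne'] at this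
    linarith
  have h2 : 1 ≤ M := le_max_right _ _
  have h3 : -Real.log y ≤ M := le_max_left _ _
  refine le_of_le_of_eq ?_ hkey.symm
  calc -(x * Real.log x) = x * -Real.log x := by ring
    _ ≤ x * ((y / x - 1) + -Real.log y) := by gcongr
    _ = (y - x) * 1 + x * -Real.log y := by field_simp
    _ ≤ (y - x) * M + x * M := by
        have : 0 ≤ y - x := sub_nonneg.2 hxy
        gcongr
    _ = _ := by ring

theorem growthCondition_logGauge {d : ℕ} (hd : 0 < d) : GrowthCondition d (logGauge d) := by
  intro t ht0 ht1
  have ht : 0 < 1 - t := by linarith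
  refine ⟨1, one_pos, (1 - t)⁻¹, by positivity, fun r α hr hα hαt hαr => ?_⟩
  have hα0 : 0 < α := by linarith
  have hr1 : r < 1 := by nlinarith
  have hαr0 : 0 < α * r := by positivity
  have hlogα : Real.log α ≤ t * -Real.log r := by
    have := Real.log_le_log hα0 hαt.le
    rw [Real.log_rpow hr] at this
    linarith
  have hlogα0 : 0 ≤ Real.log α := Real.log_nonneg hα.le
  have hlog : Real.log (α * r) = Real.log α + Real.log r := Real.log_mul hα0.ne' hr.ne'
  set M := max (-Real.log r) 1 with hM
  set M' := max (-Real.log (α * r)) 1 with hM'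
  have hM0 : 0 < M := one_pos.trans_le (le_max_right _ _)
  have hup : M' ≤ M := by
    refine max_le_max ?_ le_rfl
    rw [hlog]; linarith
  have hlow : (1 - t) * M ≤ M' := by
    rw [hM, mul_max_of_nonneg _ _ ht.le]
    refine max_le_max ?_ (by linarith)
    rw [hlog]; linarith
  have hratio : logGauge d (α * r) / logGauge d r = α ^ d * (M' / M) := by
    rw [logGauge_eq hd hαr0, logGauge_eq hd hr, ← hM, ← hM', mul_pow]
    field_simp
  rw [hratio, inv_inv]
  have hαd : 0 < α ^ d := by positivity
  constructor
  · rw [mul_comm]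
    gcongr
    rwa [le_div_iff₀ hM0]
  · rw [mul_comm]
    gcongr
    calc M' / M ≤ 1 := (div_le_one hM0).2 hup
      _ ≤ (1 - t)⁻¹ := (one_le_inv₀ ht).2 (by linarith)

theorem isAdmissible_logGauge {d : ℕ} (hd : 0 < d) : IsAdmissible d (logGauge d) where
  dimensionFunction :=
    { continuousOn := by
        have h := Real.continuous_mul_log
        have : Continuous (logGauge d) := by
          unfold logGauge
          exact (continuous_id.pow _).mul (h.neg.max continuous_id)
        exact this.continuousOn
      monotoneOn := by
        intro x hx y hy hxy
        have h1 := monotoneOn_max_mul_log hx hy hxy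
        have h2 : 0 ≤ max (-(x * Real.log x)) x := le_max_of_le_right hx
        exact mul_le_mul (pow_le_pow_left₀ hx hxy _) h1 h2 (pow_nonneg hy _)
      map_zero := by simp [logGauge] }
  eqPrec := by
    intro x y hx hxy
    have hy := hx.trans hxy
    have key : ∀ z : ℝ, 0 < z → logGauge d z / z ^ ((d : ℝ) - 1) = max (-(z * Real.log z)) z := by
      intro z hz
      have : (d : ℝ) - 1 = ((d - 1 : ℕ) : ℝ) := by rw [Nat.cast_sub hd, Nat.cast_one]
      rw [this, Real.rpow_natCast, logGauge, mul_div_cancel_left₀ _ (by positivity)]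
    rw [key x hx, key y hy]
    exact monotoneOn_max_mul_log hx.le hy.le hxy.le
  prec := by
    have key : ∀ z : ℝ, 0 < z → logGauge d z / z ^ (d : ℝ) = max (-Real.log z) 1 := by
      intro z hz
      rw [Real.rpow_natCast, logGauge_eq hd hz, mul_div_cancel_left₀ _ (by positivity)]
    refine ⟨fun x y hx hxy => ?_, ?_⟩
    · rw [key x hx, key y (hx.trans hxy)]
      exact max_le_max (neg_le_neg (Real.log_le_log hx hxy.le)) le_rfl
    · refine Filter.Tendsto.congr' (f₁ := fun z => max (-Real.log z) 1) ?_ ?_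
      · filter_upwards [self_mem_nhdsWithin] with z hz using (key z hz).symm
      · exact Filter.tendsto_atTop_mono (fun z => le_max_left _ _)
          (Filter.tendsto_neg_atBot_atTop.comp Real.tendsto_log_nhdsGT_zero)
  growth := growthCondition_logGauge hd

theorem logGauge_eq_of_lt {d : ℕ} (hd : 0 < d) {r : ℝ} (hr : 0 < r) (hr' : r < Real.exp (-1)) :
    logGauge d r = r ^ d * Real.log (1 / r) := by
  have h1 : Real.log r ≤ -1 := by
    rw [← Real.log_exp (-1)]
    exact Real.log_le_log hr hr'.le
  rw [logGauge_eq hd hr, one_div, Real.log_inv, max_eq_left (by linarith)]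

end Example

/-! ### The zero-infinity law -/

theorem theorem1p9 (n m : ℕ) (hn : 1 < n) (hm : 1 < m) :
    (∀ (ψ : (Fin n → ℤ) → ℝ) (f : ℝ → ℝ),
      (∀ q, 0 < ψ q) → {q | 1 ≤ ψ q}.Finite → NonIncreasing ψ → IsAdmissible (n * m) f →
        (Summable (fun q : {q : Fin n → ℤ // q ≠ 0} => seriesTerm n m f ψ q) →
          hausdorffFMeasure f (multSet n m ψ) = 0) ∧
        (¬ Summable (fun q : {q : Fin n → ℤ // q ≠ 0} => seriesTerm n m f ψ q) →
          hausdorffFMeasure f (multSet n m ψ) = hausdorffFMeasure f (unitCube n m))) ∧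
    ∃ f : ℝ → ℝ, IsAdmissible (n * m) f ∧
      ∃ ρ : ℝ, 0 < ρ ∧ ∀ r : ℝ, 0 < r → r < ρ → f r = r ^ (n * m) * Real.log (1 / r) := by
  have hn0 : 0 < n := by omega
  have hm0 : 0 < m := by omega
  have hd : 0 < n * m := Nat.mul_pos hn0 hm0
  refine ⟨fun ψ f hψ hfin hmono hf =>
    ⟨hausdorffFMeasure_multSet_eq_zero hf hn0 hm0 hmono hψ hfin, fun hdiv => ?_⟩,
    logGauge (n * m), isAdmissible_logGauge hd, Real.exp (-1), Real.exp_pos _,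
    fun r hr hr' => logGauge_eq_of_lt hd hr hr'⟩
  have htop : hausdorffFMeasure f (multSet n m ψ) = ⊤ := by
    by_contra h
    exact hdiv (summable_of_hausdorffFMeasure_ne_top hf hm0 hmono hn0 hψ hfin h)
  rw [htop, eq_comm, eq_top_iff, ← htop]
  exact hausdorffFMeasure_mono f fun x hx => hx.1
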